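/- Let $k$ be an algebraically closed field of arbitrary characteristic, and let $X\subset\mathbb A^N$ be a non-empty closed subscheme over $k$ with ideal $I_X=(f_1,\dots,f_m)\subset k[x_1,\dots,x_N]$. Let $d$ be the minimum of the dimensions of the irreducible components of $X$ and put $r=N-d$. For a closed subscheme $Y\subset\mathbb A^N$ with ideal $I_Y$, let $\mathcal L(Y)$ be the set of arcs on $Y$, i.e. of $\gamma\in k[[t]]^N$ with $F(\gamma)=0$ for all $F\in I_Y$. For $n\in\mathbb N$ let $\pi_n$ be truncation modulo $t^{n+1}$, which maps $\mathcal L(\mathbb A^N)=k[[t]]^N$ to the set of $n$-jets on $\mathbb A^N$; the latter is identified, through coefficients, with the affine space $k^{N(n+1)}$ with its Zariski topology. If $Y$ has ideal $(h_1,\dots,h_s)$ and $0\le e_1\le\dots\le e_p$ are integers with $p\le\min\{s,N\}$, let $\mathcal L^{e_1,\dots,e_p}(Y)$ be the set of $\gamma\in\mathcal L(Y)$ such that the quotient of $k[[t]]^N$ by the submodule generated by the rows of $\bigl(\frac{\partial h_i}{\partial x_j}(\gamma)\bigr)_{i,j}$ is isomorphic to $\bigoplus_{i=1}^p k[[t]]/(t^{e_i})\oplus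 k[[t]]^{N-p}$; for $\gamma$ in this set write $p(Y;\gamma)=p$ and $e_i(Y;\gamma)=e_i$ (these do not depend on the chosen generators of the ideal). Let $\mathrm{Jac}_X$ be the closed subscheme defined by the ideal generated by $I_X$ and all $r\times r$ minors of the Jacobian matrices of $r$ elements of $I_X$. In the case $r=0$, read $e_r$ as $0$. (a) Let $\gamma\in\mathcal L(X)\setminus\mathcal L(\mathrm{Jac}_X)$. Then $p(X;\gamma)=r$. Put $e_i=e_i(X;\gamma)$ for $i=1,\dots,r$, and for $l\in\mathbb N$ put $A_l=\{\rho\in\mathcal L(\mathbb A^N)\mid \pi_l(\rho)=\pi_l(\gamma)\}$. Then: (i) if $M$ is a closed subscheme of $\mathbb A^N$ defined by $r$ elements $g_1,\dots,g_r$ of $I_X$ such that $\gamma\in\mathcal L^{e_1,\dots,e_r}(M)$, then $\mathcal L(M)\cap A_l=\mathcal L(X)\cap A_l$ for every $l\ge e_r$; (ii) for $n>l\ge e_r$, the set $\pi_n(\mathcal L(X)\cap A_l)$ is closed and, with its reduced structure, isomorphic to $\mathbb A^{(n-l)d}$. (b) Let $0\le e_1\le\dots\le e_r$ be integers. For $l\ge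 e_r$ the set $\pi_l(\mathcal L^{e_1,\dots,e_r}(X))$ is constructible, and for $n>l\ge e_r$ the truncation map \[\pi_n(\mathcal L^{e_1,\dots,e_r}(X))\to\pi_l(\mathcal L^{e_1,\dots,e_r}(X))\] is a piecewise trivial fibration with fibre $\mathbb A^{(n-l)d}$: the target has a finite partition into locally closed subsets $S$ of the affine space of $l$-jets on $\mathbb A^N$ whose inverse images (in the source) are locally closed and isomorphic to $S\times\mathbb A^{(n-l)d}$ as varieties, the truncation map corresponding to the projection onto $S$. -/

import Mathlib

namespace ArcTruncation

variable {k : Type*} [Field k]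

/-! ### Affine space with its Zariski topology -/

/-- The closed points of the affine space over `k` with coordinates indexed by `σ`
(over an algebraically closed field). -/
abbrev AffSpace (k : Type*) (σ : Type*) : Type _ := σ → k

/-- The Zariski topology, as the topology induced from `Spec k[x_σ]`. -/
@[reducible] noncomputable def zariskiTopology (k : Type*) [Field k] (σ : Type*) :
    TopologicalSpace (AffSpace k σ) :=
  TopologicalSpace.induced
    (fun x => (MvPolynomial.pointToPoint x : PrimeSpectrum (MvPolynomial σ k))) inferInstance

/-- Closed subsets of affine space. -/
def ZariskiClosed {σ : Type*} (S : Set (AffSpace k σ)) : Prop :=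
  @IsClosed _ (zariskiTopology k σ) S

/-- Locally closed subsets of affine space. -/
def ZariskiLocallyClosed {σ : Type*} (S : Set (AffSpace k σ)) : Prop :=
  @IsLocallyClosed _ (zariskiTopology k σ) S

/-- Constructible subsets of affine space. -/
def ZariskiConstructible {σ : Type*} (S : Set (AffSpace k σ)) : Prop :=
  @Topology.IsConstructible _ (zariskiTopology k σ) S

/-- The Zariski closed sets are the zero sets of families of polynomials. -/
theorem zariskiClosed_iff {σ : Type*} (S : Set (AffSpace k σ)) :
    ZariskiClosed S ↔ ∃ T : Set (MvPolynomial σ k),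
      S = {x | ∀ F ∈ T, MvPolynomial.eval x F = 0} := by
  have key : ∀ (T : Set (MvPolynomial σ k)) (x : σ → k),
      (MvPolynomial.pointToPoint x : PrimeSpectrum (MvPolynomial σ k)) ∈
        PrimeSpectrum.zeroLocus T ↔ ∀ F ∈ T, MvPolynomial.eval x F = 0 := by
    intro T x
    rw [PrimeSpectrum.mem_zeroLocus]
    change (∀ F ∈ T, F ∈ MvPolynomial.vanishingIdeal k {x}) ↔ _
    simp only [MvPolynomial.mem_vanishingIdeal_singleton_iff]
    rfl
  let _ := zariskiTopology k σ
  refine (isClosed_induced_iff (s := S)).trans ?_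
  constructor
  · rintro ⟨C, hC, rfl⟩
    obtain ⟨T, rfl⟩ := (PrimeSpectrum.isClosed_iff_zeroLocus C).1 hC
    exact ⟨T, Set.ext fun x => key T x⟩
  · rintro ⟨T, rfl⟩
    exact ⟨PrimeSpectrum.zeroLocus T, PrimeSpectrum.isClosed_zeroLocus T,
      Set.ext fun x => key T x⟩

/-- `φ` is a regular function on `S`: locally on `S` (for the Zariski topology) it is a quotient
of two polynomials. The values of `φ` outside `S` are irrelevant. -/
def IsRegularOn {σ : Type*} (S : Set (AffSpace k σ)) (φ : AffSpace k σ → k) : Prop :=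
  ∀ x ∈ S, ∃ P Q : MvPolynomial σ k, MvPolynomial.eval x Q ≠ 0 ∧
    ∀ y ∈ S, MvPolynomial.eval y Q ≠ 0 → φ y = MvPolynomial.eval y P / MvPolynomial.eval y Q

/-- `Φ` and `Ψ` restrict to mutually inverse morphisms of (reduced) varieties between `S`
and `T`. -/
structure IsIsoOn {σ τ : Type*} (S : Set (AffSpace k σ)) (T : Set (AffSpace k τ))
    (Φ : AffSpace k σ → AffSpace k τ) (Ψ : AffSpace k τ → AffSpace k σ) : Prop where
  mapsTo : Set.MapsTo Φ S T
  mapsTo_symm : Set.MapsTo Ψ T S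
  left_inv : Set.LeftInvOn Ψ Φ S
  right_inv : Set.RightInvOn Ψ Φ T
  regular : ∀ j, IsRegularOn S fun x => Φ x j
  regular_symm : ∀ i, IsRegularOn T fun y => Ψ y i

/-- `S`, with its reduced structure, is a closed subvariety isomorphic to the affine space
of dimension `a`. -/
def IsoAffine {σ : Type*} (S : Set (AffSpace k σ)) (a : ℕ) : Prop :=
  ZariskiClosed S ∧ ∃ (Φ : AffSpace k σ → AffSpace k (Fin a)) (Ψ : AffSpace k (Fin a) → AffSpace k σ),
    IsIsoOn S Set.univ Φ Ψ

/-- The product of `S` with the affine space of dimension `a`. -/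
def prodAffine {τ : Type*} (S : Set (AffSpace k τ)) (a : ℕ) : Set (AffSpace k (τ ⊕ Fin a)) :=
  {z | (fun j => z (Sum.inl j)) ∈ S}

/-- `q : A → B` is a piecewise trivial fibration with fibre the affine space of dimension `a`:
`B` has a finite partition into locally closed subsets `S` such that the inverse image of `S` in
`A` is locally closed and isomorphic to the product of `S` with the fibre, `q` corresponding to
the projection onto `S`. -/
def IsPiecewiseTrivialFibration {σ τ : Type*} (A : Set (AffSpace k σ)) (B : Set (AffSpace k τ))
    (q : AffSpace k σ → AffSpace k τ) (a : ℕ) : Prop :=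
  Set.MapsTo q A B ∧
  ∃ parts : Set (Set (AffSpace k τ)),
    parts.Finite ∧ parts.PairwiseDisjoint id ∧ ⋃₀ parts = B ∧
    ∀ S ∈ parts, ZariskiLocallyClosed S ∧ ZariskiLocallyClosed (A ∩ q ⁻¹' S) ∧
      ∃ (Φ : AffSpace k σ → AffSpace k (τ ⊕ Fin a)) (Ψ : AffSpace k (τ ⊕ Fin a) → AffSpace k σ),
        IsIsoOn (A ∩ q ⁻¹' S) (prodAffine S a) Φ Ψ ∧
        ∀ x ∈ A ∩ q ⁻¹' S, ∀ j, Φ x (Sum.inl j) = q x j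

/-! ### Arcs and jets -/

/-- Arcs on the affine space of dimension `N`: `N`-tuples of formal power series. -/
abbrev Arc (k : Type*) [Field k] (N : ℕ) : Type _ := Fin N → PowerSeries k

/-- `n`-jets on the affine space of dimension `N`: `N`-tuples of truncated series
`a_{i,0} + a_{i,1} t + ⋯ + a_{i,n} t ^ n`, given by their coefficients. -/
abbrev Jet (k : Type*) (N n : ℕ) : Type _ := AffSpace k (Fin N × Fin (n + 1))

/-- The truncation of an arc to an `n`-jet. -/
noncomputable def arcTrunc {N : ℕ} (n : ℕ) (γ : Arc k N) : Jet k N n :=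
  fun ij => PowerSeries.coeff (ij.2 : ℕ) (γ ij.1)

/-- The truncation of an `n`-jet to an `l`-jet. -/
def jetTrunc {N n l : ℕ} (h : l ≤ n) (θ : Jet k N n) : Jet k N l :=
  fun ij => θ (ij.1, Fin.castLE (Nat.succ_le_succ h) ij.2)

/-- The arcs on the closed subscheme defined by `I`. -/
def arcs {N : ℕ} (I : Ideal (MvPolynomial (Fin N) k)) : Set (Arc k N) :=
  {γ | ∀ F ∈ I, MvPolynomial.aeval γ F = 0}

/-- The arcs with the same `l`-jet as `γ`. -/
def sameJet {N : ℕ} (l : ℕ) (γ : Arc k N) : Set (Arc k N) :=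
  {ρ | arcTrunc l ρ = arcTrunc l γ}

/-- The Jacobian matrix of `f_1, …, f_m`, evaluated at the arc `γ`. -/
noncomputable def jacobianAt {N m : ℕ} (f : Fin m → MvPolynomial (Fin N) k) (γ : Arc k N) :
    Matrix (Fin m) (Fin N) (PowerSeries k) :=
  Matrix.of fun i j => MvPolynomial.aeval γ (MvPolynomial.pderiv j (f i))

/-- `t ^ e_1, …, t ^ e_p` are the invariant factors of the quotient of `k[[t]] ^ N` by the module
generated by the rows of the Jacobian matrix of `f` at `γ`. Exponents `e_i = 0` are allowed;
`p` is the rank of the matrix. -/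
def HasInvariantFactors {N m p : ℕ} (f : Fin m → MvPolynomial (Fin N) k) (γ : Arc k N)
    (e : Fin p → ℕ) : Prop :=
  p ≤ min m N ∧ Monotone e ∧
    Nonempty (((Fin N → PowerSeries k) ⧸
        Submodule.span (PowerSeries k) (Set.range (jacobianAt f γ).row)) ≃ₗ[PowerSeries k]
      (((i : Fin p) → PowerSeries k ⧸ Ideal.span {(PowerSeries.X : PowerSeries k) ^ e i}) ×
        (Fin (N - p) → PowerSeries k)))

/-- The arcs on the subscheme with ideal `(f_1, …, f_m)` whose invariant factors
are `t ^ e_1, …, t ^ e_p`. -/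
def arcsWith {N m p : ℕ} (f : Fin m → MvPolynomial (Fin N) k) (e : Fin p → ℕ) : Set (Arc k N) :=
  {γ | γ ∈ arcs (Ideal.span (Set.range f)) ∧ HasInvariantFactors f γ e}

/-- `d` is the minimum of the dimensions of the irreducible components of the closed subscheme
defined by `I`. -/
def IsMinComponentDim {N : ℕ} (I : Ideal (MvPolynomial (Fin N) k)) (d : ℕ) : Prop :=
  IsLeast {δ : ℕ | ∃ P ∈ I.minimalPrimes, ringKrullDim (MvPolynomial (Fin N) k ⧸ P) = δ} d

/-- The ideal generated by `I` and the `r × r` minors of the Jacobian matrices of `r` elements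
of `I`. -/
noncomputable def jacIdeal {N : ℕ} (I : Ideal (MvPolynomial (Fin N) k)) (r : ℕ) :
    Ideal (MvPolynomial (Fin N) k) :=
  I ⊔ Ideal.span {D | ∃ (g : Fin r → MvPolynomial (Fin N) k) (c : Fin r ↪o Fin N),
    (∀ i, g i ∈ I) ∧ D = (Matrix.of fun i j => MvPolynomial.pderiv (c j) (g i)).det}

end ArcTruncation

open ArcTruncation

/-!
The geometry of arcs is governed by two facts.

*Newton's method.* Let `g₁, …, g_r` be polynomials and `γ` a tuple of power series over a `k`-algebra
`A`, and split the `N` coordinates into `r` and `d = N - r` of them, so that the Jacobian matrix of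
`g` at `γ` has a square block `K` and a remaining block. If `K` divides `t ^ l` and the remaining
block, and `t ^ (l + 1) K` divides `g(γ)` (`LiftData`), then substituting `γ + t ^ (l + 1) u` into
`g` and dividing by `t ^ (l + 1) K` gives an equation `v + w + H z + t Q(w, z) = 0` for the two parts
`w`, `z` of `u`. It has a unique solution `w` for every `z` (`LiftData.existsUnique`), and `w` modulo
`t ^ n` depends only on `z` modulo `t ^ n` (`LiftData.congr_of_congr`). For an arc on the scheme with
`r` invariant factors, all with exponents at most `l`, such data come from the rows and columns of a
nonzero `r × r` minor of least order `E`; they amount to the divisibility conditions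
`MinorConditions`, which can be tested on the `l`-jet alone
(`HasInvariantFactors.exists_minorConditions`, `exists_minorConditions_jetArc`). That `A` is
arbitrary allows families: over a set `S` of `l`-jets one takes for `A` the algebra of regular
functions on `S`, and the solutions depend regularly on the `l`-jet and on `z` (`exists_family`).

*Complete intersections.* If an arc `γ` on the scheme has a nonzero `p × p` Jacobian minor of elements
`g₁, …, g_p` of the ideal, then a rational point in the closure of `γ` at which the minor does not
vanish is, by the Jacobian criterion, a regular point of the scheme `g = 0`, of codimension `p`. Hence
`p ≤ N - d`, and if `p = N - d` then the scheme and `g = 0` coincide locally at the generic point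
of `γ` (`le_and_exists_mul_mem_span`). Two solutions of `g = 0` with the same `l`-jet are the values at `0`
and `1` of a family of solutions over `k[X]`. If the first lies on the scheme, then each `F` in the
ideal has a multiple `s F` in `(g₁, …, g_r)` with `s` nonzero at the first solution, hence nonzero on
the family, so that `F` vanishes on the family and at the second solution (`LiftData.aeval_eq_zero`).

The first part of the theorem follows: the number of invariant factors is at most `N - d` by the second
fact and at least `N - d` outside the Jacobian subscheme, and the arcs with a given `l`-jet are
parametrized by `z`.

For the second part one needs that the truncation of a stratum is a finite union of locally closed
sets. The ranks of the block Toeplitz matrices of the Jacobian matrix are determined by the invariant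
factors and conversely, and those of order at most `l + 1` depend only on the `l`-jet
(`hasInvariantFactors_iff_rank_toeplitz`); ranks and `MinorConditions` define locally closed sets
of jets, and the condition that the jet lifts to an arc on the scheme is closed there, since it
can be tested on the solution with `z = 0` (`isLocallyClosed_jetStratum`). Over a locally closed part
of such a set, `n`-jets correspond to `l`-jets together with the coefficients of `z` of order less than
`n - l` (`exists_isIsoOn`), and a finite union of locally closed sets has a finite partition into
locally closed subsets of its members (`exists_partition_of_isLocallyClosed`).
-/

open ArcTruncation

/-! ### Regular local rings -/

/-- A Noetherian local ring whose maximal ideal is generated by at most `dim R` elements is a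
domain. -/
theorem IsLocalRing.isDomain_of_maximalIdeal_eq_span (n : ℕ) :
    ∀ {R : Type*} [CommRing R] [IsLocalRing R] [IsNoetherianRing R] (s : Set R),
      maximalIdeal R = Ideal.span s → s.encard ≤ n → (n : WithBot ℕ∞) ≤ ringKrullDim R →
      IsDomain R := by
  induction n with
  | zero =>
    intro R _ _ _ s hs hn _
    have hs0 : s = ∅ := by simpa using hn
    subst hs0
    rw [Ideal.span_empty] at hs
    exact (IsLocalRing.isField_iff_maximalIdeal_eq.2 hs).isDomain
  | succ n ih =>
    intro R _ _ _ s hs hn hdim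
    classical
    have hht : (maximalIdeal R).height ≠ 0 := by
      intro h0
      rw [← IsLocalRing.maximalIdeal_height_eq_ringKrullDim, h0] at hdim
      have : ((n + 1 : ℕ) : ℕ∞) ≤ 0 := by exact_mod_cast hdim
      simp at this
    have hfg : (maximalIdeal R).FG := IsNoetherian.noetherian _
    -- an element outside the square of the maximal ideal and outside all minimal primes
    obtain ⟨x, hxm, hx2, hxmin⟩ : ∃ x ∈ maximalIdeal R, x ∉ maximalIdeal R ^ 2 ∧
        ∀ p ∈ minimalPrimes R, x ∉ p := by
      by_contra! hcon
      have hfin : (minimalPrimes R).Finite := minimalPrimes.finite_of_isNoetherianRing R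
      have hsub : ((maximalIdeal R : Ideal R) : Set R) ⊆
          ⋃ i ∈ ((insert (maximalIdeal R ^ 2) hfin.toFinset : Finset (Ideal R)) : Set (Ideal R)),
            ((id i : Ideal R) : Set R) := by
        intro x hx
        by_cases h2 : x ∈ maximalIdeal R ^ 2
        · exact Set.mem_biUnion (x := maximalIdeal R ^ 2) (by simp) h2
        · obtain ⟨p, hp, hxp⟩ := hcon x hx h2
          exact Set.mem_biUnion (x := p) (by simp [hp]) hxp
      rw [Ideal.subset_union_prime (maximalIdeal R ^ 2) (maximalIdeal R ^ 2)] at hsub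
      · obtain ⟨i, hi, hle⟩ := hsub
        rcases Finset.mem_insert.1 hi with rfl | hi
        · have hbot : maximalIdeal R = ⊥ :=
            Submodule.eq_bot_of_le_smul_of_le_jacobson_bot (maximalIdeal R) _ hfg
              (by simpa [pow_two] using hle)
              (IsLocalRing.maximalIdeal_le_jacobson _)
          apply hht
          rw [hbot, Ideal.height_bot]
        · have hi' : i ∈ minimalPrimes R := by simpa using hi
          have hip : i.IsPrime := hi'.1.1
          have h0 : i.height = 0 := Ideal.height_eq_zero_iff.2 hi'
          exact hht (le_antisymm ((Ideal.height_mono hle).trans h0.le) bot_le)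
      · intro i hi h1 _
        rcases Finset.mem_insert.1 hi with rfl | hi
        · exact absurd rfl h1
        · have hi' : i ∈ minimalPrimes R := by simpa using hi
          exact hi'.1.1
    -- exchange one generator for `x`
    obtain ⟨y, hy, hspan⟩ : ∃ y ∈ s, maximalIdeal R = Ideal.span (insert x (s \ {y})) := by
      have hx' : x ∈ Ideal.span s := hs ▸ hxm
      obtain ⟨c, T, hT, -, hsum⟩ := Submodule.mem_span_iff_exists_finset_subset.1 hx'
      obtain ⟨y, hyT, hcy⟩ : ∃ y ∈ T, c y ∉ maximalIdeal R := by
        by_contra! hcon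
        refine hx2 (hsum ▸ Ideal.sum_mem _ fun y hy => ?_)
        rw [pow_two]
        exact Ideal.mul_mem_mul (hcon y hy) (hs ▸ Ideal.subset_span (hT hy))
      refine ⟨y, hT hyT, le_antisymm ?_ ?_⟩
      · rw [hs, Ideal.span_le]
        intro z hz
        by_cases hzy : z = y
        · subst hzy
          have hu : IsUnit (c z) := by simpa using hcy
          obtain ⟨u, hu⟩ := hu
          have hz' : z = ↑u⁻¹ * (x - ∑ a ∈ T.erase z, c a • a) := by
            rw [← hsum, ← Finset.add_sum_erase T _ hyT, add_sub_cancel_right, smul_eq_mul, ← hu,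
              Units.inv_mul_cancel_left]
          suffices h : ↑u⁻¹ * (x - ∑ a ∈ T.erase z, c a • a) ∈ Ideal.span (insert x (s \ {z})) by
            rwa [← hz'] at h
          refine Ideal.mul_mem_left _ _ (Ideal.sub_mem _ (Ideal.subset_span (by simp)) ?_)
          refine Ideal.sum_mem _ fun a ha => Ideal.mul_mem_left _ _ (Ideal.subset_span ?_)
          exact Or.inr ⟨hT (Finset.mem_of_mem_erase ha), (Finset.mem_erase.1 ha).1⟩
        · exact Ideal.subset_span (Or.inr ⟨hz, hzy⟩)
      · rw [Ideal.span_le, Set.insert_subset_iff]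
        exact ⟨hxm, fun z hz => hs ▸ Ideal.subset_span hz.1⟩
    have hxs : ({x} : Set R) ⊆ Ring.jacobson R := by
      rw [IsLocalRing.ringJacobson_eq_maximalIdeal]
      simpa using hxm
    have hxu : Ideal.span {x} ≤ maximalIdeal R := by
      rw [Ideal.span_le]; simpa using hxm
    have hne : Ideal.span {x} ≠ ⊤ := fun h => (maximalIdeal.isMaximal R).ne_top (top_le_iff.1 (h ▸ hxu))
    have : Nontrivial (R ⧸ Ideal.span {x}) := Ideal.Quotient.nontrivial_iff.2 hne
    have hloc : IsLocalRing (R ⧸ Ideal.span {x}) :=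
      IsLocalRing.of_surjective' (Ideal.Quotient.mk _) Ideal.Quotient.mk_surjective
    have hdom : IsDomain (R ⧸ Ideal.span {x}) := by
      refine ih (Ideal.Quotient.mk (Ideal.span {x}) '' (s \ {y})) ?_ ?_ ?_
      · rw [← IsLocalRing.map_maximalIdeal_of_surjective _ Ideal.Quotient.mk_surjective, hspan,
          Ideal.map_span, Set.image_insert_eq, Ideal.Quotient.eq_zero_iff_mem.2
            (Ideal.mem_span_singleton_self x), Ideal.span_insert_zero]
      · refine (Set.encard_image_le _ _).trans ?_
        have := Set.encard_sdiff_singleton_add_one hy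
        rw [← this] at hn
        push_cast at hn
        exact (ENat.add_le_add_iff_right (by simp)).1 hn
      · have := hdim.trans (ringKrullDim_le_ringKrullDim_quotient_add_encard {x} hxs)
        simp only [Set.encard_singleton] at this
        push_cast at this
        exact ENat.WithBot.add_le_add_one_right_iff.1 (by exact_mod_cast this)
    have hprime : (Ideal.span {x}).IsPrime := (Ideal.Quotient.isDomain_iff_prime _).1 hdom
    obtain ⟨p, hp, hpx⟩ := Ideal.exists_minimalPrimes_le (I := ⊥) (J := Ideal.span {x}) bot_le
    have hpp : p.IsPrime := hp.1.1
    have hxp : x ∉ p := hxmin p hp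
    have hpbot : p = ⊥ := by
      refine Submodule.eq_bot_of_le_smul_of_le_jacobson_bot (maximalIdeal R) p
        (IsNoetherian.noetherian _) ?_ (IsLocalRing.maximalIdeal_le_jacobson _)
      intro a ha
      obtain ⟨b, rfl⟩ := Ideal.mem_span_singleton'.1 (hpx ha)
      have hb : b ∈ p := (hpp.mem_or_mem ha).resolve_right hxp
      rw [mul_comm]
      exact Submodule.smul_mem_smul hxm hb
    subst hpbot
    exact (IsDomain.of_bot_isPrime R)

/-- In a regular local ring, part of a regular system of parameters generates a prime ideal. -/
theorem IsLocalRing.isPrime_span_of_maximalIdeal_eq_span {R : Type*} [CommRing R] [IsLocalRing R]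
    [IsNoetherianRing R] (S T : Set R) (a b : ℕ) (h : maximalIdeal R = Ideal.span (S ∪ T))
    (hS : S.encard ≤ a) (hT : T.encard ≤ b) (hdim : ((a + b : ℕ) : WithBot ℕ∞) ≤ ringKrullDim R) :
    (Ideal.span S).IsPrime := by
  have hSm : Ideal.span S ≤ maximalIdeal R := h ▸ Ideal.span_mono Set.subset_union_left
  have hSj : S ⊆ Ring.jacobson R := by
    rw [IsLocalRing.ringJacobson_eq_maximalIdeal]
    exact Ideal.subset_span.trans hSm
  have hne : Ideal.span S ≠ ⊤ := fun h =>
    (maximalIdeal.isMaximal R).ne_top (top_le_iff.1 (h ▸ hSm))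
  have : Nontrivial (R ⧸ Ideal.span S) := Ideal.Quotient.nontrivial_iff.2 hne
  have hloc : IsLocalRing (R ⧸ Ideal.span S) :=
    IsLocalRing.of_surjective' (Ideal.Quotient.mk _) Ideal.Quotient.mk_surjective
  rw [← Ideal.Quotient.isDomain_iff_prime]
  refine IsLocalRing.isDomain_of_maximalIdeal_eq_span b (Ideal.Quotient.mk (Ideal.span S) '' T)
    ?_ ((Set.encard_image_le _ _).trans hT) ?_
  · rw [← IsLocalRing.map_maximalIdeal_of_surjective _ Ideal.Quotient.mk_surjective, h,
      Ideal.span_union, Ideal.map_sup, Ideal.map_quotient_self, bot_sup_eq, Ideal.map_span]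
  · have h1 := hdim.trans (ringKrullDim_le_ringKrullDim_quotient_add_encard S hSj)
    have h2 : ((b : WithBot ℕ∞) + (a : ℕ)) ≤ ringKrullDim (R ⧸ Ideal.span S) + (a : ℕ) := by
      rw [add_comm a b] at h1
      push_cast at h1
      refine h1.trans ?_
      gcongr
      exact_mod_cast hS
    exact ENat.WithBot.add_le_add_natCast_right_iff.1 h2

/-- In a regular local ring, `p` elements of a regular system of parameters generate an ideal of
height at least `p`. -/
theorem IsLocalRing.le_height_span_of_maximalIdeal_eq_span {R : Type*} [CommRing R] [IsLocalRing R]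
    [IsNoetherianRing R] (p : ℕ) : ∀ (g : Fin p → R) (T : Set R) (b : ℕ),
      maximalIdeal R = Ideal.span (Set.range g ∪ T) → T.encard ≤ b →
      ((p + b : ℕ) : WithBot ℕ∞) ≤ ringKrullDim R → (p : ℕ∞) ≤ (Ideal.span (Set.range g)).height := by
  have hcard : ∀ (q : ℕ) (g : Fin q → R), (Set.range g).encard ≤ q := by
    intro q g
    rw [← Set.image_univ]
    refine (Set.encard_image_le _ _).trans ?_
    simp
  induction p with
  | zero => intro g T b _ _ _; simp
  | succ p ih =>
    intro g T b h hT hdim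
    have hrange : Set.range g = insert (g (Fin.last p)) (Set.range fun i : Fin p => g i.castSucc) := by
      ext x
      constructor
      · rintro ⟨i, rfl⟩
        refine Fin.lastCases (Or.inl rfl) (fun i => Or.inr ⟨i, rfl⟩) i
      · rintro (rfl | ⟨i, rfl⟩) <;> exact ⟨_, rfl⟩
    have hset : Set.range g ∪ T =
        Set.range (fun i : Fin p => g i.castSucc) ∪ insert (g (Fin.last p)) T := by
      rw [hrange, Set.insert_union, Set.union_insert]
    have hT' : (insert (g (Fin.last p)) T).encard ≤ (b + 1 : ℕ) := by
      refine (Set.encard_insert_le _ _).trans ?_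
      push_cast
      gcongr
    have hdim' : ((p + (b + 1) : ℕ) : WithBot ℕ∞) ≤ ringKrullDim R := by
      rwa [show p + (b + 1) = p + 1 + b by ring]
    have h1 := ih (fun i => g i.castSucc) _ (b + 1) (hset ▸ h) hT' hdim'
    have hp1 : (Ideal.span (Set.range fun i : Fin p => g i.castSucc)).IsPrime :=
      IsLocalRing.isPrime_span_of_maximalIdeal_eq_span _ _ p (b + 1) (hset ▸ h) (hcard _ _) hT' hdim'
    have hp2 : (Ideal.span (Set.range g)).IsPrime :=
      IsLocalRing.isPrime_span_of_maximalIdeal_eq_span _ _ (p + 1) b h (hcard _ _) hT hdim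
    have hle : Ideal.span (Set.range fun i : Fin p => g i.castSucc) ≤ Ideal.span (Set.range g) :=
      Ideal.span_mono (by rw [hrange]; exact Set.subset_insert _ _)
    have hlt : Ideal.span (Set.range fun i : Fin p => g i.castSucc) < Ideal.span (Set.range g) := by
      refine lt_of_le_of_ne hle fun heq => ?_
      -- otherwise the maximal ideal has fewer than `dim R` generators
      have hm : maximalIdeal R =
          Ideal.span (Set.range (fun i : Fin p => g i.castSucc) ∪ T) := by
        rw [h, Ideal.span_union, Ideal.span_union, heq]
      have h3 := ringKrullDim_le_spanFinrank_maximalIdeal R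
      rw [hm] at h3
      have h4 : (Set.range (fun i : Fin p => g i.castSucc) ∪ T).encard ≤ (p + b : ℕ) := by
        refine (Set.encard_union_le _ _).trans ?_
        push_cast
        exact add_le_add (hcard _ _) hT
      have h5 := (Submodule.spanFinrank_span_le_encard (R := R)
        (Set.range (fun i : Fin p => g i.castSucc) ∪ T)).trans h4
      have h6 := hdim.trans h3
      have h7 : p + 1 + b ≤ (Ideal.span (Set.range (fun i : Fin p => g i.castSucc) ∪ T)).spanFinrank := by
        exact_mod_cast h6
      have h8 : (Ideal.span (Set.range (fun i : Fin p => g i.castSucc) ∪ T)).spanFinrank ≤ p + b := by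
        exact_mod_cast h5
      omega
    push_cast
    exact (add_le_add_left h1 1).trans (Ideal.height_add_one_le_of_lt_of_isPrime hlt)

/-! ### Taylor expansion -/

open MvPolynomial in
/-- The Taylor expansion of a polynomial to second order, with remainder a quadratic form whose
coefficients are polynomials in the increment. -/
theorem MvPolynomial.exists_aeval_add_eq {k A σ : Type*} [CommRing k] [CommRing A] [Algebra k A]
    [Fintype σ] [DecidableEq σ] (γ : σ → A) (F : MvPolynomial σ k) :
    ∃ G : σ → σ → MvPolynomial σ A, ∀ u : σ → A,
      aeval (γ + u) F = aeval γ F + ∑ j, aeval γ (pderiv j F) * u j +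
        ∑ i, ∑ j, u i * u j * aeval u (G i j) := by
  induction F using MvPolynomial.induction_on with
  | C a => exact ⟨0, fun u => by simp [algHom_C]⟩
  | add F F' h h' =>
    obtain ⟨G, hG⟩ := h
    obtain ⟨G', hG'⟩ := h'
    refine ⟨G + G', fun u => ?_⟩
    simp only [map_add, hG u, hG' u, Pi.add_apply, add_mul, mul_add, Finset.sum_add_distrib]
    ring
  | mul_X F a h =>
    obtain ⟨G, hG⟩ := h
    refine ⟨fun i j => G i j * C (γ a) + (if j = a then C (aeval γ (pderiv i F)) else 0)
      + G i j * X a, fun u => ?_⟩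
    have h1 : ∑ j, aeval γ (pderiv j (F * X a)) * u j =
        (∑ j, aeval γ (pderiv j F) * u j) * γ a + aeval γ F * u a := by
      simp only [Derivation.leibniz, smul_eq_mul, map_add, map_mul, aeval_X, pderiv_X, add_mul,
        Finset.sum_add_distrib, Finset.sum_mul]
      rw [add_comm]
      congr 1
      · exact Finset.sum_congr rfl fun j _ => by ring
      · simp [Pi.single_apply, apply_ite]
    have h2 : ∑ i, ∑ j, u i * u j * aeval u (G i j * C (γ a) +
        (if j = a then C (aeval γ (pderiv i F)) else 0) + G i j * X a) =
        (∑ i, ∑ j, u i * u j * aeval u (G i j)) * (γ a + u a) +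
          (∑ j, aeval γ (pderiv j F) * u j) * u a := by
      have h3 : ∀ i, ∑ j, u i * u j * aeval u (G i j * C (γ a) +
          (if j = a then C (aeval γ (pderiv i F)) else 0) + G i j * X a) =
          (∑ j, u i * u j * aeval u (G i j)) * (γ a + u a) +
          aeval γ (pderiv i F) * u i * u a := by
        intro i
        simp only [map_add, map_mul, aeval_X, aeval_C, mul_add, Finset.sum_add_distrib,
          Finset.sum_mul, apply_ite (aeval u), map_zero, mul_ite, mul_zero, Finset.sum_ite_eq',
          Finset.mem_univ, if_true, Algebra.algebraMap_self, RingHom.id_apply]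
        have h4 : ∑ x, u i * u x * (aeval u (G i x) * γ a) =
            ∑ x, u i * u x * aeval u (G i x) * γ a := Finset.sum_congr rfl fun _ _ => by ring
        have h5 : ∑ x, u i * u x * (aeval u (G i x) * u a) =
            ∑ x, u i * u x * aeval u (G i x) * u a := Finset.sum_congr rfl fun _ _ => by ring
        rw [h4, h5]
        ring
      rw [Finset.sum_congr rfl fun i _ => h3 i, Finset.sum_add_distrib, Finset.sum_mul,
        Finset.sum_mul]
    rw [h1, h2, map_mul, map_mul, hG u, aeval_X, aeval_X, Pi.add_apply]
    ring

/-! ### The Jacobian criterion at a rational point -/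

namespace ArcTruncation
open MvPolynomial

variable {k : Type*} [Field k]

/-- The maximal ideal of polynomials vanishing at a rational point is generated by the differences
`X j - C (a j)`. -/
theorem ker_eval_eq_span {N : ℕ} (a : Fin N → k) :
    RingHom.ker (eval a) = Ideal.span (Set.range fun j : Fin N => (X j - C (a j) : MvPolynomial (Fin N) k)) := by
  refine le_antisymm (fun F hF => ?_) ?_
  · have h : ∀ F : MvPolynomial (Fin N) k, F - C (eval a F) ∈
        Ideal.span (Set.range fun j : Fin N => (X j - C (a j) : MvPolynomial (Fin N) k)) := by
      intro F
      rw [← Ideal.Quotient.eq]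
      set φ := Ideal.Quotient.mk
        (Ideal.span (Set.range fun j : Fin N => (X j - C (a j) : MvPolynomial (Fin N) k)))
      suffices φ = (φ.comp C).comp (eval a) from DFunLike.congr_fun this F
      refine MvPolynomial.ringHom_ext (by simp) fun j => ?_
      simpa [φ, Ideal.Quotient.eq] using Ideal.subset_span (Set.mem_range_self j)
    simpa [(RingHom.mem_ker).1 hF] using h F
  · rw [Ideal.span_le]
    rintro _ ⟨j, rfl⟩
    simp [RingHom.mem_ker]

/-- Taylor expansion at a rational point modulo the square of its maximal ideal. -/
theorem sub_sum_mem_ker_eval_sq {N : ℕ} (a : Fin N → k) (F : MvPolynomial (Fin N) k)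
    (hF : eval a F = 0) :
    F - ∑ j, C (eval a (pderiv j F)) * (X j - C (a j)) ∈ RingHom.ker (eval a) ^ 2 := by
  obtain ⟨G, hG⟩ := MvPolynomial.exists_aeval_add_eq (fun j => C (a j)) F
    (A := MvPolynomial (Fin N) k)
  have h := hG fun j => X j - C (a j)
  have h1 : ((fun j => C (a j)) + fun j => X j - C (a j) : Fin N → MvPolynomial (Fin N) k) = X := by
    ext1 j; simp
  have h2 : ∀ F : MvPolynomial (Fin N) k,
      aeval (fun j => (C (a j) : MvPolynomial (Fin N) k)) F = C (eval a F) := by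
    intro F
    rw [← algebraMap_eq]
    exact aeval_algebraMap_apply (MvPolynomial (Fin N) k) a F
  simp only [h1, h2, aeval_X_left_apply, hF, map_zero, zero_add] at h
  rw [sub_eq_of_eq_add' h, pow_two]
  refine Ideal.sum_mem _ fun i _ => Ideal.sum_mem _ fun j _ => Ideal.mul_mem_right _ _
    (Ideal.mul_mem_mul ?_ ?_) <;> simp [RingHom.mem_ker]

instance {N : ℕ} (a : Fin N → k) : (RingHom.ker (eval a)).IsMaximal :=
  RingHom.ker_isMaximal_of_surjective _ fun x => ⟨C x, by simp⟩

/-- Every rational point of affine space has height at least the dimension of the space. -/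
theorem le_height_ker_eval [IsAlgClosed k] {N : ℕ} (a : Fin N → k) :
    (N : ℕ∞) ≤ (RingHom.ker (eval a)).height := by
  have : FiniteRingKrullDim (MvPolynomial (Fin N) k) := by
    rw [finiteRingKrullDim_iff_ne_bot_and_top]
    rw [MvPolynomial.ringKrullDim_of_isNoetherianRing, ringKrullDim_eq_zero_of_field, zero_add]
    exact ⟨by simp, fun h => by simpa using (WithBot.coe_inj.1 h)⟩
  obtain ⟨M, hM, hMh⟩ := Ideal.exists_isMaximal_height (R := MvPolynomial (Fin N) k)
  obtain ⟨b, rfl⟩ := eq_vanishingIdeal_singleton_of_isMaximal k hM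
  rw [MvPolynomial.ringKrullDim_of_isNoetherianRing, ringKrullDim_eq_zero_of_field, zero_add] at hMh
  have hb : (vanishingIdeal k {b} : Ideal (MvPolynomial (Fin N) k)) = RingHom.ker (eval b) := by
    ext F
    rw [mem_vanishingIdeal_singleton_iff]
    exact Iff.rfl
  -- translate `b` to `a`
  let e : MvPolynomial (Fin N) k ≃ₐ[k] MvPolynomial (Fin N) k :=
    AlgEquiv.ofAlgHom (aeval fun j => X j + C (a j - b j)) (aeval fun j => X j - C (a j - b j))
      (by ext j; simp [algHom_C]) (by ext j; simp [algHom_C])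
  have he : (RingHom.ker (eval b)).comap (e : MvPolynomial (Fin N) k ≃+* MvPolynomial (Fin N) k) =
      RingHom.ker (eval a) := by
    have : (eval b).comp (e : MvPolynomial (Fin N) k →+* MvPolynomial (Fin N) k) = eval a := by
      refine MvPolynomial.ringHom_ext (fun r => ?_) fun j => ?_ <;> simp [e, algHom_C]
    rw [← this, ← RingHom.comap_ker]
    rfl
  rw [← he, RingEquiv.height_comap, ← hb]
  have : ((vanishingIdeal k {b} : Ideal (MvPolynomial (Fin N) k)).height : WithBot ℕ∞) = (N : ℕ∞) := by
    simpa using hMh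
  exact (WithBot.coe_inj.1 this).ge

/-- **Jacobian criterion**, at a rational point `a`: if `g₁, …, g_p` vanish at `a` and have a
nonzero `p × p` Jacobian minor there, then in the local ring at `a` they generate a prime ideal of
height at least `p`. -/
theorem exists_prime_of_det_ne_zero [IsAlgClosed k] {N p : ℕ} (a : Fin N → k)
    (g : Fin p → MvPolynomial (Fin N) k) (hg : ∀ i, eval a (g i) = 0) (c : Fin p → Fin N)
    (hdet : (Matrix.of fun i j => eval a (pderiv (c j) (g i))).det ≠ 0) :
    ∃ q : Ideal (MvPolynomial (Fin N) k), q.IsPrime ∧ (p : ℕ∞) ≤ q.height ∧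
      ∀ F ∈ q, ∃ s, eval a s ≠ 0 ∧ s * F ∈ Ideal.span (Set.range g) := by
  classical
  set M := RingHom.ker (eval a : MvPolynomial (Fin N) k →+* k) with hM
  let O := Localization.AtPrime M
  let al := algebraMap (MvPolynomial (Fin N) k) O
  have hcinj : Function.Injective c := by
    intro i j hij
    by_contra hne
    exact hdet (Matrix.det_zero_of_column_eq hne fun l => by simp [hij])
  let T : Set O := (fun j => al (X j - C (a j))) '' (Set.range c)ᶜ
  have hT : T.encard ≤ (N - p : ℕ) := by
    refine (Set.encard_image_le _ _).trans ?_
    have : (Set.range c)ᶜ = ((Finset.univ.image c)ᶜ : Finset (Fin N)) := by simp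
    rw [this, Set.encard_coe_eq_coe_finsetCard, Finset.card_compl,
      Finset.card_image_of_injective _ hcinj]
    simp
  have hp : p ≤ N := by simpa using Fintype.card_le_of_injective c hcinj
  have hdim : ((p + (N - p) : ℕ) : WithBot ℕ∞) ≤ ringKrullDim O := by
    rw [IsLocalization.AtPrime.ringKrullDim_eq_height M O, Nat.add_sub_cancel' hp]
    exact_mod_cast le_height_ker_eval a
  have hmax : IsLocalRing.maximalIdeal O = Ideal.span (Set.range (fun i => al (g i)) ∪ T) := by
    rw [← Localization.AtPrime.map_eq_maximalIdeal]
    refine le_antisymm ?_ ?_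
    · refine Submodule.le_of_le_smul_of_le_jacobson_bot (I := IsLocalRing.maximalIdeal O)
        (IsNoetherian.noetherian _) (IsLocalRing.maximalIdeal_le_jacobson _) ?_
      set J := Ideal.span (Set.range (fun i => al (g i)) ∪ T) ⊔
        IsLocalRing.maximalIdeal O • Ideal.map (algebraMap (MvPolynomial (Fin N) k) O) M with hJ
      have hsq : ∀ F ∈ M ^ 2, al F ∈ J := by
        intro F hF
        refine Ideal.mem_sup_right ?_
        rw [smul_eq_mul, ← Localization.AtPrime.map_eq_maximalIdeal, ← Ideal.map_mul, ← pow_two]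
        exact Ideal.mem_map_of_mem _ hF
      have hnot : ∀ j ∉ Set.range c, al (X j - C (a j)) ∈ J := fun j hj =>
        Ideal.mem_sup_left (Ideal.subset_span (Or.inr ⟨j, hj, rfl⟩))
      have hlin : ∀ i, ∑ j : Fin p, al (C (eval a (pderiv (c j) (g i)))) * al (X (c j) - C (a (c j))) ∈ J := by
        intro i
        have h1 := hsq _ (sub_sum_mem_ker_eval_sq a (g i) (hg i))
        have h2 : al (g i) ∈ J := Ideal.mem_sup_left (Ideal.subset_span (Or.inl ⟨i, rfl⟩))
        rw [map_sub] at h1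
        have h3 := Ideal.sub_mem _ h2 h1
        rw [sub_sub_cancel, map_sum] at h3
        have h4 : ∑ j, al (C (eval a (pderiv j (g i))) * (X j - C (a j))) =
            ∑ j ∈ (Finset.univ.image c), al (C (eval a (pderiv j (g i))) * (X j - C (a j))) +
            ∑ j ∈ (Finset.univ.image c)ᶜ, al (C (eval a (pderiv j (g i))) * (X j - C (a j))) :=
          (Finset.sum_add_sum_compl _ _).symm
        rw [h4] at h3
        have h5 := (Ideal.add_mem_iff_left J (Ideal.sum_mem J fun j hj => by
          rw [map_mul]
          exact Ideal.mul_mem_left _ _ (hnot j (by simpa using hj)))).1 h3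
        rw [Finset.sum_image fun x _ y _ h => hcinj h] at h5
        simpa only [map_mul] using h5
      -- invert the Jacobian minor to solve for `X (c j) - C (a (c j))`
      have hin : ∀ j, al (X (c j) - C (a (c j))) ∈ J := by
        intro j
        obtain ⟨B, hB⟩ : ∃ B : Fin p → k, ∀ j', ∑ i, B i * eval a (pderiv (c j') (g i)) =
            if j = j' then 1 else 0 := by
          set D : Matrix (Fin p) (Fin p) k := Matrix.of fun i j => eval a (pderiv (c j) (g i)) with hDdef
          have hD : D⁻¹ * D = 1 := Matrix.nonsing_inv_mul _ (Ne.isUnit hdet)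
          refine ⟨fun i => D⁻¹ j i, fun j' => ?_⟩
          have := congrFun (congrFun hD j) j'
          rwa [Matrix.mul_apply, Matrix.one_apply] at this
        have : al (X (c j) - C (a (c j))) = ∑ i, al (C (B i)) *
            ∑ j : Fin p, al (C (eval a (pderiv (c j) (g i)))) * al (X (c j) - C (a (c j))) := by
          have h1 : ∀ j', ∑ i, al (C (B i)) * (al (C (eval a (pderiv (c j') (g i)))) *
              al (X (c j') - C (a (c j')))) =
              al (C (if j = j' then 1 else 0)) * al (X (c j') - C (a (c j'))) := by
            intro j'
            simp only [← hB j', map_sum, map_mul, Finset.sum_mul, mul_assoc]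
          rw [Finset.sum_congr rfl fun i _ => Finset.mul_sum _ _ _, Finset.sum_comm,
            Finset.sum_congr rfl fun j' _ => h1 j']
          simp [apply_ite]
        rw [this]
        exact Ideal.sum_mem _ fun i _ => Ideal.mul_mem_left _ _ (hlin i)
      have hMs : M = Ideal.span _ := ker_eval_eq_span a
      refine Ideal.map_le_iff_le_comap.2 (hMs.le.trans (Ideal.span_le.2 ?_))
      rintro _ ⟨j, rfl⟩
      by_cases hj : j ∈ Set.range c
      · obtain ⟨j, rfl⟩ := hj
        exact hin j
      · exact hnot j hj
    · rw [Ideal.span_le, Set.union_subset_iff]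
      constructor
      · rintro _ ⟨i, rfl⟩
        exact Ideal.mem_map_of_mem _ (hg i)
      · rintro _ ⟨j, _, rfl⟩
        exact Ideal.mem_map_of_mem _ (by simp [hM, RingHom.mem_ker])
  have hrange : (Set.range fun i => al (g i)).encard ≤ p := by
    rw [← Set.image_univ]
    exact (Set.encard_image_le _ _).trans (by simp)
  have hq := IsLocalRing.isPrime_span_of_maximalIdeal_eq_span _ _ p (N - p) hmax hrange hT hdim
  have hh := IsLocalRing.le_height_span_of_maximalIdeal_eq_span p _ _ (N - p) hmax hT hdim
  refine ⟨(Ideal.span (Set.range fun i => al (g i))).comap al, hq.comap _, ?_, ?_⟩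
  · rwa [← IsLocalization.height_under M.primeCompl] at hh
  · intro F hF
    have hspan : Ideal.span (Set.range fun i => al (g i)) = (Ideal.span (Set.range g)).map al := by
      rw [Ideal.map_span, ← Set.range_comp]; rfl
    rw [hspan, Ideal.mem_comap, IsLocalization.mem_map_algebraMap_iff M.primeCompl] at hF
    obtain ⟨⟨⟨x, hx⟩, ⟨s, hs⟩⟩, h⟩ := hF
    refine ⟨s, fun h0 => hs h0, ?_⟩
    simp only [al, ← map_mul] at h
    have h' := IsLocalization.injective O M.primeCompl_le_nonZeroDivisors h
    rwa [mul_comm, h']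

end ArcTruncation

/-! ### Jacobian minors at an arc -/

namespace ArcTruncation
open MvPolynomial

variable {k : Type*} [Field k]

theorem exists_ringKrullDim_quotient_eq {N : ℕ} (Q : Ideal (MvPolynomial (Fin N) k)) [Q.IsPrime] :
    ∃ δ : ℕ, ringKrullDim (MvPolynomial (Fin N) k ⧸ Q) = δ ∧ (δ : ℕ∞) + Q.height ≤ N := by
  have hQ : Q.IsPrime := ‹_›
  let x : PrimeSpectrum (MvPolynomial (Fin N) k) := ⟨Q, hQ⟩
  have h1 : ringKrullDim (MvPolynomial (Fin N) k ⧸ Q) = Order.coheight x := by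
    rw [ringKrullDim_quotient, Order.coheight_eq_krullDim_Ici]
    rfl
  have h2 : Q.height = Order.height x := x.height_eq_orderHeight
  have h3 : ((Order.height x + Order.coheight x : ℕ∞) : WithBot ℕ∞) ≤ (N : ℕ∞) := by
    have h : ringKrullDim (MvPolynomial (Fin N) k) = (N : ℕ∞) := by
      rw [MvPolynomial.ringKrullDim_of_isNoetherianRing, ringKrullDim_eq_zero_of_field]
      simp
    rw [← h, ringKrullDim, Order.krullDim_eq_iSup_height_add_coheight_of_nonempty]
    exact WithBot.coe_le_coe.2 (le_iSup (fun a => Order.height a + Order.coheight a) x)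
  have h4 := WithBot.coe_le_coe.1 h3
  obtain ⟨δ, hδ⟩ := ENat.ne_top_iff_exists.1
    (ne_top_of_le_ne_top (ENat.natCast_ne_top N) (le_add_self.trans h4))
  refine ⟨δ, by rw [h1, ← hδ]; rfl, ?_⟩
  rw [hδ, h2, add_comm]
  exact h4

theorem IsMinComponentDim.le {N d : ℕ} {I : Ideal (MvPolynomial (Fin N) k)}
    (hd : IsMinComponentDim I d) : d ≤ N := by
  obtain ⟨P, hP, hdim⟩ := hd.1
  have : P.IsPrime := hP.1.1
  obtain ⟨δ, hδ, hle⟩ := exists_ringKrullDim_quotient_eq P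
  have h1 : d = δ := by
    rw [hdim] at hδ
    exact_mod_cast hδ
  rw [h1]
  exact_mod_cast le_self_add.trans hle

/-- Let `γ` be an arc on the scheme defined by `I`, at which some `p × p` Jacobian minor of
elements `g₁, …, g_p` of `I` does not vanish. Then `p ≤ N - d`; in case of equality, `g₁, …, g_p`
generate `I` locally at the generic point of `γ`. -/
theorem le_and_exists_mul_mem_span [IsAlgClosed k] {N d p : ℕ} {I : Ideal (MvPolynomial (Fin N) k)}
    (hd : IsMinComponentDim I d) {γ : Arc k N} (hγ : γ ∈ arcs I)
    (g : Fin p → MvPolynomial (Fin N) k) (hg : ∀ i, g i ∈ I) (c : Fin p → Fin N)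
    (hdet : (Matrix.of fun i j => aeval γ (pderiv (c j) (g i))).det ≠ 0) :
    p ≤ N - d ∧ (p = N - d → ∀ F ∈ I, ∃ s, aeval γ s ≠ 0 ∧ s * F ∈ Ideal.span (Set.range g)) := by
  set P := RingHom.ker (aeval γ : MvPolynomial (Fin N) k →ₐ[k] PowerSeries k) with hP
  have hPp : P.IsPrime := RingHom.ker_isPrime _
  have hIP : I ≤ P := fun F hF => hγ F hF
  set Δ := (Matrix.of fun i j => pderiv (c j) (g i)).det with hΔ
  have hΔP : Δ ∉ P := by
    rw [hP, RingHom.mem_ker, hΔ]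
    intro h
    apply hdet
    rw [← h]
    erw [AlgHom.map_det]
    rfl
  -- a closed point of the closure of `γ` at which the minor does not vanish
  obtain ⟨a, haP, haΔ⟩ : ∃ a : Fin N → k, (∀ F ∈ P, eval a F = 0) ∧ eval a Δ ≠ 0 := by
    rw [← MvPolynomial.IsPrime.vanishingIdeal_zeroLocus (K := k) P, mem_vanishingIdeal_iff] at hΔP
    push Not at hΔP
    obtain ⟨a, ha, ha'⟩ := hΔP
    refine ⟨a, fun F hF => ?_, ?_⟩
    · simpa using! ha F hF
    · simpa using! ha'
  obtain ⟨q, hq, hqh, hqs⟩ := exists_prime_of_det_ne_zero a g (fun i => haP _ (hIP (hg i))) c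
    (by
      intro h
      apply haΔ
      rw [← h, hΔ]
      erw [RingHom.map_det]
      rfl)
  obtain ⟨Q, hQ, hQP⟩ := Ideal.exists_minimalPrimes_le hIP
  have hQp : Q.IsPrime := hQ.1.1
  have hgQ : Ideal.span (Set.range g) ≤ Q := by
    rw [Ideal.span_le]
    rintro _ ⟨i, rfl⟩
    exact hQ.1.2 (hg i)
  have hqQ : q ≤ Q := by
    intro F hF
    obtain ⟨s, hs, hsF⟩ := hqs F hF
    exact (hQp.mem_or_mem (hgQ hsF)).resolve_left fun h => hs (haP s (hQP h))
  obtain ⟨δ, hδ, hle⟩ := exists_ringKrullDim_quotient_eq Q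
  have hdδ : d ≤ δ := hd.2 ⟨Q, hQ, hδ⟩
  have hdN := hd.le
  have hpδ : δ + p ≤ N := by
    have : (δ : ℕ∞) + p ≤ N := (add_le_add_right (hqh.trans (Ideal.height_mono hqQ)) _).trans hle
    exact_mod_cast this
  refine ⟨by omega, fun hpd F hF => ?_⟩
  -- equality of heights forces the two primes to coincide
  have hqQ' : q = Q := by
    by_contra hne
    have h1 := Ideal.height_add_one_le_of_lt_of_isPrime (lt_of_le_of_ne hqQ hne)
    have h2 : (δ : ℕ∞) + (p + 1) ≤ N :=
      (add_le_add_right ((add_le_add_left hqh 1).trans h1) _).trans hle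
    have h3 : δ + (p + 1) ≤ N := by exact_mod_cast h2
    omega
  obtain ⟨s, hs, hsF⟩ := hqs F (hqQ' ▸ hQ.1.2 hF)
  exact ⟨s, fun h => hs (haP s h), hsF⟩

end ArcTruncation

/-! ### A Hensel lemma over rings of power series -/

namespace ArcTruncation
open MvPolynomial

variable {k : Type*} [Field k] {A : Type*} [CommRing A]

theorem powerSeries_eq_of_forall_X_pow_dvd_sub {a b : PowerSeries A}
    (h : ∀ n : ℕ, (PowerSeries.X : PowerSeries A) ^ n ∣ a - b) : a = b := by
  rw [← sub_eq_zero]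
  ext n
  exact PowerSeries.X_pow_dvd_iff.1 (h (n + 1)) n (Nat.lt_succ_self n)

/-- A map between tuples of power series which raises the order of congruences modulo powers of the
variable has a unique fixed point. -/
theorem existsUnique_fixedPoint {ι : Type*} (Φ : (ι → PowerSeries A) → ι → PowerSeries A)
    (hΦ : ∀ (n : ℕ) (y y' : ι → PowerSeries A), (∀ i, PowerSeries.X ^ n ∣ y i - y' i) →
      ∀ i, PowerSeries.X ^ (n + 1) ∣ Φ y i - Φ y' i) : ∃! y, Φ y = y := by
  let s : ℕ → ι → PowerSeries A := fun n => Φ^[n] 0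
  have hs : ∀ n, s (n + 1) = Φ (s n) := fun n => Function.iterate_succ_apply' Φ n 0
  have hstep : ∀ n i, PowerSeries.X ^ n ∣ s (n + 1) i - s n i := by
    intro n
    induction n with
    | zero => simp
    | succ n ih => rw [hs (n + 1), hs n]; rw [hs n] at ih; exact hΦ n _ _ ih
  have hcauchy : ∀ n m i, n ≤ m → PowerSeries.X ^ n ∣ s m i - s n i := by
    intro n m i hnm
    induction m, hnm using Nat.le_induction with
    | base => simp
    | succ m hm ih =>
      rw [← sub_add_sub_cancel _ (s m i)]
      exact dvd_add ((pow_dvd_pow _ hm).trans (hstep m i)) ih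
  let y : ι → PowerSeries A := fun i => PowerSeries.mk fun n => PowerSeries.coeff n (s (n + 1) i)
  have hy : ∀ n i, PowerSeries.X ^ n ∣ y i - s n i := by
    intro n i
    rw [PowerSeries.X_pow_dvd_iff]
    intro j hj
    have := PowerSeries.X_pow_dvd_iff.1 (hcauchy (j + 1) n i hj) j (Nat.lt_succ_self j)
    rw [map_sub] at this ⊢
    rw [PowerSeries.coeff_mk, ← neg_sub, this, neg_zero]
  refine ⟨y, ?_, fun y' hy' => ?_⟩
  · funext i
    refine powerSeries_eq_of_forall_X_pow_dvd_sub fun n => (pow_dvd_pow _ n.le_succ).trans ?_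
    have h1 := hΦ n y (s n) (hy n) i
    rw [← hs n] at h1
    rw [← sub_sub_sub_cancel_right _ _ (s (n + 1) i)]
    exact dvd_sub h1 (hy (n + 1) i)
  · have h1 : ∀ n i, PowerSeries.X ^ n ∣ y' i - s n i := by
      intro n
      induction n with
      | zero => simp
      | succ n ih => rw [hs n]; nth_rw 1 [← hy']; exact hΦ n _ _ ih
    funext i
    refine powerSeries_eq_of_forall_X_pow_dvd_sub fun n => ?_
    rw [← sub_sub_sub_cancel_right _ _ (s n i)]
    exact dvd_sub (h1 n i) (hy n i)

theorem dvd_aeval_sub_aeval {σ S B : Type*} [CommRing S] [CommRing B] [Algebra S B] (t : B)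
    (x y : σ → B) (h : ∀ i, t ∣ x i - y i) (F : MvPolynomial σ S) :
    t ∣ aeval x F - aeval y F := by
  rw [← Ideal.mem_span_singleton, ← Ideal.Quotient.eq]
  have hxy : (fun i => Ideal.Quotient.mkₐ S (Ideal.span {t}) (x i)) =
      fun i => Ideal.Quotient.mkₐ S (Ideal.span {t}) (y i) := by
    funext i
    exact Ideal.Quotient.eq.2 (Ideal.mem_span_singleton.2 (h i))
  have h1 := MvPolynomial.comp_aeval_apply (R := S) x (Ideal.Quotient.mkₐ S (Ideal.span {t})) F
  have h2 := MvPolynomial.comp_aeval_apply (R := S) y (Ideal.Quotient.mkₐ S (Ideal.span {t})) F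
  rw [hxy, ← h2] at h1
  exact h1

variable [Algebra k A] {N r d : ℕ}

/-- The columns of the Jacobian matrix singled out by a splitting of the coordinates. -/
noncomputable def jacL (g : Fin r → MvPolynomial (Fin N) k) (σ : Fin r ⊕ Fin d ≃ Fin N)
    (γ : Fin N → PowerSeries A) : Matrix (Fin r) (Fin r) (PowerSeries A) :=
  Matrix.of fun i j => aeval γ (pderiv (σ (Sum.inl j)) (g i))

/-- The remaining columns of the Jacobian matrix. -/
noncomputable def jacR (g : Fin r → MvPolynomial (Fin N) k) (σ : Fin r ⊕ Fin d ≃ Fin N)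
    (γ : Fin N → PowerSeries A) : Matrix (Fin r) (Fin d) (PowerSeries A) :=
  Matrix.of fun i j => aeval γ (pderiv (σ (Sum.inr j)) (g i))

/-- The tuple `γ + t ^ (l + 1) u`, where `u` has coordinates `w` and `z` in the splitting `σ`. -/
noncomputable def perturb (σ : Fin r ⊕ Fin d ≃ Fin N) (l : ℕ) (γ : Fin N → PowerSeries A)
    (w : Fin r → PowerSeries A) (z : Fin d → PowerSeries A) : Fin N → PowerSeries A :=
  fun j => γ j + PowerSeries.X ^ (l + 1) * Sum.elim w z (σ.symm j)

/-- The data which make Newton's method for `g = 0` work at the approximate solution `γ`: in the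
splitting `σ` of the coordinates, the first block `K` of the Jacobian matrix divides `t ^ l`, it
divides the second block, and `t ^ (l + 1) K` divides the value `g(γ)`. -/
structure LiftData (g : Fin r → MvPolynomial (Fin N) k) (σ : Fin r ⊕ Fin d ≃ Fin N) (l : ℕ)
    (γ : Fin N → PowerSeries A) (L : Matrix (Fin r) (Fin r) (PowerSeries A))
    (H : Matrix (Fin r) (Fin d) (PowerSeries A)) (v : Fin r → PowerSeries A) : Prop where
  mul_left : L * jacL g σ γ = (PowerSeries.X : PowerSeries A) ^ l • (1 : Matrix _ _ _)
  mul_right : jacL g σ γ * L = (PowerSeries.X : PowerSeries A) ^ l • (1 : Matrix _ _ _)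
  col : jacL g σ γ * H = jacR g σ γ
  value : (fun i => aeval γ (g i)) = (PowerSeries.X : PowerSeries A) ^ (l + 1) • (jacL g σ γ).mulVec v

theorem X_pow_smul_injective {ι : Type*} (n : ℕ) :
    Function.Injective fun v : ι → PowerSeries A => (PowerSeries.X : PowerSeries A) ^ n • v := by
  intro v w h
  funext i
  have := congrFun h i
  exact PowerSeries.X_pow_mul_cancel this

namespace LiftData

variable {g : Fin r → MvPolynomial (Fin N) k} {σ : Fin r ⊕ Fin d ≃ Fin N} {l : ℕ}
  {γ : Fin N → PowerSeries A} {L : Matrix (Fin r) (Fin r) (PowerSeries A)}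
  {H : Matrix (Fin r) (Fin d) (PowerSeries A)} {v : Fin r → PowerSeries A}

theorem mulVec_injective (h : LiftData g σ l γ L H v) :
    Function.Injective (jacL g σ γ).mulVec := by
  intro x y hxy
  have h1 := congrArg L.mulVec hxy
  simp only [Matrix.mulVec_mulVec, h.mul_left, Matrix.smul_mulVec, Matrix.one_mulVec] at h1
  exact X_pow_smul_injective l h1

/-- Taylor expansion in the presence of lifting data. -/
theorem exists_expansion (h : LiftData g σ l γ L H v) :
    ∃ Q : Fin r → MvPolynomial (Fin N) (PowerSeries A), ∀ w z,
      (fun i => aeval (perturb σ l γ w z) (g i)) = (PowerSeries.X : PowerSeries A) ^ (l + 1) •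
        (jacL g σ γ).mulVec (v + w + H.mulVec z + (PowerSeries.X : PowerSeries A) •
          fun i => aeval (fun j => Sum.elim w z (σ.symm j)) (Q i)) := by
  choose G hG using fun i => MvPolynomial.exists_aeval_add_eq γ (g i)
  let G' : Fin r → MvPolynomial (Fin N) (PowerSeries A) := fun i =>
    ∑ a, ∑ b, X a * X b * bind₁ (fun c => C (PowerSeries.X ^ (l + 1)) * X c) (G i a b)
  refine ⟨fun i => ∑ j, C (L i j) * G' j, fun w z => ?_⟩
  set u : Fin N → PowerSeries A := fun j => Sum.elim w z (σ.symm j) with hu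
  have h1 : (fun i => aeval u (∑ j, C (L i j) * G' j)) = L.mulVec fun i => aeval u (G' i) := by
    funext i
    simp [Matrix.mulVec, dotProduct]
  rw [h1, Matrix.mulVec_add, Matrix.mulVec_add, Matrix.mulVec_add, Matrix.mulVec_smul,
    Matrix.mulVec_mulVec, Matrix.mulVec_mulVec, h.mul_right, h.col, smul_add, smul_add, smul_add,
    ← h.value]
  funext i
  have h2 : perturb σ l γ w z = γ + fun j => PowerSeries.X ^ (l + 1) * u j := rfl
  rw [h2, hG i]
  have h3 : ∑ j, aeval γ (pderiv j (g i)) * (PowerSeries.X ^ (l + 1) * u j) =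
      PowerSeries.X ^ (l + 1) * ((jacL g σ γ).mulVec w i + (jacR g σ γ).mulVec z i) := by
    rw [← Equiv.sum_comp σ, Fintype.sum_sum_type, mul_add]
    simp only [Matrix.mulVec, dotProduct, Finset.mul_sum, jacL, jacR, Matrix.of_apply, hu,
      Equiv.symm_apply_apply, Sum.elim_inl, Sum.elim_inr]
    congr 1 <;> exact Finset.sum_congr rfl fun j _ => by ring
  have h4 : ∑ a, ∑ b, PowerSeries.X ^ (l + 1) * u a * (PowerSeries.X ^ (l + 1) * u b) *
      aeval (fun j => PowerSeries.X ^ (l + 1) * u j) (G i a b) =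
      PowerSeries.X ^ (l + 1) * (PowerSeries.X * (PowerSeries.X ^ l * aeval u (G' i))) := by
    simp only [G', map_sum, map_mul, aeval_X, aeval_bind₁, Finset.mul_sum, aeval_C]
    refine Finset.sum_congr rfl fun a _ => Finset.sum_congr rfl fun b _ => ?_
    simp only [Algebra.algebraMap_self, RingHom.id_apply]
    ring
  rw [h3, h4]
  simp only [Pi.add_apply, Pi.smul_apply, smul_eq_mul, Matrix.smul_mulVec, Matrix.one_mulVec]
  ring

theorem exists_forall_eq_zero_iff (h : LiftData g σ l γ L H v) :
    ∃ Q : Fin r → MvPolynomial (Fin N) (PowerSeries A), ∀ w z,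
      (∀ i, aeval (perturb σ l γ w z) (g i) = 0) ↔
        -(v + H.mulVec z + (PowerSeries.X : PowerSeries A) •
          fun i => aeval (fun j => Sum.elim w z (σ.symm j)) (Q i)) = w := by
  obtain ⟨Q, hQ⟩ := h.exists_expansion
  refine ⟨Q, fun w z => ?_⟩
  rw [← funext_iff (f := fun i => aeval (perturb σ l γ w z) (g i)) (g := fun _ => 0), hQ]
  have h0 : (fun _ => 0 : Fin r → PowerSeries A) =
      (PowerSeries.X : PowerSeries A) ^ (l + 1) • (jacL g σ γ).mulVec 0 := by
    rw [Matrix.mulVec_zero, smul_zero]; rfl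
  rw [h0, (X_pow_smul_injective (l + 1)).eq_iff, h.mulVec_injective.eq_iff, neg_eq_iff_add_eq_zero]
  constructor <;> intro h1 <;> rw [← h1] <;> abel

theorem dvd_step (Q : Fin r → MvPolynomial (Fin N) (PowerSeries A)) {n : ℕ}
    {w w' : Fin r → PowerSeries A} {z z' : Fin d → PowerSeries A}
    (hw : ∀ i, PowerSeries.X ^ n ∣ w i - w' i) (hz : ∀ i, PowerSeries.X ^ (n + 1) ∣ z i - z' i)
    (i : Fin r) : PowerSeries.X ^ (n + 1) ∣
      (-(v + H.mulVec z + (PowerSeries.X : PowerSeries A) •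
          fun i => aeval (fun j => Sum.elim w z (σ.symm j)) (Q i))) i -
      (-(v + H.mulVec z' + (PowerSeries.X : PowerSeries A) •
          fun i => aeval (fun j => Sum.elim w' z' (σ.symm j)) (Q i))) i := by
  have h1 : PowerSeries.X ^ (n + 1) ∣ (H.mulVec z) i - (H.mulVec z') i := by
    simp only [Matrix.mulVec, dotProduct, ← Finset.sum_sub_distrib, ← mul_sub]
    exact Finset.dvd_sum fun j _ => (hz j).mul_left _
  have h2 : PowerSeries.X ^ n ∣ aeval (fun j => Sum.elim w z (σ.symm j)) (Q i) -
      aeval (fun j => Sum.elim w' z' (σ.symm j)) (Q i) := by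
    refine dvd_aeval_sub_aeval _ _ _ (fun j => ?_) _
    rcases σ.symm j with a | a
    · exact hw a
    · exact (pow_dvd_pow _ n.le_succ).trans (hz a)
  have h3 := dvd_add h1 (pow_succ' (PowerSeries.X : PowerSeries A) n ▸
    mul_dvd_mul_left PowerSeries.X h2)
  rw [← dvd_neg] at h3
  convert h3 using 1
  simp only [Pi.neg_apply, Pi.add_apply, Pi.smul_apply, smul_eq_mul]
  ring

/-- Existence and uniqueness of solutions with prescribed `z`-coordinates. -/
theorem existsUnique (h : LiftData g σ l γ L H v) (z : Fin d → PowerSeries A) :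
    ∃! w, ∀ i, aeval (perturb σ l γ w z) (g i) = 0 := by
  obtain ⟨Q, hQ⟩ := h.exists_forall_eq_zero_iff
  simp only [hQ]
  exact existsUnique_fixedPoint _ fun n y y' hy i => dvd_step Q hy (by simp) i

/-- Solutions depend continuously on their `z`-coordinates, for the `t`-adic topology. -/
theorem congr_of_congr (h : LiftData g σ l γ L H v) {n : ℕ} {w w' : Fin r → PowerSeries A}
    {z z' : Fin d → PowerSeries A} (hw : ∀ i, aeval (perturb σ l γ w z) (g i) = 0)
    (hw' : ∀ i, aeval (perturb σ l γ w' z') (g i) = 0)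
    (hz : ∀ i, PowerSeries.X ^ n ∣ z i - z' i) : ∀ i, PowerSeries.X ^ n ∣ w i - w' i := by
  obtain ⟨Q, hQ⟩ := h.exists_forall_eq_zero_iff
  rw [hQ] at hw hw'
  have key : ∀ m ≤ n, ∀ i, PowerSeries.X ^ m ∣ w i - w' i := by
    intro m
    induction m with
    | zero => simp
    | succ m ih =>
      intro hm i
      rw [← hw, ← hw']
      exact dvd_step Q (ih (Nat.le_of_succ_le hm))
        (fun i => (pow_dvd_pow _ hm).trans (hz i)) i
  exact key n le_rfl

end LiftData

theorem aeval_map_comp {B : Type*} [CommRing B] [Algebra k B] (φ : A →ₐ[k] B)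
    (γ : Fin N → PowerSeries A) (F : MvPolynomial (Fin N) k) :
    aeval (fun j => PowerSeries.map (φ : A →+* B) (γ j)) F =
      PowerSeries.map (φ : A →+* B) (aeval γ F) :=
  (MvPolynomial.comp_aeval_apply (R := k) γ (PowerSeries.mapAlgHom φ) F).symm

theorem perturb_map {B : Type*} [CommRing B] [Algebra k B] (φ : A →ₐ[k] B)
    (σ : Fin r ⊕ Fin d ≃ Fin N) (l : ℕ) (γ : Fin N → PowerSeries A) (w : Fin r → PowerSeries A)
    (z : Fin d → PowerSeries A) :
    perturb σ l (fun j => PowerSeries.map (φ : A →+* B) (γ j))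
      (fun i => PowerSeries.map (φ : A →+* B) (w i)) (fun i => PowerSeries.map (φ : A →+* B) (z i)) =
      fun j => PowerSeries.map (φ : A →+* B) (perturb σ l γ w z j) := by
  funext j
  simp only [perturb, map_add, map_mul, map_pow, PowerSeries.map_X]
  rcases σ.symm j with a | a <;> rfl

theorem jacL_map {B : Type*} [CommRing B] [Algebra k B] (φ : A →ₐ[k] B)
    (g : Fin r → MvPolynomial (Fin N) k) (σ : Fin r ⊕ Fin d ≃ Fin N) (γ : Fin N → PowerSeries A) :
    jacL g σ (fun j => PowerSeries.map (φ : A →+* B) (γ j)) =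
      (jacL g σ γ).map (PowerSeries.map (φ : A →+* B)) := by
  ext1 i j
  exact aeval_map_comp φ γ _

theorem jacR_map {B : Type*} [CommRing B] [Algebra k B] (φ : A →ₐ[k] B)
    (g : Fin r → MvPolynomial (Fin N) k) (σ : Fin r ⊕ Fin d ≃ Fin N) (γ : Fin N → PowerSeries A) :
    jacR g σ (fun j => PowerSeries.map (φ : A →+* B) (γ j)) =
      (jacR g σ γ).map (PowerSeries.map (φ : A →+* B)) := by
  ext1 i j
  exact aeval_map_comp φ γ _

/-- A matrix congruent to the identity modulo the variable is invertible. -/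
theorem exists_mul_eq_one (M : Matrix (Fin r) (Fin r) (PowerSeries A)) :
    ∃ V : Matrix (Fin r) (Fin r) (PowerSeries A),
      V * (1 + (PowerSeries.X : PowerSeries A) • M) = 1 ∧
      (1 + (PowerSeries.X : PowerSeries A) • M) * V = 1 := by
  have h : IsUnit (1 + (PowerSeries.X : PowerSeries A) • M).det := by
    rw [PowerSeries.isUnit_iff_constantCoeff]
    have h1 : (PowerSeries.constantCoeff (R := A)).mapMatrix (1 + (PowerSeries.X : PowerSeries A) • M) = 1 := by
      ext i j
      by_cases hij : i = j <;> simp [Matrix.one_apply, hij]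
    rw [RingHom.map_det, h1, Matrix.det_one]
    exact isUnit_one
  exact ⟨_, Matrix.nonsing_inv_mul _ h, Matrix.mul_nonsing_inv _ h⟩

namespace LiftData

variable {g : Fin r → MvPolynomial (Fin N) k} {σ : Fin r ⊕ Fin d ≃ Fin N} {l : ℕ}
  {γ : Fin N → PowerSeries A} {L : Matrix (Fin r) (Fin r) (PowerSeries A)}
  {H : Matrix (Fin r) (Fin d) (PowerSeries A)} {v : Fin r → PowerSeries A}

protected theorem map {B : Type*} [CommRing B] [Algebra k B] (φ : A →ₐ[k] B)
    (h : LiftData g σ l γ L H v) :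
    LiftData g σ l (fun j => PowerSeries.map (φ : A →+* B) (γ j))
      (L.map (PowerSeries.map (φ : A →+* B))) (H.map (PowerSeries.map (φ : A →+* B)))
      (fun i => PowerSeries.map (φ : A →+* B) (v i)) where
  mul_left := by
    rw [jacL_map, ← Matrix.map_mul, h.mul_left]
    ext1 i j
    by_cases hij : i = j <;> simp [hij]
  mul_right := by
    rw [jacL_map, ← Matrix.map_mul, h.mul_right]
    ext1 i j
    by_cases hij : i = j <;> simp [hij]
  col := by rw [jacL_map, jacR_map, ← Matrix.map_mul, h.col]
  value := by
    funext i
    have h1 := congrArg (PowerSeries.map (φ : A →+* B)) (congrFun h.value i)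
    simp only [aeval_map_comp]
    rw [h1, jacL_map]
    simp [Matrix.mulVec, dotProduct]

/-- Lifting data for `γ` give lifting data for all arcs with the same `l`-jet. -/
theorem exists_perturb (h : LiftData g σ l γ L H v) (w : Fin r → PowerSeries A) (z : Fin d → PowerSeries A) :
    ∃ L' H' v', LiftData g σ l (perturb σ l γ w z) L' H' v' := by
  have hdvd : ∀ F : MvPolynomial (Fin N) k, ∃ y, aeval (perturb σ l γ w z) F = aeval γ F +
      PowerSeries.X ^ (l + 1) * y := by
    intro F
    obtain ⟨y, hy⟩ := dvd_aeval_sub_aeval ((PowerSeries.X : PowerSeries A) ^ (l + 1))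
      (perturb σ l γ w z) γ (fun i => by simp [perturb]) F
    exact ⟨y, by rw [← hy]; ring⟩
  choose Y hY using hdvd
  let ZL : Matrix (Fin r) (Fin r) (PowerSeries A) :=
    Matrix.of fun i j => Y (pderiv (σ (Sum.inl j)) (g i))
  let ZR : Matrix (Fin r) (Fin d) (PowerSeries A) :=
    Matrix.of fun i j => Y (pderiv (σ (Sum.inr j)) (g i))
  have hL : jacL g σ (perturb σ l γ w z) =
      jacL g σ γ * (1 + (PowerSeries.X : PowerSeries A) • (L * ZL)) := by
    rw [mul_add, mul_one, mul_smul_comm, ← mul_assoc, h.mul_right, smul_mul_assoc, one_mul,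
      smul_smul, ← pow_succ']
    ext1 i j
    exact hY _
  have hR : jacR g σ (perturb σ l γ w z) =
      jacL g σ γ * (H + (PowerSeries.X : PowerSeries A) • (L * ZR)) := by
    rw [Matrix.mul_add, Matrix.mul_smul, ← Matrix.mul_assoc, h.mul_right, h.col, Matrix.smul_mul,
      Matrix.one_mul, smul_smul, ← pow_succ']
    ext1 i j
    exact hY _
  obtain ⟨V, hV1, hV2⟩ := exists_mul_eq_one (L * ZL)
  obtain ⟨Q, hQ⟩ := h.exists_expansion
  refine ⟨V * L, V * (H + (PowerSeries.X : PowerSeries A) • (L * ZR)), V.mulVec (v + w +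
    H.mulVec z + (PowerSeries.X : PowerSeries A) •
      fun i => aeval (fun j => Sum.elim w z (σ.symm j)) (Q i)), ?_, ?_, ?_, ?_⟩
  · rw [hL, mul_assoc, ← mul_assoc L, h.mul_left, smul_mul_assoc, one_mul, mul_smul_comm, hV1]
  · rw [hL, mul_assoc, ← mul_assoc _ V, hV2, one_mul, h.mul_right]
  · rw [hL, hR, Matrix.mul_assoc, ← Matrix.mul_assoc _ V, hV2, Matrix.one_mul]
  · rw [hQ, hL, Matrix.mulVec_mulVec, Matrix.mul_assoc, hV2, Matrix.mul_one]

end LiftData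
end ArcTruncation

/-! ### Arcs near a given arc -/

namespace ArcTruncation
open MvPolynomial

variable {k : Type*} [Field k] {N r d : ℕ}

theorem LiftData.det_ne_zero {g : Fin r → MvPolynomial (Fin N) k} {σ : Fin r ⊕ Fin d ≃ Fin N}
    {l : ℕ} {γ : Fin N → PowerSeries k} {L : Matrix (Fin r) (Fin r) (PowerSeries k)}
    {H : Matrix (Fin r) (Fin d) (PowerSeries k)} {v : Fin r → PowerSeries k}
    (h : LiftData g σ l γ L H v) : (jacL g σ γ).det ≠ 0 := by
  intro h0
  have h1 := congrArg Matrix.det h.mul_left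
  rw [Matrix.det_mul, h0, mul_zero, Matrix.det_smul, Matrix.det_one, mul_one] at h1
  exact pow_ne_zero _ (pow_ne_zero _ PowerSeries.X_ne_zero) h1.symm

/-- Let `γ` be an arc with lifting data for elements `g₁, …, g_r` of `I`, where `r = N - d`. If one
arc with the same `l`-jet lies on the scheme defined by `I`, then so does every such arc on the scheme
defined by `g₁, …, g_r`. The two arcs are joined by a family of arcs over the affine line, which lies
on the same component as its first member. -/
theorem LiftData.aeval_eq_zero [IsAlgClosed k] {e : ℕ} {I : Ideal (MvPolynomial (Fin N) k)}
    (hd : IsMinComponentDim I e) (hr : r = N - e)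
    {g : Fin r → MvPolynomial (Fin N) k} (hg : ∀ i, g i ∈ I) {σ : Fin r ⊕ Fin d ≃ Fin N}
    {l : ℕ} {γ : Fin N → PowerSeries k} {L : Matrix (Fin r) (Fin r) (PowerSeries k)}
    {H : Matrix (Fin r) (Fin d) (PowerSeries k)} {v : Fin r → PowerSeries k}
    (h : LiftData g σ l γ L H v) {w w' : Fin r → PowerSeries k} {z z' : Fin d → PowerSeries k}
    (hw : perturb σ l γ w z ∈ arcs I) (hw' : ∀ i, aeval (perturb σ l γ w' z') (g i) = 0) :
    perturb σ l γ w' z' ∈ arcs I := by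
  -- the family over `k[X]` with `z`-coordinates `z + X (z' - z)`
  let ι : k →ₐ[k] Polynomial k := Algebra.ofId k (Polynomial k)
  let ev : k → Polynomial k →ₐ[k] k := fun a => Polynomial.aeval a
  have hev : ∀ a (f : PowerSeries k), PowerSeries.map (ev a : Polynomial k →+* k)
      (PowerSeries.map (ι : k →+* Polynomial k) f) = f := by
    intro a f
    ext n
    simp [ι, ev]
  let γ₁ : Fin N → PowerSeries (Polynomial k) := fun j => PowerSeries.map (ι : k →+* Polynomial k) (γ j)
  have h₁ := h.map ι
  let z₁ : Fin d → PowerSeries (Polynomial k) := fun i =>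
    PowerSeries.map (ι : k →+* Polynomial k) (z i) +
      PowerSeries.C Polynomial.X * PowerSeries.map (ι : k →+* Polynomial k) (z' i - z i)
  obtain ⟨w₁, hw₁, -⟩ := h₁.existsUnique z₁
  have hz0 : (fun i => PowerSeries.map (ev 0 : Polynomial k →+* k) (z₁ i)) = z := by
    funext i
    simp only [z₁, map_add, map_mul, hev, PowerSeries.map_C]
    simp [ev]
  have hz1 : (fun i => PowerSeries.map (ev 1 : Polynomial k →+* k) (z₁ i)) = z' := by
    funext i
    simp only [z₁, map_add, map_mul, hev, PowerSeries.map_C]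
    simp [ev]
  have hspec : ∀ (a : k) (F : MvPolynomial (Fin N) k), aeval (perturb σ l γ (fun i => PowerSeries.map (ev a : Polynomial k →+* k) (w₁ i))
      (fun i => PowerSeries.map (ev a : Polynomial k →+* k) (z₁ i))) F =
      PowerSeries.map (ev a : Polynomial k →+* k) (aeval (perturb σ l γ₁ w₁ z₁) F) := by
    intro a F
    rw [← aeval_map_comp, ← perturb_map]
    simp only [γ₁, hev]
  have hw0 : (fun i => PowerSeries.map (ev 0 : Polynomial k →+* k) (w₁ i)) = w := by
    refine (h.existsUnique z).unique (fun i => ?_) fun i => hw _ (hg i)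
    rw [← hz0, hspec, hw₁, map_zero]
  have hw1 : (fun i => PowerSeries.map (ev 1 : Polynomial k →+* k) (w₁ i)) = w' := by
    refine (h.existsUnique z').unique (fun i => ?_) hw'
    rw [← hz1, hspec, hw₁, map_zero]
  obtain ⟨L', H', v', h'⟩ := h.exists_perturb w z
  have hloc := (le_and_exists_mul_mem_span hd hw g hg (fun j => σ (Sum.inl j)) h'.det_ne_zero).2 hr
  intro F hF
  obtain ⟨s, hs, hsF⟩ := hloc F hF
  have hzero : ∀ G ∈ Ideal.span (Set.range g), aeval (perturb σ l γ₁ w₁ z₁) G = 0 := by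
    intro G hG
    have : Ideal.span (Set.range g) ≤ RingHom.ker (aeval (R := k) (perturb σ l γ₁ w₁ z₁)) := by
      rw [Ideal.span_le]
      rintro _ ⟨i, rfl⟩
      exact hw₁ i
    exact this hG
  have h2 := hzero _ hsF
  rw [map_mul] at h2
  have h3 : aeval (perturb σ l γ₁ w₁ z₁) s ≠ 0 := by
    intro h0
    apply hs
    rw [← hw0, ← hz0, hspec, h0, map_zero]
  rw [← hw1, ← hz1, hspec, (mul_eq_zero.1 h2).resolve_left h3, map_zero]

theorem arcTrunc_eq_iff (l : ℕ) (γ ρ : Arc k N) :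
    arcTrunc l ρ = arcTrunc l γ ↔ ∀ j, PowerSeries.X ^ (l + 1) ∣ ρ j - γ j := by
  constructor
  · intro h j
    rw [PowerSeries.X_pow_dvd_iff]
    intro n hn
    have := congrFun h (j, ⟨n, hn⟩)
    simpa [arcTrunc, sub_eq_zero] using this
  · intro h
    funext ⟨j, n⟩
    have := PowerSeries.X_pow_dvd_iff.1 (h j) n n.2
    simpa [arcTrunc, sub_eq_zero] using this

/-- The arcs with the same `l`-jet as `γ` are the perturbations of `γ`. -/
theorem exists_perturb_eq (σ : Fin r ⊕ Fin d ≃ Fin N) {l : ℕ} {γ ρ : Arc k N}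
    (h : arcTrunc l ρ = arcTrunc l γ) : ∃ w z, ρ = perturb σ l γ w z := by
  choose y hy using (arcTrunc_eq_iff l γ ρ).1 h
  refine ⟨fun i => y (σ (Sum.inl i)), fun i => y (σ (Sum.inr i)), ?_⟩
  funext j
  rw [perturb, ← sub_eq_iff_eq_add', hy]
  obtain ⟨a | a, rfl⟩ := σ.surjective j <;> simp

theorem arcTrunc_perturb (σ : Fin r ⊕ Fin d ≃ Fin N) (l : ℕ) (γ : Arc k N)
    (w : Fin r → PowerSeries k) (z : Fin d → PowerSeries k) :
    arcTrunc l (perturb σ l γ w z) = arcTrunc l γ := by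
  rw [arcTrunc_eq_iff]
  intro j
  simp [perturb]

theorem mem_arcs_span_iff {m : ℕ} (f : Fin m → MvPolynomial (Fin N) k) (γ : Arc k N) :
    γ ∈ arcs (Ideal.span (Set.range f)) ↔ ∀ i, aeval γ (f i) = 0 := by
  constructor
  · intro h i
    exact h _ (Ideal.subset_span ⟨i, rfl⟩)
  · intro h F hF
    have : Ideal.span (Set.range f) ≤ RingHom.ker (aeval (R := k) γ) := by
      rw [Ideal.span_le]
      rintro _ ⟨i, rfl⟩
      exact h i
    exact this hF

/-- The arcs on a complete intersection with the `l`-jet of `γ` coincide with the arcs on the scheme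
defined by `I`, as soon as there is one of the latter. -/
theorem LiftData.mem_arcs_of_arcTrunc_eq [IsAlgClosed k] {e : ℕ} {I : Ideal (MvPolynomial (Fin N) k)}
    (hd : IsMinComponentDim I e) (hr : r = N - e)
    {g : Fin r → MvPolynomial (Fin N) k} (hg : ∀ i, g i ∈ I) {σ : Fin r ⊕ Fin d ≃ Fin N}
    {l : ℕ} {γ : Fin N → PowerSeries k} {L : Matrix (Fin r) (Fin r) (PowerSeries k)}
    {H : Matrix (Fin r) (Fin d) (PowerSeries k)} {v : Fin r → PowerSeries k}
    (h : LiftData g σ l γ L H v) {ρ ρ' : Arc k N} (hρ : arcTrunc l ρ = arcTrunc l γ)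
    (hρ' : arcTrunc l ρ' = arcTrunc l γ) (hI : ρ ∈ arcs I) (hg' : ∀ i, aeval ρ' (g i) = 0) :
    ρ' ∈ arcs I := by
  obtain ⟨w, z, rfl⟩ := exists_perturb_eq σ hρ
  obtain ⟨w', z', rfl⟩ := exists_perturb_eq σ hρ'
  exact h.aeval_eq_zero hd hr hg hI hg'

/-! ### Lifting data from divisibility of minors -/

/-- Divisibility conditions on the Jacobian matrix and the value of `g` at `γ`, which imply the
existence of lifting data. The order of the Jacobian minor is `E`. -/
structure MinorConditions {A : Type*} [CommRing A] [Algebra k A] (g : Fin r → MvPolynomial (Fin N) k)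
    (σ : Fin r ⊕ Fin d ≃ Fin N) (l E : ℕ) (γ : Fin N → PowerSeries A) : Prop where
  det : PowerSeries.X ^ E ∣ (jacL g σ γ).det
  isUnit : IsUnit (PowerSeries.coeff E (jacL g σ γ).det)
  col : ∀ i j, PowerSeries.X ^ E ∣ ((jacL g σ γ).adjugate * jacR g σ γ) i j
  adj : ∀ i j, PowerSeries.X ^ E ∣ PowerSeries.X ^ l * (jacL g σ γ).adjugate i j
  value : ∀ i, PowerSeries.X ^ (E + (l + 1)) ∣
    (jacL g σ γ).adjugate.mulVec (fun i => aeval γ (g i)) i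

theorem MinorConditions.exists_liftData {A : Type*} [CommRing A] [Algebra k A]
    {g : Fin r → MvPolynomial (Fin N) k} {σ : Fin r ⊕ Fin d ≃ Fin N} {l E : ℕ}
    {γ : Fin N → PowerSeries A} (h : MinorConditions g σ l E γ) :
    ∃ L H v, LiftData g σ l γ L H v := by
  obtain ⟨ε, hε⟩ := h.det
  have hu : IsUnit ε := by
    rw [PowerSeries.isUnit_iff_constantCoeff]
    have := h.isUnit
    rwa [hε, PowerSeries.coeff_X_pow_mul', if_pos le_rfl, Nat.sub_self,
      PowerSeries.coeff_zero_eq_constantCoeff] at this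
  obtain ⟨ε, rfl⟩ := hu
  have hεε : (ε : PowerSeries A) * ↑ε⁻¹ = 1 := Units.mul_inv ε
  set K := jacL g σ γ with hK
  choose L hL using h.adj
  choose H hH using h.col
  choose v hv using h.value
  have hKdet : K * K.adjugate = (PowerSeries.X ^ E * (ε : PowerSeries A)) • (1 : Matrix _ _ _) := by
    rw [Matrix.mul_adjugate, hε]
  have hKdet' : K.adjugate * K = (PowerSeries.X ^ E * (ε : PowerSeries A)) • (1 : Matrix _ _ _) := by
    rw [Matrix.adjugate_mul, hε]
  have hL' : (PowerSeries.X : PowerSeries A) ^ E • Matrix.of L = (PowerSeries.X : PowerSeries A) ^ l • K.adjugate := by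
    ext1 i j; exact (hL i j).symm
  have hH' : (PowerSeries.X : PowerSeries A) ^ E • Matrix.of H = K.adjugate * jacR g σ γ := by
    ext1 i j; exact (hH i j).symm
  have hv' : (PowerSeries.X : PowerSeries A) ^ E • ((PowerSeries.X : PowerSeries A) ^ (l + 1) • v) =
      K.adjugate.mulVec (fun i => aeval γ (g i)) := by
    funext i
    rw [hv, pow_add _ E, mul_assoc]; rfl
  have hcancel : ∀ {a b : ℕ} (M M' : Matrix (Fin a) (Fin b) (PowerSeries A)),
      (PowerSeries.X : PowerSeries A) ^ E • M = (PowerSeries.X : PowerSeries A) ^ E • M' → M = M' := by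
    intro a b M M' h
    ext1 i j
    exact PowerSeries.X_pow_mul_cancel (congrFun (congrFun h i) j)
  refine ⟨(↑ε⁻¹ : PowerSeries A) • Matrix.of L, (↑ε⁻¹ : PowerSeries A) • Matrix.of H,
    (↑ε⁻¹ : PowerSeries A) • v, ?_, ?_, ?_, ?_⟩
  · apply hcancel
    rw [smul_mul_assoc, smul_comm, ← smul_mul_assoc, hL', smul_mul_assoc, hKdet', smul_smul,
      smul_smul, smul_smul]
    congr 1
    linear_combination (PowerSeries.X ^ E * PowerSeries.X ^ l) * hεε
  · apply hcancel
    rw [mul_smul_comm, smul_comm, ← mul_smul_comm, hL', mul_smul_comm, hKdet, smul_smul,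
      smul_smul, smul_smul]
    congr 1
    linear_combination (PowerSeries.X ^ E * PowerSeries.X ^ l) * hεε
  · apply hcancel
    rw [Matrix.mul_smul, smul_comm, ← Matrix.mul_smul, hH', ← Matrix.mul_assoc, hKdet, Matrix.smul_mul,
      Matrix.one_mul, smul_smul]
    congr 1
    linear_combination PowerSeries.X ^ E * hεε
  · apply X_pow_smul_injective E
    have h1 := congrArg K.mulVec hv'
    rw [Matrix.mulVec_mulVec, hKdet, Matrix.smul_mulVec, Matrix.one_mulVec, Matrix.mulVec_smul,
      Matrix.mulVec_smul] at h1
    funext i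
    have h2 := congrFun h1 i
    simp only [Pi.smul_apply, smul_eq_mul, Matrix.mulVec_smul] at h2 ⊢
    linear_combination (-(↑ε⁻¹ : PowerSeries A)) * h2 -
      (PowerSeries.X ^ E * aeval γ (g i)) * hεε

end ArcTruncation

/-! ### Minors of matrices over a domain -/

namespace ArcTruncation

section Domain

variable {R : Type*} [CommRing R] [IsDomain R]

theorem exists_linearIndependent_comp {M ι : Type*} [AddCommGroup M] [Module R M]
    [Module.IsTorsionFree R M] [Finite ι] (v : ι → M) :
    ∃ (q : ℕ) (c : Fin q → ι), LinearIndependent R (v ∘ c) ∧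
      (∃ a : R, a ≠ 0 ∧ ∀ x ∈ Submodule.span R (Set.range v),
        a • x ∈ Submodule.span R (Set.range (v ∘ c))) ∧
      q = Module.finrank R (Submodule.span R (Set.range v)) := by
  classical
  cases nonempty_fintype ι
  obtain ⟨s, hs, hs'⟩ := exists_maximal_linearIndepOn R v
  let e : Fin (Fintype.card s) ≃ s := (Fintype.equivFin s).symm
  have hrange : Set.range (v ∘ fun i => (e i : ι)) = v '' s := by
    rw [Set.range_comp]
    congr 1
    ext x
    simp only [Set.mem_range]
    constructor
    · rintro ⟨i, rfl⟩; exact (e i).2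
    · intro hx; exact ⟨e.symm ⟨x, hx⟩, by simp⟩
  have hlin : LinearIndependent R (v ∘ fun i => (e i : ι)) :=
    LinearIndependent.comp hs e e.injective
  have ha : ∀ i, ∃ a : R, a ≠ 0 ∧ a • v i ∈ Submodule.span R (v '' s) := by
    intro i
    by_cases hi : i ∈ s
    · exact ⟨1, one_ne_zero, by rw [one_smul]; exact Submodule.subset_span ⟨i, hi, rfl⟩⟩
    · exact hs' i hi
  choose a ha0 ha using ha
  have hmul : ∀ x ∈ Submodule.span R (Set.range v), (∏ i, a i) • x ∈ Submodule.span R (v '' s) := by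
    intro x hx
    have : Submodule.span R (Set.range v) ≤
        (Submodule.span R (v '' s)).comap ((∏ i, a i) • LinearMap.id) := by
      rw [Submodule.span_le]
      rintro _ ⟨i, rfl⟩
      change (∏ i, a i) • v i ∈ Submodule.span R (v '' s)
      rw [← Finset.prod_erase_mul _ _ (Finset.mem_univ i), mul_smul]
      exact Submodule.smul_mem _ _ (ha i)
    exact this hx
  have hprod : ∏ i, a i ≠ 0 := Finset.prod_ne_zero_iff.2 fun i _ => ha0 i
  refine ⟨Fintype.card s, fun i => e i, hlin, ⟨∏ i, a i, hprod, fun x hx => hrange ▸ hmul x hx⟩, ?_⟩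
  have hcard := finrank_span_eq_card hlin
  rw [Fintype.card_fin] at hcard
  refine le_antisymm ?_ ?_
  · rw [← hcard]
    have hle : Submodule.span R (Set.range (v ∘ fun i => (e i : ι))) ≤ Submodule.span R (Set.range v) :=
      Submodule.span_mono (Set.range_comp_subset_range _ _)
    have : Module.Finite R (Submodule.span R (Set.range v)) :=
      Module.Finite.span_of_finite R (Set.finite_range v)
    exact LinearMap.finrank_le_finrank_of_injective (f := Submodule.inclusion hle)
      (Submodule.inclusion_injective hle)
  · rw [← hcard, hrange]
    have : Module.Finite R (Submodule.span R (v '' s)) :=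
      Module.Finite.span_of_finite R (Set.toFinite _)
    let φ : Submodule.span R (Set.range v) →ₗ[R] Submodule.span R (v '' s) :=
      (((∏ i, a i) • LinearMap.id : M →ₗ[R] M).restrict hmul)
    refine LinearMap.finrank_le_finrank_of_injective (f := φ) fun x y hxy => ?_
    have h1 : (∏ i, a i) • (x : M) = (∏ i, a i) • (y : M) := congrArg Subtype.val hxy
    exact Subtype.ext (smul_right_injective M hprod h1)

/-- A matrix over a domain has a nonzero minor of size the rank of its row module. -/
theorem exists_det_submatrix_ne_zero {ι κ : Type*} [Finite ι] [Finite κ] {p : ℕ}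
    (J : Matrix ι κ R)
    (hp : Module.finrank R (Submodule.span R (Set.range J.row)) = p) :
    ∃ (c : Fin p → ι) (c' : Fin p → κ), (J.submatrix c c').det ≠ 0 := by
  obtain ⟨q, c, hc, -, hq⟩ := exists_linearIndependent_comp (R := R) J.row
  obtain rfl : q = p := hq.trans hp
  obtain ⟨q', c', hc', ⟨a, ha, hspan⟩, -⟩ :=
    exists_linearIndependent_comp (R := R) (fun j i => J (c i) j : κ → Fin q → R)
  have hrow : ∀ y : Fin q → R, (∀ j, ∑ i, y i * J (c i) j = 0) → y = 0 := by
    intro y hy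
    funext i
    refine Fintype.linearIndependent_iff.1 hc y ?_ i
    funext j
    rw [Finset.sum_apply]
    exact hy j
  have hle : q' ≤ q := by simpa using hc'.fintype_card_le_finrank
  obtain rfl : q' = q := by
    by_contra hne
    -- fewer than `q` columns are annihilated by a nonzero combination of the rows
    let φ : (Fin q → R) →ₗ[R] (Fin q' → R) := Matrix.mulVecLin (Matrix.of fun j i => J (c i) (c' j))
    have hφ : ¬ Function.Injective φ := by
      intro h
      have := LinearMap.finrank_le_finrank_of_injective h
      simp at this
      omega
    apply hφ
    rw [← LinearMap.ker_eq_bot, LinearMap.ker_eq_bot']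
    intro y hy
    refine hrow y fun j => ?_
    let ψ : (Fin q → R) →ₗ[R] R := ∑ i, y i • LinearMap.proj i
    have hψ : ∀ x, ψ x = ∑ i, y i * x i := fun x => by simp [ψ]
    have h1 : Submodule.span R (Set.range ((fun j i => J (c i) j : κ → Fin q → R) ∘ c')) ≤
        LinearMap.ker ψ := by
      rw [Submodule.span_le]
      rintro _ ⟨j, rfl⟩
      rw [SetLike.mem_coe, LinearMap.mem_ker, hψ]
      have := congrFun hy j
      simpa [φ, Matrix.mulVec, dotProduct, mul_comm] using this
    have h2 := h1 (hspan _ (Submodule.subset_span ⟨j, rfl⟩))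
    rw [LinearMap.mem_ker, map_smul, smul_eq_mul, hψ] at h2
    exact (mul_eq_zero.1 h2).resolve_left ha
  refine ⟨c, c', fun h0 => ?_⟩
  obtain ⟨y, hy, hy0⟩ := Matrix.exists_mulVec_eq_zero_iff.2 h0
  refine hy (funext fun j => Fintype.linearIndependent_iff.1 hc' y ?_ j)
  funext i
  have := congrFun hy0 i
  simpa [Matrix.mulVec, dotProduct, mul_comm] using this

/-- Rows with a nonzero maximal minor are linearly independent. -/
theorem linearIndependent_of_det_submatrix_ne_zero {p N : ℕ} (J : Matrix (Fin p) (Fin N) R)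
    (c' : Fin p → Fin N) (h : (J.submatrix id c').det ≠ 0) : LinearIndependent R J.row := by
  rw [Fintype.linearIndependent_iff]
  intro y hy i
  by_contra hi
  refine h (Matrix.exists_vecMul_eq_zero_iff.1 ⟨y, fun h => hi (congrFun h i), ?_⟩)
  funext j
  have := congrFun hy (c' j)
  simpa [Matrix.vecMul, dotProduct, Matrix.row] using this

/-- A linearly independent family of maximal length spans up to torsion. -/
theorem exists_smul_mem_span {M : Type*} [AddCommGroup M] [Module R M] [IsNoetherianRing R]
    [Module.Finite R M] {p : ℕ} {S : Submodule R M} (hS : Module.finrank R S = p) (v : Fin p → M)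
    (hv : LinearIndependent R v) (hvS : ∀ i, v i ∈ S) {x : M} (hx : x ∈ S) :
    ∃ a : R, a ≠ 0 ∧ a • x ∈ Submodule.span R (Set.range v) := by
  let T : Submodule R S := (Submodule.span R (Set.range v)).comap S.subtype
  have hle : Submodule.span R (Set.range v) ≤ S := by
    rw [Submodule.span_le]
    rintro _ ⟨i, rfl⟩
    exact hvS i
  have hT : Module.finrank R T = p := by
    rw [LinearEquiv.finrank_eq (Submodule.comapSubtypeEquivOfLe hle), finrank_span_eq_card hv,
      Fintype.card_fin]
  have h0 : Module.finrank R (S ⧸ T) = 0 := by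
    have := Submodule.finrank_quotient_add_finrank T
    omega
  obtain ⟨a, ha, hax⟩ := Module.finrank_eq_zero_iff.1 h0 (Submodule.Quotient.mk ⟨x, hx⟩)
  refine ⟨a, ha, ?_⟩
  rw [← Submodule.Quotient.mk_smul, Submodule.Quotient.mk_eq_zero] at hax
  exact hax

end Domain

/-- A splitting of the coordinates which begins with a given injective family. -/
theorem exists_equiv_extending {N r d : ℕ} (hN : r + d = N) (c : Fin r → Fin N)
    (hc : Function.Injective c) : ∃ σ : Fin r ⊕ Fin d ≃ Fin N, ∀ i, σ (Sum.inl i) = c i := by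
  classical
  have hcard : Fintype.card ((Set.range c)ᶜ : Set (Fin N)) = Fintype.card (Fin d) := by
    rw [Fintype.card_compl_set, Set.card_range_of_injective hc]
    simp
    omega
  refine ⟨(Equiv.sumCongr (Equiv.ofInjective c hc) (Fintype.equivOfCardEq hcard).symm).trans
    (Equiv.Set.sumCompl (Set.range c)), fun i => ?_⟩
  simp

end ArcTruncation

/-! ### Consequences of the invariant factors -/

namespace ArcTruncation

variable {k : Type*} [Field k]

/-- The module generated by the rows of the Jacobian matrix. -/
noncomputable abbrev rowModule {N m : ℕ} (f : Fin m → MvPolynomial (Fin N) k) (γ : Arc k N) :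
    Submodule (PowerSeries k) (Fin N → PowerSeries k) :=
  Submodule.span (PowerSeries k) (Set.range (jacobianAt f γ).row)

namespace HasInvariantFactors

variable {N m p : ℕ} {f : Fin m → MvPolynomial (Fin N) k} {γ : Arc k N} {e : Fin p → ℕ}

theorem X_pow_smul_mem (h : HasInvariantFactors f γ e) {l : ℕ} (hl : ∀ i, e i ≤ l)
    {x : Fin N → PowerSeries k} {a : PowerSeries k} (ha : a ≠ 0) (hx : a • x ∈ rowModule f γ) :
    (PowerSeries.X : PowerSeries k) ^ l • x ∈ rowModule f γ := by
  obtain ⟨-, -, ⟨φ⟩⟩ := h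
  rw [← Submodule.Quotient.mk_eq_zero, Submodule.Quotient.mk_smul] at hx ⊢
  rw [← φ.map_eq_zero_iff, map_smul] at hx ⊢
  generalize φ (Submodule.Quotient.mk x) = y at hx ⊢
  obtain ⟨y1, y2⟩ := y
  rw [Prod.smul_mk, Prod.mk_eq_zero] at hx ⊢
  constructor
  · funext i
    obtain ⟨b, hb⟩ := Ideal.Quotient.mk_surjective (y1 i)
    rw [Pi.smul_apply, Pi.zero_apply, ← hb]
    change Ideal.Quotient.mk _ ((PowerSeries.X : PowerSeries k) ^ l * b) = 0
    rw [Ideal.Quotient.eq_zero_iff_mem, Ideal.mem_span_singleton]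
    exact (pow_dvd_pow _ (hl i)).mul_right _
  · funext i
    have := congrFun hx.2 i
    have h0 : y2 i = 0 := (mul_eq_zero.1 this).resolve_left ha
    simp [h0]

theorem finrank_rowModule (h : HasInvariantFactors f γ e) :
    Module.finrank (PowerSeries k) (rowModule f γ) = p := by
  obtain ⟨hp, -, ⟨φ⟩⟩ := id h
  have hpN : p ≤ N := hp.trans (min_le_right _ _)
  have h1 := Submodule.finrank_quotient_add_finrank (rowModule f γ)
  rw [φ.finrank_eq, Module.finrank_fin_fun] at h1
  have h2 := Submodule.finrank_quotient_add_finrank (LinearMap.ker (LinearMap.snd (PowerSeries k)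
    ((i : Fin p) → PowerSeries k ⧸ Ideal.span {(PowerSeries.X : PowerSeries k) ^ e i})
      (Fin (N - p) → PowerSeries k)))
  rw [(LinearMap.quotKerEquivOfSurjective _ LinearMap.snd_surjective).finrank_eq,
    Module.finrank_fin_fun] at h2
  have h3 : Module.finrank (PowerSeries k) (LinearMap.ker (LinearMap.snd (PowerSeries k)
      ((i : Fin p) → PowerSeries k ⧸ Ideal.span {(PowerSeries.X : PowerSeries k) ^ e i})
        (Fin (N - p) → PowerSeries k))) = 0 := by
    refine (Module.finrank_eq_zero_iff (R := PowerSeries k) (M := LinearMap.ker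
      (LinearMap.snd (PowerSeries k) ((i : Fin p) → PowerSeries k ⧸
        Ideal.span {(PowerSeries.X : PowerSeries k) ^ e i}) (Fin (N - p) → PowerSeries k)))).2 ?_
    rintro ⟨⟨y1, y2⟩, hy⟩
    obtain rfl : y2 = 0 := hy
    refine ⟨PowerSeries.X ^ (∑ i, e i), pow_ne_zero _ PowerSeries.X_ne_zero, ?_⟩
    refine Subtype.ext (Prod.ext ?_ (smul_zero _))
    funext i
    change (PowerSeries.X : PowerSeries k) ^ (∑ i, e i) • y1 i = 0
    obtain ⟨b, hb⟩ := Ideal.Quotient.mk_surjective (y1 i)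
    rw [← hb]
    change Ideal.Quotient.mk _ ((PowerSeries.X : PowerSeries k) ^ (∑ i, e i) * b) = 0
    rw [Ideal.Quotient.eq_zero_iff_mem, Ideal.mem_span_singleton]
    exact (pow_dvd_pow _ (Finset.single_le_sum (fun _ _ => Nat.zero_le _) (Finset.mem_univ i))).mul_right _
  omega

/-- The number of invariant factors at an arc is at most the codimension. -/
theorem le_codim [IsAlgClosed k] {d : ℕ} (hd : IsMinComponentDim (Ideal.span (Set.range f)) d)
    (hγ : γ ∈ arcs (Ideal.span (Set.range f))) (h : HasInvariantFactors f γ e) : p ≤ N - d := by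
  obtain ⟨c, c', hdet⟩ := exists_det_submatrix_ne_zero _ h.finrank_rowModule
  exact (le_and_exists_mul_mem_span hd hγ (fun i => f (c i))
    (fun i => Ideal.subset_span ⟨c i, rfl⟩) c' hdet).1

theorem aeval_pderiv_mem_rowModule (hγ : γ ∈ arcs (Ideal.span (Set.range f)))
    {F : MvPolynomial (Fin N) k} (hF : F ∈ Ideal.span (Set.range f)) :
    (fun j => MvPolynomial.aeval γ (MvPolynomial.pderiv j F)) ∈ rowModule f γ := by
  refine Submodule.span_induction (p := fun F _ =>
    (fun j => MvPolynomial.aeval γ (MvPolynomial.pderiv j F)) ∈ rowModule f γ) ?_ ?_ ?_ ?_ hF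
  · rintro _ ⟨i, rfl⟩
    exact Submodule.subset_span ⟨i, rfl⟩
  · simp only [map_zero]; exact Submodule.zero_mem _
  · intro F G _ _ hF hG
    simp only [map_add]
    exact Submodule.add_mem _ hF hG
  · intro a F hF' hF
    have h0 : MvPolynomial.aeval γ F = 0 := hγ F hF'
    have : (fun j => MvPolynomial.aeval γ (MvPolynomial.pderiv j (a • F))) =
        MvPolynomial.aeval γ a • fun j => MvPolynomial.aeval γ (MvPolynomial.pderiv j F) := by
      funext j
      simp [Derivation.leibniz, h0]
    rw [this]
    exact Submodule.smul_mem _ _ hF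

/-- Outside the Jacobian subscheme there are at least as many invariant factors as the
codimension. -/
theorem le_of_notMem_jacIdeal {r : ℕ} (hγ : γ ∈ arcs (Ideal.span (Set.range f)))
    (hJ : γ ∉ arcs (jacIdeal (Ideal.span (Set.range f)) r)) (h : HasInvariantFactors f γ e) :
    r ≤ p := by
  obtain ⟨g, c, hg, hdet⟩ : ∃ (g : Fin r → MvPolynomial (Fin N) k) (c : Fin r ↪o Fin N),
      (∀ i, g i ∈ Ideal.span (Set.range f)) ∧
      MvPolynomial.aeval γ (Matrix.of fun i j => MvPolynomial.pderiv (c j) (g i)).det ≠ 0 := by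
    by_contra! hcon
    apply hJ
    have : jacIdeal (Ideal.span (Set.range f)) r ≤ RingHom.ker (MvPolynomial.aeval (R := k) γ) := by
      refine sup_le (fun F hF => hγ F hF) ?_
      rw [Ideal.span_le]
      rintro _ ⟨g, c, hg, rfl⟩
      exact hcon g c hg
    exact fun F hF => this hF
  have hdet' : ((jacobianAt g γ).submatrix id c).det ≠ 0 := by
    intro h0
    apply hdet
    rw [← h0]
    erw [AlgHom.map_det]
    rfl
  have hlin := linearIndependent_of_det_submatrix_ne_zero _ _ hdet'
  have hmem : ∀ i, (jacobianAt g γ).row i ∈ rowModule f γ := fun i =>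
    aeval_pderiv_mem_rowModule hγ (hg i)
  have hlin' : LinearIndependent (PowerSeries k) fun i =>
      (⟨(jacobianAt g γ).row i, hmem i⟩ : rowModule f γ) :=
    LinearIndependent.of_comp (rowModule f γ).subtype hlin
  have := hlin'.fintype_card_le_finrank
  rwa [Fintype.card_fin, h.finrank_rowModule] at this

/-- An arc on the scheme, with invariant factors of exponents at most `l` and in number the
codimension, satisfies the divisibility conditions for some choice of equations and coordinates:
those of a maximal Jacobian minor of least order. -/
theorem exists_minorConditions {d r l : ℕ} (hrd : r + d = N) {e : Fin r → ℕ} (hl : ∀ i, e i ≤ l)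
    (hγ : γ ∈ arcs (Ideal.span (Set.range f))) (h : HasInvariantFactors f γ e) :
    ∃ (c : Fin r → Fin m) (σ : Fin r ⊕ Fin d ≃ Fin N) (E : ℕ),
      MinorConditions (fun i => f (c i)) σ l E γ := by
  classical
  set J := jacobianAt f γ with hJ
  -- a minor `K` of least order `E`
  have hex : ∃ E, ∃ (c : Fin r → Fin m) (c' : Fin r → Fin N),
      PowerSeries.coeff E (J.submatrix c c').det ≠ 0 := by
    obtain ⟨c, c', h0⟩ := exists_det_submatrix_ne_zero _ h.finrank_rowModule
    by_contra! hcon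
    exact h0 (PowerSeries.ext fun E => hcon E c c')
  obtain ⟨c, c', hcc'⟩ := Nat.find_spec hex
  set E := Nat.find hex with hE
  have hmin : ∀ (c : Fin r → Fin m) (c' : Fin r → Fin N),
      PowerSeries.X ^ E ∣ (J.submatrix c c').det := by
    intro c c'
    rw [PowerSeries.X_pow_dvd_iff]
    intro n hn
    by_contra hne
    exact Nat.find_min hex hn ⟨c, c', hne⟩
  set K := J.submatrix c c' with hK
  have hdet : K.det ≠ 0 := fun h0 => hcc' (by rw [h0, map_zero])
  have hcinj : Function.Injective c' := by
    intro i j hij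
    by_contra hne
    exact hdet (Matrix.det_zero_of_column_eq hne fun l => by simp [hK, hij])
  obtain ⟨σ, hσ⟩ := exists_equiv_extending hrd c' hcinj
  have hjacL : jacL (fun i => f (c i)) σ γ = K := by
    ext1 i j
    change MvPolynomial.aeval γ (MvPolynomial.pderiv (σ (Sum.inl j)) (f (c i))) = _
    rw [hσ]
    rfl
  -- by Cramer's rule, exchanging a column or a row of `K` gives further minors, of order at least `E`
  have hcol : ∀ j b, PowerSeries.X ^ E ∣ K.adjugate.mulVec (fun i => J (c i) b) j := by
    intro j b
    rw [← Matrix.cramer_eq_adjugate_mulVec, Matrix.cramer_apply]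
    have : K.updateCol j (fun i => J (c i) b) = J.submatrix c (Function.update c' j b) := by
      ext1 i j'
      by_cases hj : j' = j
      · subst hj; simp
      · simp [hj, hK]
    rw [this]
    exact hmin _ _
  have hrowd : ∀ i j, PowerSeries.X ^ E ∣ Matrix.vecMul (fun b => J i (c' b)) K.adjugate j := by
    intro i j
    rw [← Matrix.mulVec_transpose, Matrix.adjugate_transpose, ← Matrix.cramer_eq_adjugate_mulVec,
      Matrix.cramer_transpose_apply]
    have : K.updateRow j (fun b => J i (c' b)) = J.submatrix (Function.update c j i) c' := by
      ext1 a b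
      by_cases ha : a = j
      · subst ha; simp
      · simp [ha, hK]
    rw [this]
    exact hmin _ _
  obtain ⟨ε, hε⟩ := hmin c c'
  have hεu : IsUnit ε := by
    rw [PowerSeries.isUnit_iff_constantCoeff, isUnit_iff_ne_zero]
    rwa [hε, PowerSeries.coeff_X_pow_mul', if_pos le_rfl, Nat.sub_self,
      PowerSeries.coeff_zero_eq_constantCoeff] at hcc'
  obtain ⟨ε, rfl⟩ := hεu
  have hX : (PowerSeries.X : PowerSeries k) ^ E ≠ 0 := pow_ne_zero _ PowerSeries.X_ne_zero
  set Jc : Matrix (Fin r) (Fin N) (PowerSeries k) := J.submatrix c id with hJc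
  have hlin : LinearIndependent (PowerSeries k) Jc.row :=
    linearIndependent_of_det_submatrix_ne_zero Jc c' hdet
  have hres : ∀ μ : Fin r → PowerSeries k, (fun b => Matrix.vecMul μ Jc (c' b)) = Matrix.vecMul μ K :=
    fun μ => rfl
  have hspan : ∀ x, x ∈ Submodule.span (PowerSeries k) (Set.range Jc.row) ↔
      ∃ μ : Fin r → PowerSeries k, Matrix.vecMul μ Jc = x := by
    intro x
    rw [Submodule.mem_span_range_iff_exists_fun]
    refine exists_congr fun μ => ?_
    rw [Matrix.vecMul_eq_sum]
    rfl
  -- the chosen rows generate the row module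
  have hgen : rowModule f γ ≤ Submodule.span (PowerSeries k) (Set.range Jc.row) := by
    rw [Submodule.span_le]
    rintro _ ⟨i, rfl⟩
    obtain ⟨a, ha, hai⟩ := exists_smul_mem_span h.finrank_rowModule Jc.row hlin
      (fun j => Submodule.subset_span ⟨c j, rfl⟩) (Submodule.subset_span ⟨i, rfl⟩)
    obtain ⟨μ, hμ⟩ := (hspan _).1 hai
    choose ν hν using hrowd i
    have h1 : a • (fun b => J i (c' b)) = Matrix.vecMul μ K := by
      rw [← hres, hμ]; rfl
    have h2 : a • Matrix.vecMul (fun b => J i (c' b)) K.adjugate = K.det • μ := by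
      rw [← Matrix.smul_vecMul, h1, Matrix.vecMul_vecMul, Matrix.mul_adjugate, Matrix.vecMul_smul,
        Matrix.vecMul_one]
    have h3 : a • (PowerSeries.X : PowerSeries k) ^ E • ν = K.det • μ := by
      rw [← h2]
      congr 1
      funext j
      exact (hν j).symm
    refine (hspan _).2 ⟨(↑ε⁻¹ : PowerSeries k) • ν, ?_⟩
    have h4 : (a * K.det) • J.row i = (a * K.det) • Matrix.vecMul ((↑ε⁻¹ : PowerSeries k) • ν) Jc := by
      rw [mul_comm, mul_smul]
      change K.det • (a • J.row i) = _
      rw [← hμ, ← Matrix.smul_vecMul, ← h3, hε, ← Matrix.smul_vecMul, smul_smul, smul_smul]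
      congr 2
      have : (ε : PowerSeries k) * ↑ε⁻¹ = 1 := Units.mul_inv ε
      linear_combination (-(PowerSeries.X ^ E * a)) * this
    exact (smul_right_injective (Fin N → PowerSeries k) (mul_ne_zero ha hdet) h4).symm
  have hKadj : K.adjugate * K = K.det • (1 : Matrix _ _ _) := Matrix.adjugate_mul K
  refine ⟨c, σ, E, ?_, ?_, ?_, ?_, ?_⟩
  · rw [hjacL, hε]; exact dvd_mul_right _ _
  · rw [hjacL]; exact hcc'.isUnit
  · intro i j
    rw [hjacL]
    exact hcol i (σ (Sum.inr j))
  · intro i j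
    rw [hjacL]
    -- `t ^ E` times `P` is in the row module, hence so is `t ^ l` times `P`; comparing the columns
    -- of `K` shows that row `i` of `t ^ l K⁻¹` is integral
    choose P hP using hcol i
    have hPc : ∀ b, P (c' b) = if i = b then (ε : PowerSeries k) else 0 := by
      intro b
      apply mul_left_cancel₀ hX
      rw [← hP]
      change (K.adjugate * K) i b = _
      rw [hKadj, hε, Matrix.smul_apply, Matrix.one_apply]
      by_cases hib : i = b <;> simp [hib]
    have hPmem : (PowerSeries.X : PowerSeries k) ^ E • P ∈ rowModule f γ := by
      have : (PowerSeries.X : PowerSeries k) ^ E • P = Matrix.vecMul (K.adjugate i) Jc := by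
        funext b
        exact (hP b).symm
      rw [this, Matrix.vecMul_eq_sum]
      exact Submodule.sum_mem _ fun j _ => Submodule.smul_mem _ _ (Submodule.subset_span ⟨c j, rfl⟩)
    obtain ⟨ν, hν⟩ := (hspan _).1 (hgen (h.X_pow_smul_mem hl hX hPmem))
    have h1 : Matrix.vecMul ν K = fun b => PowerSeries.X ^ l * (if i = b then (ε : PowerSeries k) else 0) := by
      rw [← hres, hν]
      funext b
      simp [hPc]
    have h2 : K.det • ν = Matrix.vecMul
        (fun b => PowerSeries.X ^ l * (if i = b then (ε : PowerSeries k) else 0)) K.adjugate := by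
      rw [← h1, Matrix.vecMul_vecMul, Matrix.mul_adjugate, Matrix.vecMul_smul, Matrix.vecMul_one]
    have h3 := congrFun h2 j
    have hε' : K.det = PowerSeries.X ^ E * (ε : PowerSeries k) := hε
    simp only [Matrix.vecMul, dotProduct, mul_ite, mul_zero, ite_mul, zero_mul, Finset.sum_ite_eq,
      Finset.mem_univ, if_true, Pi.smul_apply, smul_eq_mul, hε'] at h3
    refine ⟨ν j, ?_⟩
    have : (ε : PowerSeries k) * ↑ε⁻¹ = 1 := Units.mul_inv ε
    linear_combination (-(↑ε⁻¹ : PowerSeries k)) * h3 +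
      (PowerSeries.X ^ E * ν j - PowerSeries.X ^ l * K.adjugate i j) * this
  · intro i
    have : (fun i => MvPolynomial.aeval γ (f (c i))) = 0 := by
      funext i
      exact hγ _ (Ideal.subset_span ⟨c i, rfl⟩)
    rw [this, Matrix.mulVec_zero]
    exact dvd_zero _

end HasInvariantFactors

end ArcTruncation

/-! ### Existence of invariant factors -/

namespace ArcTruncation
open MvPolynomial

variable {k : Type*} [Field k]

/-- Over a field, lifting data give the divisibility conditions, with a bound on the order of the
Jacobian minor. -/
theorem LiftData.exists_minorConditions {N r d : ℕ} {g : Fin r → MvPolynomial (Fin N) k}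
    {σ : Fin r ⊕ Fin d ≃ Fin N} {l : ℕ} {γ : Fin N → PowerSeries k}
    {L : Matrix (Fin r) (Fin r) (PowerSeries k)} {H : Matrix (Fin r) (Fin d) (PowerSeries k)}
    {v : Fin r → PowerSeries k} (h : LiftData g σ l γ L H v) :
    ∃ E ≤ l * r, MinorConditions g σ l E γ := by
  have h1 := congrArg Matrix.det h.mul_left
  rw [Matrix.det_mul, Matrix.det_smul, Matrix.det_one, mul_one, Fintype.card_fin, ← pow_mul] at h1
  obtain ⟨E, hE, hass⟩ := (dvd_prime_pow PowerSeries.X_prime (l * r)).1 (Dvd.intro_left _ h1)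
  obtain ⟨ε, hε⟩ := hass.symm
  have hdvd : PowerSeries.X ^ E ∣ (jacL g σ γ).det := ⟨ε, hε.symm⟩
  refine ⟨E, hE, hdvd, ?_, ?_, ?_, ?_⟩
  · rw [← hε, PowerSeries.coeff_X_pow_mul', if_pos le_rfl, Nat.sub_self,
      PowerSeries.coeff_zero_eq_constantCoeff]
    exact ε.isUnit.map _
  · intro i j
    rw [← h.col, ← Matrix.mul_assoc, Matrix.adjugate_mul, Matrix.smul_mul, Matrix.one_mul]
    exact hdvd.mul_right _
  · intro i j
    have h2 : (PowerSeries.X : PowerSeries k) ^ l • (jacL g σ γ).adjugate = (jacL g σ γ).det • L := by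
      rw [← one_mul L, ← smul_mul_assoc, ← Matrix.adjugate_mul, Matrix.mul_assoc, h.mul_right,
        Matrix.mul_smul, Matrix.mul_one]
    have h3 : PowerSeries.X ^ l * (jacL g σ γ).adjugate i j = (jacL g σ γ).det * L i j :=
      congrFun (congrFun h2 i) j
    rw [h3]
    exact hdvd.mul_right _
  · intro i
    rw [h.value, Matrix.mulVec_smul, Matrix.mulVec_mulVec, Matrix.adjugate_mul, Matrix.smul_mulVec,
      Matrix.one_mulVec, Pi.smul_apply, Pi.smul_apply, smul_eq_mul, smul_eq_mul, mul_comm, pow_add]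
    exact mul_dvd_mul (hdvd.mul_right _) dvd_rfl

/-- Every arc has invariant factors, by the Smith normal form over `k[[t]]`. -/
theorem exists_hasInvariantFactors {N m : ℕ} (f : Fin m → MvPolynomial (Fin N) k) (γ : Arc k N) :
    ∃ (p : ℕ) (e : Fin p → ℕ), HasInvariantFactors f γ e := by
  classical
  obtain ⟨p, bM, bN, F, a, snf⟩ := Submodule.smithNormalForm
    (Pi.basisFun (PowerSeries k) (Fin N)) (rowModule f γ)
  have ha0 : ∀ i, a i ≠ 0 := by
    intro i h0
    apply bN.ne_zero i
    apply Subtype.ext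
    rw [snf, h0, zero_smul]; rfl
  have hpow : ∀ i, ∃ n : ℕ, Associated (a i) (PowerSeries.X ^ n) := by
    intro i
    obtain ⟨n, u, hu⟩ := IsDiscreteValuationRing.eq_unit_mul_pow_irreducible (ha0 i)
      PowerSeries.X_prime.irreducible
    refine ⟨n, ?_⟩
    rw [hu]
    exact associated_unit_mul_left _ _ u.isUnit
  choose n hn using hpow
  -- the permutation which makes the exponents increase
  set s := Tuple.sort n
  have hpN : p ≤ N := by simpa using Fintype.card_le_of_injective F F.injective
  have hpm : p ≤ m := by
    have h1 := Module.finrank_eq_card_basis bN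
    have h2 : Module.finrank (PowerSeries k) (rowModule f γ) ≤ Fintype.card (Fin m) :=
      finrank_range_le_card _
    simpa [h1] using h2
  obtain ⟨σ, hσ⟩ := exists_equiv_extending (d := N - p) (by omega) (fun i => F (s i))
    (F.injective.comp s.injective)
  refine ⟨p, n ∘ s, le_min hpm hpN, Tuple.monotone_sort n, ⟨?_⟩⟩
  let Φ : (Fin N → PowerSeries k) →ₗ[PowerSeries k]
      ((i : Fin p) → PowerSeries k ⧸ Ideal.span {(PowerSeries.X : PowerSeries k) ^ (n ∘ s) i}) ×
        (Fin (N - p) → PowerSeries k) :=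
    LinearMap.prod (LinearMap.pi fun i => (Submodule.mkQ (Ideal.span
      {(PowerSeries.X : PowerSeries k) ^ (n ∘ s) i})).comp (bM.coord (σ (Sum.inl i))))
      (LinearMap.pi fun j => bM.coord (σ (Sum.inr j)))
  have hsurj : Function.Surjective Φ := by
    rintro ⟨y1, y2⟩
    choose b hb using fun i => Ideal.Quotient.mk_surjective (y1 i)
    refine ⟨bM.equivFun.symm fun j => Sum.elim b y2 (σ.symm j), ?_⟩
    refine Prod.ext (funext fun i => ?_) (funext fun j => ?_)
    · refine Eq.trans ?_ (hb i)
      change Submodule.Quotient.mk (bM.equivFun (bM.equivFun.symm _) (σ (Sum.inl i))) = _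
      rw [LinearEquiv.apply_symm_apply]
      simp
    · change bM.equivFun (bM.equivFun.symm _) (σ (Sum.inr j)) = _
      rw [LinearEquiv.apply_symm_apply]
      simp
  have hmemk : ∀ x, x ∈ LinearMap.ker Φ ↔
      (∀ i, PowerSeries.X ^ n i ∣ bM.repr x (F i)) ∧ ∀ j, bM.repr x (σ (Sum.inr j)) = 0 := by
    intro x
    rw [LinearMap.mem_ker, Prod.ext_iff, _root_.funext_iff, _root_.funext_iff]
    refine and_congr ?_ Iff.rfl
    refine Iff.trans ?_ (s.forall_congr_right (q := fun i => PowerSeries.X ^ n i ∣ bM.repr x (F i)))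
    refine forall_congr' fun i => ?_
    change Submodule.Quotient.mk (bM.repr x (σ (Sum.inl i))) = 0 ↔ _
    rw [Submodule.Quotient.mk_eq_zero, Ideal.mem_span_singleton, hσ]
    rfl
  have hker : LinearMap.ker Φ = rowModule f γ := by
    apply le_antisymm
    · intro x hx
      rw [hmemk] at hx
      have hsum := bM.sum_repr x
      rw [← Equiv.sum_comp σ, Fintype.sum_sum_type] at hsum
      simp only [hx.2, zero_smul, Finset.sum_const_zero, add_zero, hσ] at hsum
      rw [← hsum]
      refine Submodule.sum_mem _ fun i _ => ?_
      obtain ⟨c, hc⟩ := (hn (s i)).dvd.trans (hx.1 (s i))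
      rw [hc, mul_comm, mul_smul, ← snf]
      exact Submodule.smul_mem _ _ (bN (s i)).2
    · intro x hx
      have hsum := congrArg Subtype.val (bN.sum_repr ⟨x, hx⟩)
      change _ = x at hsum
      rw [← hsum, Submodule.coe_sum]
      refine Submodule.sum_mem _ fun i _ => ?_
      rw [Submodule.coe_smul, snf]
      refine Submodule.smul_mem _ _ ((hmemk _).2 ⟨fun i' => ?_, fun j => ?_⟩)
      · rw [map_smul, bM.repr_self, Finsupp.smul_apply, Finsupp.single_apply]
        split_ifs with hi
        · obtain rfl := F.injective hi
          exact (hn _).dvd'.mul_right _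
        · simp
      · rw [map_smul, bM.repr_self, Finsupp.smul_apply, Finsupp.single_apply, if_neg, smul_zero]
        intro hi
        have : F i = σ (Sum.inl (s.symm i)) := by rw [hσ]; simp
        rw [this] at hi
        exact Sum.inl_ne_inr (σ.injective hi)
  exact (Submodule.quotEquivOfEq _ _ hker.symm).trans (Φ.quotKerEquivOfSurjective hsurj)

end ArcTruncation

/-! ### Invariant factors and jets -/

namespace ArcTruncation
open MvPolynomial

/-- The `j`-th block Toeplitz matrix of the Jacobian matrix: the row with index `(i, a)` consists of
the coefficients of order less than `j` of `t ^ a` times the `i`-th row. -/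
noncomputable def toeplitz {k A : Type*} [Field k] [CommRing A] [Algebra k A] {N m : ℕ}
    (f : Fin m → MvPolynomial (Fin N) k) (γ : Fin N → PowerSeries A) (j : ℕ) :
    Matrix (Fin m × Fin j) (Fin N × Fin j) A :=
  Matrix.of fun ia bc => PowerSeries.coeff (bc.2 : ℕ)
    (PowerSeries.X ^ (ia.2 : ℕ) * aeval γ (pderiv bc.1 (f ia.1)))

variable {k : Type*} [Field k]

/-- The coefficients of order less than `j`. -/
noncomputable def coeffsBelow (N j : ℕ) : (Fin N → PowerSeries k) →ₗ[k] (Fin N × Fin j → k) :=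
  LinearMap.pi fun bc => (PowerSeries.coeff (bc.2 : ℕ)).restrictScalars k ∘ₗ LinearMap.proj bc.1

theorem coeffsBelow_apply {N j : ℕ} (x : Fin N → PowerSeries k) (bc : Fin N × Fin j) :
    coeffsBelow N j x bc = PowerSeries.coeff (bc.2 : ℕ) (x bc.1) := rfl

theorem coeffsBelow_eq_zero_iff {N j : ℕ} (x : Fin N → PowerSeries k) :
    coeffsBelow N j x = 0 ↔ ∀ b, PowerSeries.X ^ j ∣ x b := by
  constructor
  · intro h b
    rw [PowerSeries.X_pow_dvd_iff]
    intro n hn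
    exact congrFun h (b, ⟨n, hn⟩)
  · intro h
    funext bc
    exact PowerSeries.X_pow_dvd_iff.1 (h bc.1) _ bc.2.2

theorem coeffsBelow_surjective {N j : ℕ} : Function.Surjective (coeffsBelow (k := k) N j) := by
  intro y
  refine ⟨fun b => PowerSeries.mk fun n => if h : n < j then y (b, ⟨n, h⟩) else 0, ?_⟩
  funext ⟨b, c⟩
  rw [coeffsBelow_apply, PowerSeries.coeff_mk, dif_pos c.2]

theorem span_row_toeplitz {N m : ℕ} (f : Fin m → MvPolynomial (Fin N) k) (γ : Arc k N) (j : ℕ) :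
    Submodule.span k (Set.range (toeplitz f γ j).row) =
      ((rowModule f γ).restrictScalars k).map (coeffsBelow N j) := by
  have hrow : ∀ i a, (toeplitz f γ j).row (i, a) = coeffsBelow N j
      ((PowerSeries.X : PowerSeries k) ^ (a : ℕ) • (jacobianAt f γ).row i) := fun i a => rfl
  apply le_antisymm
  · rw [Submodule.span_le]
    rintro _ ⟨⟨i, a⟩, rfl⟩
    rw [hrow]
    exact ⟨_, (rowModule f γ).smul_mem _ (Submodule.subset_span ⟨i, rfl⟩), rfl⟩
  · rintro _ ⟨x, hx, rfl⟩
    have hx' : x ∈ rowModule f γ := hx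
    obtain ⟨y, rfl⟩ := (Submodule.mem_span_range_iff_exists_fun _).1 hx'
    rw [map_sum]
    refine Submodule.sum_mem _ fun i _ => ?_
    have hsum : coeffsBelow N j (y i • (jacobianAt f γ).row i) =
        ∑ a : Fin j, PowerSeries.coeff (a : ℕ) (y i) • (toeplitz f γ j).row (i, a) := by
      simp only [hrow, ← map_smul, ← map_sum]
      rw [← sub_eq_zero, ← map_sub, coeffsBelow_eq_zero_iff]
      intro b
      have : (y i • (jacobianAt f γ).row i - ∑ a : Fin j, PowerSeries.coeff (a : ℕ) (y i) •
          (PowerSeries.X : PowerSeries k) ^ (a : ℕ) • (jacobianAt f γ).row i) b =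
          (y i - ∑ a : Fin j, PowerSeries.C (PowerSeries.coeff (a : ℕ) (y i)) *
            PowerSeries.X ^ (a : ℕ)) * (jacobianAt f γ).row i b := by
        simp only [Pi.sub_apply, Finset.sum_apply, Pi.smul_apply, sub_mul, Finset.sum_mul,
          smul_eq_mul, PowerSeries.smul_eq_C_mul, mul_assoc]
      rw [this]
      refine Dvd.dvd.mul_right ?_ _
      rw [PowerSeries.X_pow_dvd_iff]
      intro n hn
      rw [map_sub, map_sum, Finset.sum_eq_single ⟨n, hn⟩]
      · simp
      · intro a _ ha
        rw [PowerSeries.coeff_C_mul, PowerSeries.coeff_X_pow, if_neg, mul_zero]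
        intro h
        exact ha (Fin.ext h.symm)
      · simp
    rw [hsum]
    exact Submodule.sum_mem _ fun a _ => Submodule.smul_mem _ _ (Submodule.subset_span ⟨_, rfl⟩)

/-- The coefficients of order less than `min e j` of an element of `k[[t]] / (t ^ e)`. -/
noncomputable def quotCoeffs (e j : ℕ) :
    (PowerSeries k ⧸ Ideal.span {(PowerSeries.X : PowerSeries k) ^ e}) →ₗ[k] (Fin (min e j) → k) :=
  (((Ideal.span {(PowerSeries.X : PowerSeries k) ^ e}).restrictScalars k).liftQ
    (LinearMap.pi fun n : Fin (min e j) => (PowerSeries.coeff (n : ℕ)).restrictScalars k) (by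
      intro x hx
      have hx' : PowerSeries.X ^ e ∣ x := Ideal.mem_span_singleton.1 hx
      rw [LinearMap.mem_ker]
      funext n
      exact PowerSeries.X_pow_dvd_iff.1 hx' _ (n.2.trans_le (min_le_left _ _)))).comp
    (Submodule.Quotient.restrictScalarsEquiv k
      (Ideal.span {(PowerSeries.X : PowerSeries k) ^ e})).symm.toLinearMap

theorem quotCoeffs_mk (e j : ℕ) (x : PowerSeries k) (n : Fin (min e j)) :
    quotCoeffs e j (Ideal.Quotient.mk _ x) n = PowerSeries.coeff (n : ℕ) x := rfl

theorem quotCoeffs_eq_zero_iff (e j : ℕ)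
    (x : PowerSeries k ⧸ Ideal.span {(PowerSeries.X : PowerSeries k) ^ e}) :
    quotCoeffs e j x = 0 ↔ ∃ y, x = (PowerSeries.X : PowerSeries k) ^ j • y := by
  constructor
  · obtain ⟨x, rfl⟩ := Ideal.Quotient.mk_surjective x
    intro h
    have h1 : PowerSeries.X ^ (min e j) ∣ x := by
      rw [PowerSeries.X_pow_dvd_iff]
      intro n hn
      exact congrFun h ⟨n, hn⟩
    rcases le_total e j with hej | hej
    · refine ⟨0, ?_⟩
      rw [smul_zero, Ideal.Quotient.eq_zero_iff_mem, Ideal.mem_span_singleton]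
      rwa [min_eq_left hej] at h1
    · rw [min_eq_right hej] at h1
      obtain ⟨y, rfl⟩ := h1
      exact ⟨Ideal.Quotient.mk _ y, rfl⟩
  · rintro ⟨y, rfl⟩
    obtain ⟨y, rfl⟩ := Ideal.Quotient.mk_surjective y
    funext n
    change PowerSeries.coeff (n : ℕ) ((PowerSeries.X : PowerSeries k) ^ j * y) = 0
    exact PowerSeries.X_pow_dvd_iff.1 (dvd_mul_right _ _) _ (n.2.trans_le (min_le_right _ _))

theorem quotCoeffs_surjective (e j : ℕ) : Function.Surjective (quotCoeffs (k := k) e j) := by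
  intro y
  refine ⟨Ideal.Quotient.mk _ (PowerSeries.mk fun n => if h : n < min e j then y ⟨n, h⟩ else 0), ?_⟩
  funext n
  rw [quotCoeffs_mk, PowerSeries.coeff_mk, dif_pos n.2]

/-- The invariant factors determine the ranks of the block Toeplitz matrices. -/
theorem HasInvariantFactors.rank_toeplitz {N m p : ℕ} {f : Fin m → MvPolynomial (Fin N) k}
    {γ : Arc k N} {e : Fin p → ℕ} (h : HasInvariantFactors f γ e) (j : ℕ) :
    (toeplitz f γ j).rank = ∑ i, (j - e i) := by
  obtain ⟨hp, -, ⟨φ⟩⟩ := h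
  have hpN : p ≤ N := hp.trans (min_le_right _ _)
  let T := ((i : Fin p) → PowerSeries k ⧸ Ideal.span {(PowerSeries.X : PowerSeries k) ^ e i}) ×
        (Fin (N - p) → PowerSeries k)
  let Ψ : T →ₗ[k] ((i : Fin p) → Fin (min (e i) j) → k) × (Fin (N - p) × Fin j → k) :=
    LinearMap.prodMap (LinearMap.piMap fun i => quotCoeffs (e i) j) (coeffsBelow (N - p) j)
  have hΨ : Function.Surjective Ψ := by
    rintro ⟨y1, y2⟩
    choose x1 hx1 using fun i => quotCoeffs_surjective (e i) j (y1 i)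
    obtain ⟨x2, hx2⟩ := coeffsBelow_surjective y2
    exact ⟨(x1, x2), Prod.ext (funext hx1) hx2⟩
  have hΨ0 : ∀ x, Ψ x = 0 ↔ ∃ y, x = (PowerSeries.X : PowerSeries k) ^ j • y := by
    rintro ⟨x1, x2⟩
    have h1 : Ψ (x1, x2) = 0 ↔ (∀ i, quotCoeffs (e i) j (x1 i) = 0) ∧ coeffsBelow (N - p) j x2 = 0 := by
      rw [Prod.ext_iff, _root_.funext_iff]; rfl
    rw [h1]
    simp only [quotCoeffs_eq_zero_iff, coeffsBelow_eq_zero_iff]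
    constructor
    · rintro ⟨h2, h3⟩
      choose y1 hy1 using h2
      choose y2 hy2 using h3
      exact ⟨(y1, y2), Prod.ext (funext hy1) (funext hy2)⟩
    · rintro ⟨y, hy⟩
      rw [Prod.ext_iff] at hy
      exact ⟨fun i => ⟨y.1 i, congrFun hy.1 i⟩, fun i => ⟨y.2 i, congrFun hy.2 i⟩⟩
  let q : (Fin N → PowerSeries k) →ₗ[k] T :=
    (φ.toLinearMap.comp (rowModule f γ).mkQ).restrictScalars k
  have hq : Function.Surjective q := φ.surjective.comp (Submodule.mkQ_surjective _)
  have hq0 : ∀ x, q x = 0 ↔ x ∈ rowModule f γ := fun x => by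
    change φ (Submodule.Quotient.mk x) = 0 ↔ _
    rw [φ.map_eq_zero_iff, Submodule.Quotient.mk_eq_zero]
  set W := ((rowModule f γ).restrictScalars k).map (coeffsBelow N j) with hW
  have hker : LinearMap.ker (Ψ ∘ₗ q) = LinearMap.ker (W.mkQ ∘ₗ coeffsBelow N j) := by
    ext x
    rw [LinearMap.mem_ker, LinearMap.mem_ker, LinearMap.comp_apply, LinearMap.comp_apply, hΨ0,
      Submodule.mkQ_apply, Submodule.Quotient.mk_eq_zero, hW, Submodule.mem_map]
    constructor
    · rintro ⟨y, hy⟩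
      obtain ⟨y, rfl⟩ := hq y
      refine ⟨x - (PowerSeries.X : PowerSeries k) ^ j • y, ?_, ?_⟩
      · refine (hq0 _).1 ?_
        rw [map_sub, hy, sub_eq_zero]
        exact (map_smul (φ.toLinearMap.comp (rowModule f γ).mkQ) _ y).symm
      · rw [map_sub, sub_eq_self, coeffsBelow_eq_zero_iff]
        exact fun b => dvd_mul_right _ _
    · rintro ⟨y, hy, hxy⟩
      rw [← sub_eq_zero, ← map_sub, coeffsBelow_eq_zero_iff] at hxy
      choose z hz using hxy
      refine ⟨q (-z), ?_⟩
      have h1 : x = y + (PowerSeries.X : PowerSeries k) ^ j • (-z) := by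
        funext b
        have := hz b
        simp only [Pi.sub_apply] at this
        simp only [Pi.add_apply, Pi.smul_apply, Pi.neg_apply, smul_eq_mul]
        linear_combination -this
      have h2 : q y = 0 := (hq0 y).2 hy
      rw [h1, map_add, h2, zero_add]
      exact map_smul (φ.toLinearMap.comp (rowModule f γ).mkQ) _ (-z)
  have hdim := ((LinearMap.quotKerEquivOfSurjective (Ψ ∘ₗ q) (hΨ.comp hq)).symm.trans
    ((Submodule.quotEquivOfEq _ _ hker).trans
    (LinearMap.quotKerEquivOfSurjective (W.mkQ ∘ₗ coeffsBelow N j)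
      ((Submodule.mkQ_surjective _).comp coeffsBelow_surjective)))).finrank_eq
  have hquot := Submodule.finrank_quotient_add_finrank W
  rw [← hdim] at hquot
  rw [Matrix.rank_eq_finrank_span_row, span_row_toeplitz, ← hW]
  rw [Module.finrank_prod, Module.finrank_pi_fintype, Module.finrank_fintype_fun_eq_card,
    Module.finrank_fintype_fun_eq_card, Fintype.card_prod, Fintype.card_prod, Fintype.card_fin,
    Fintype.card_fin, Fintype.card_fin] at hquot
  have h1 : ∑ i, (j - e i) + ∑ i, min (e i) j = p * j := by
    rw [← Finset.sum_add_distrib, Finset.sum_congr rfl fun i _ =>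
      (show j - e i + min (e i) j = j by omega)]
    simp
  have h2 : (N - p) * j + p * j = N * j := by rw [← add_mul, Nat.sub_add_cancel hpN]
  have h3 : ∑ i, Module.finrank k (Fin (min (e i) j) → k) = ∑ i, min (e i) j := by simp
  omega

/-! ### Invariant factors are determined by a jet -/

theorem le_iff_lt_card_of_monotone {p : ℕ} {e : Fin p → ℕ} (he : Monotone e) (i : Fin p) (j : ℕ) :
    e i ≤ j ↔ (i : ℕ) < (Finset.univ.filter fun i => e i ≤ j).card := by
  constructor
  · intro h
    have : Finset.Iic i ⊆ Finset.univ.filter fun i => e i ≤ j := by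
      intro a ha
      simpa using (he (Finset.mem_Iic.1 ha)).trans h
    have := Finset.card_le_card this
    rw [Fin.card_Iic] at this
    omega
  · intro h
    by_contra hlt
    have : (Finset.univ.filter fun i => e i ≤ j) ⊆ Finset.Iio i := by
      intro a ha
      rw [Finset.mem_Iio]
      by_contra hai
      exact hlt ((he (not_lt.1 hai)).trans (by simpa using ha))
    have := Finset.card_le_card this
    rw [Fin.card_Iio] at this
    omega

theorem card_le_add_sum_tsub {p : ℕ} (e : Fin p → ℕ) (j : ℕ) :
    (Finset.univ.filter fun i => e i ≤ j).card + ∑ i, (j - e i) = ∑ i, (j + 1 - e i) := by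
  rw [Finset.card_filter, ← Finset.sum_add_distrib]
  refine Finset.sum_congr rfl fun i _ => ?_
  split_ifs <;> omega

/-- Among the arcs on the scheme, those with invariant factors of exponents `e i ≤ l` are
characterized by the ranks of the first block Toeplitz matrices. That the number of invariant
factors is at most the codimension excludes invariant factors of higher order. -/
theorem hasInvariantFactors_iff_rank_toeplitz [IsAlgClosed k] {N m d r l : ℕ}
    {f : Fin m → MvPolynomial (Fin N) k} (hd : IsMinComponentDim (Ideal.span (Set.range f)) d)
    (hr : r = N - d) {γ : Arc k N} (hγ : γ ∈ arcs (Ideal.span (Set.range f))) {e : Fin r → ℕ}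
    (he : Monotone e) (hl : ∀ i, e i ≤ l) :
    HasInvariantFactors f γ e ↔ ∀ j ≤ l + 1, (toeplitz f γ j).rank = ∑ i, (j - e i) := by
  refine ⟨fun h j _ => h.rank_toeplitz j, fun h => ?_⟩
  obtain ⟨p, e', h'⟩ := exists_hasInvariantFactors f γ
  have hpr : p ≤ r := hr ▸ h'.le_codim hd hγ
  have hcard : ∀ j ≤ l, (Finset.univ.filter fun i => e' i ≤ j).card =
      (Finset.univ.filter fun i => e i ≤ j).card := by
    intro j hj
    have h1 := card_le_add_sum_tsub e' j
    have h2 := card_le_add_sum_tsub e j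
    rw [← h'.rank_toeplitz, ← h'.rank_toeplitz] at h1
    rw [← h j (by omega), ← h (j + 1) (by omega)] at h2
    omega
  have hrp : r ≤ p := by
    have h1 := hcard l le_rfl
    rw [Finset.filter_true_of_mem (s := (Finset.univ : Finset (Fin r))) fun i _ => hl i] at h1
    have h2 := Finset.card_le_univ (Finset.univ.filter fun i => e' i ≤ l)
    rw [h1] at h2
    simpa using h2
  obtain rfl : p = r := le_antisymm hpr hrp
  have hle : ∀ i, ∀ j ≤ l, e' i ≤ j ↔ e i ≤ j := fun i j hj => by
    rw [le_iff_lt_card_of_monotone h'.2.1, le_iff_lt_card_of_monotone he, hcard j hj]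
  have : e' = e := by
    funext i
    have h1 : e' i ≤ e i := (hle i _ (hl i)).2 le_rfl
    exact le_antisymm h1 ((hle i _ (h1.trans (hl i))).1 le_rfl)
  rwa [← this]

end ArcTruncation

/-! ### Zariski topology and regular functions -/

namespace ArcTruncation
open MvPolynomial Topology TopologicalSpace

variable {k : Type*} [Field k] {σ τ : Type*}

attribute [local instance] zariskiTopology

theorem isClosed_setOf_eval_eq_zero (F : MvPolynomial σ k) :
    IsClosed {x : AffSpace k σ | eval x F = 0} :=
  (zariskiClosed_iff _).2 ⟨{F}, by simp⟩

theorem eval_bind₁ (x : σ → k) (G : τ → MvPolynomial σ k) (F : MvPolynomial τ k) :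
    eval x (bind₁ G F) = eval (fun j => eval x (G j)) F :=
  eval₂Hom_bind₁ _ _ _ _

theorem continuous_eval (G : τ → MvPolynomial σ k) :
    Continuous fun (x : AffSpace k σ) j => eval x (G j) := by
  refine continuous_iff_isClosed.2 fun C hC => ?_
  obtain ⟨T, rfl⟩ := (zariskiClosed_iff _).1 hC
  refine (zariskiClosed_iff _).2 ⟨bind₁ G '' T, ?_⟩
  ext x
  simp only [Set.mem_preimage, Set.mem_ofPred_eq, Set.forall_mem_image]
  refine forall₂_congr fun F _ => ?_
  rw [eval_bind₁]

instance noetherianSpace_affSpace [Finite σ] : NoetherianSpace (AffSpace k σ) :=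
  (IsInducing.mk rfl : IsInducing fun x : AffSpace k σ =>
    (MvPolynomial.pointToPoint x : PrimeSpectrum (MvPolynomial σ k))).noetherianSpace

theorem isConstructible_of_isLocallyClosed [Finite σ] {S : Set (AffSpace k σ)}
    (hS : IsLocallyClosed S) : IsConstructible S := by
  obtain ⟨U, Z, hU, hZ, rfl⟩ := hS
  refine IsConstructible.inter ?_ ?_
  · exact IsRetrocompact.isConstructible hU fun V _ _ => NoetherianSpace.isCompact _
  · rw [← isConstructible_compl]
    exact IsRetrocompact.isConstructible hZ.isOpen_compl fun V _ _ => NoetherianSpace.isCompact _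

/-- A finite union of locally closed sets has a finite partition into locally closed sets, each of
which is contained in one of the given sets. -/
theorem exists_partition_of_isLocallyClosed {X ι : Type*} [TopologicalSpace X] [Finite ι]
    (B : ι → Set X) (hB : ∀ i, IsLocallyClosed (B i)) :
    ∃ parts : Set (Set X), parts.Finite ∧ parts.PairwiseDisjoint id ∧ ⋃₀ parts = ⋃ i, B i ∧
      ∀ S ∈ parts, IsLocallyClosed S ∧ ∃ i, S ⊆ B i := by
  choose U Z hU hZ hUZ using hB
  let C : ι ⊕ ι → Set X := Sum.elim (fun i => (U i)ᶜ) Z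
  have hC : ∀ a, IsClosed (C a) := by
    rintro (i | i)
    · exact (hU i).isClosed_compl
    · exact hZ i
  -- the atoms of the algebra of sets generated by the sets `C a`
  let atom : Set (ι ⊕ ι) → Set X := fun I => {x | {a | x ∈ C a} = I}
  have hatom : ∀ I, IsLocallyClosed (atom I) := by
    intro I
    have : atom I = (⋂ a ∈ Iᶜ, (C a)ᶜ) ∩ ⋂ a ∈ I, C a := by
      ext x
      simp only [atom, Set.mem_ofPred_eq, Set.mem_inter_iff, Set.mem_iInter, Set.mem_compl_iff,
        Set.ext_iff]
      exact ⟨fun h => ⟨fun a ha hx => ha ((h a).1 hx), fun a ha => (h a).2 ha⟩,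
        fun h a => ⟨fun hx => by_contra fun ha => h.1 a ha hx, h.2 a⟩⟩
    rw [this]
    exact ⟨_, _, (Set.toFinite _).isOpen_biInter fun a _ => (hC a).isOpen_compl,
      isClosed_biInter fun a _ => hC a, rfl⟩
  refine ⟨{S | ∃ I, S = atom I ∧ ∃ i, S ⊆ B i}, ?_, ?_, ?_, ?_⟩
  · refine (Set.finite_range atom).subset ?_
    rintro S ⟨I, rfl, -⟩
    exact ⟨I, rfl⟩
  · rintro _ ⟨I, rfl, -⟩ _ ⟨J, rfl, -⟩ hne
    rw [Function.onFun, id, id, Set.disjoint_left]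
    intro x hx hx'
    exact hne (by rw [show I = J from hx.symm.trans hx'])
  · ext x
    simp only [Set.mem_sUnion, Set.mem_iUnion]
    constructor
    · rintro ⟨S, ⟨I, -, i, hi⟩, hx⟩
      exact ⟨i, hi hx⟩
    · rintro ⟨i, hx⟩
      refine ⟨_, ⟨{a | x ∈ C a}, rfl, i, ?_⟩, rfl⟩
      intro y hy
      have hy' : ∀ a, y ∈ C a ↔ x ∈ C a := Set.ext_iff.1 hy
      rw [hUZ] at hx ⊢
      exact ⟨not_not.1 fun h => (hy' (Sum.inl i)).1 h hx.1, (hy' (Sum.inr i)).2 hx.2⟩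
  · rintro _ ⟨I, rfl, hi⟩
    exact ⟨hatom I, hi⟩

/-- The algebra of regular functions on a subset of affine space. -/
def regularFunctions (S : Set (AffSpace k σ)) : Subalgebra k (S → k) where
  carrier := {φ | ∀ x : S, ∃ P Q : MvPolynomial σ k, eval x.1 Q ≠ 0 ∧
    ∀ y : S, eval y.1 Q ≠ 0 → φ y = eval y.1 P / eval y.1 Q}
  mul_mem' := by
    intro φ ψ hφ hψ x
    obtain ⟨P, Q, hQ, h⟩ := hφ x
    obtain ⟨P', Q', hQ', h'⟩ := hψ x
    refine ⟨P * P', Q * Q', by rw [map_mul]; exact mul_ne_zero hQ hQ', fun y hy => ?_⟩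
    rw [map_mul] at hy
    rw [Pi.mul_apply, h y (left_ne_zero_of_mul hy), h' y (right_ne_zero_of_mul hy), map_mul, map_mul,
      div_mul_div_comm]
  add_mem' := by
    intro φ ψ hφ hψ x
    obtain ⟨P, Q, hQ, h⟩ := hφ x
    obtain ⟨P', Q', hQ', h'⟩ := hψ x
    refine ⟨P * Q' + Q * P', Q * Q', by rw [map_mul]; exact mul_ne_zero hQ hQ', fun y hy => ?_⟩
    rw [map_mul] at hy
    have h1 := left_ne_zero_of_mul hy
    have h2 := right_ne_zero_of_mul hy
    rw [Pi.add_apply, h y h1, h' y h2, map_add, map_mul, map_mul, map_mul, div_add_div _ _ h1 h2]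
  algebraMap_mem' := fun a x => ⟨C a, 1, by simp, fun y _ => by simp⟩

namespace regularFunctions

/-- The value of a regular function at a point. -/
def evalAt {S : Set (AffSpace k σ)} (x : S) : regularFunctions S →ₐ[k] k :=
  (Pi.evalAlgHom k (fun _ : S => k) x).comp (regularFunctions S).val

theorem evalAt_apply {S : Set (AffSpace k σ)} (x : S) (φ : regularFunctions S) :
    evalAt x φ = φ.1 x := rfl

theorem ext_evalAt {S : Set (AffSpace k σ)} {φ ψ : regularFunctions S}
    (h : ∀ x, evalAt x φ = evalAt x ψ) : φ = ψ :=
  Subtype.ext (funext h)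

/-- Polynomials are regular. -/
noncomputable def ofPolynomial (S : Set (AffSpace k σ)) (P : MvPolynomial σ k) : regularFunctions S :=
  ⟨fun x => eval x.1 P, fun _ => ⟨P, 1, by simp, fun y _ => by simp⟩⟩

theorem evalAt_ofPolynomial {S : Set (AffSpace k σ)} (x : S) (P : MvPolynomial σ k) :
    evalAt x (ofPolynomial S P) = eval x.1 P := rfl

theorem isUnit_of_forall_ne_zero {S : Set (AffSpace k σ)} {φ : regularFunctions S}
    (h : ∀ x, evalAt x φ ≠ 0) : IsUnit φ := by
  have hinv : (fun x => (φ.1 x)⁻¹) ∈ regularFunctions S := by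
    intro x
    obtain ⟨P, Q, hQ, hφ⟩ := φ.2 x
    have hPx : eval x.1 P ≠ 0 := by
      intro h0
      exact h x (by rw [evalAt_apply, hφ x hQ, h0, zero_div])
    refine ⟨Q * Q, P * Q, by rw [map_mul]; exact mul_ne_zero hPx hQ, fun y hy => ?_⟩
    rw [map_mul] at hy
    have h2 := right_ne_zero_of_mul hy
    change (φ.1 y)⁻¹ = _
    rw [hφ y h2, inv_div, map_mul, map_mul, mul_div_mul_right _ _ h2]
  refine IsUnit.of_mul_eq_one ⟨_, hinv⟩ (Subtype.ext (funext fun x => ?_))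
  exact mul_inv_cancel₀ (h x)

theorem isClosed_setOf_evalAt_eq_zero {S : Set (AffSpace k σ)} (φ : regularFunctions S) :
    IsClosed {x : S | evalAt x φ = 0} := by
  rw [← isOpen_compl_iff, isOpen_iff_forall_mem_open]
  intro x hx
  obtain ⟨P, Q, hQ, h⟩ := φ.2 x
  refine ⟨Subtype.val ⁻¹' {y | eval y (P * Q) = 0}ᶜ, fun y hy => ?_,
    (isClosed_setOf_eval_eq_zero _).isOpen_compl.preimage continuous_subtype_val, ?_⟩
  · have hy' : eval y.1 (P * Q) ≠ 0 := hy
    rw [map_mul] at hy'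
    have h2 := right_ne_zero_of_mul hy'
    change φ.1 y ≠ 0
    rw [h y h2]
    exact div_ne_zero (left_ne_zero_of_mul hy') h2
  · change eval x.1 (P * Q) ≠ 0
    rw [map_mul]
    refine mul_ne_zero (fun h0 => hx ?_) hQ
    change φ.1 x = 0
    rw [h x hQ, h0, zero_div]

theorem isRegularOn_iff {S : Set (AffSpace k σ)} (φ : AffSpace k σ → k) :
    IsRegularOn S φ ↔ (fun x : S => φ x.1) ∈ regularFunctions S := by
  constructor
  · intro h x
    obtain ⟨P, Q, hQ, h'⟩ := h x.1 x.2
    exact ⟨P, Q, hQ, fun y => h' y.1 y.2⟩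
  · intro h x hx
    obtain ⟨P, Q, hQ, h'⟩ := h ⟨x, hx⟩
    exact ⟨P, Q, hQ, fun y hy => h' ⟨y, hy⟩⟩

theorem isRegularOn_of_forall_eq {S : Set (AffSpace k σ)} {φ : AffSpace k σ → k}
    (ψ : regularFunctions S) (h : ∀ x : S, φ x.1 = evalAt x ψ) : IsRegularOn S φ := by
  rw [isRegularOn_iff]
  have : (fun x : S => φ x.1) = ψ.1 := funext h
  rw [this]
  exact ψ.2

end regularFunctions

theorem isRegularOn_eval (S : Set (AffSpace k σ)) (P : MvPolynomial σ k) :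
    IsRegularOn S fun x => eval x P :=
  regularFunctions.isRegularOn_of_forall_eq (regularFunctions.ofPolynomial S P) fun _ => rfl

theorem IsRegularOn.comp_eval {S : Set (AffSpace k σ)} {T : Set (AffSpace k τ)}
    {φ : AffSpace k τ → k} (hφ : IsRegularOn T φ) (G : τ → MvPolynomial σ k)
    (hG : Set.MapsTo (fun x j => eval x (G j)) S T) :
    IsRegularOn S fun x => φ fun j => eval x (G j) := by
  intro x hx
  obtain ⟨P, Q, hQ, h⟩ := hφ _ (hG hx)
  refine ⟨bind₁ G P, bind₁ G Q, by rwa [eval_bind₁], fun y hy hy' => ?_⟩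
  rw [eval_bind₁] at hy'
  rw [eval_bind₁, eval_bind₁]
  exact h _ (hG hy) hy'

/-- The locus where regular functions vanish is relatively closed. -/
theorem exists_isClosed_of_forall_isRegularOn {ι : Type*} {S : Set (AffSpace k σ)}
    (φ : ι → AffSpace k σ → k) (hφ : ∀ i, IsRegularOn S (φ i)) :
    ∃ C, IsClosed C ∧ {x ∈ S | ∀ i, φ i x = 0} = S ∩ C := by
  have h1 : IsClosed {x : S | ∀ i, φ i x.1 = 0} := by
    rw [Set.ofPred_forall]
    exact isClosed_iInter fun i => regularFunctions.isClosed_setOf_evalAt_eq_zero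
      ⟨_, (regularFunctions.isRegularOn_iff _).1 (hφ i)⟩
  obtain ⟨C, hC, hCS⟩ := isClosed_induced_iff.1 h1
  refine ⟨C, hC, ?_⟩
  ext x
  constructor
  · rintro ⟨hx, h⟩
    exact ⟨hx, (Set.ext_iff.1 hCS ⟨x, hx⟩).2 h⟩
  · rintro ⟨hx, h⟩
    exact ⟨hx, (Set.ext_iff.1 hCS ⟨x, hx⟩).1 h⟩

end ArcTruncation

/-! ### Families of arcs over subsets of jet space -/

namespace ArcTruncation
open MvPolynomial Topology regularFunctions

variable {k : Type*} [Field k]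

attribute [local instance] zariskiTopology

section Jets

variable {A B : Type*} [CommRing A] [CommRing B] {N l : ℕ}

/-- The arc with polynomial components of degree at most `l` given by an `l`-jet. -/
noncomputable def jetArc (θ : Fin N × Fin (l + 1) → A) : Fin N → PowerSeries A :=
  fun j => PowerSeries.mk fun n => if h : n < l + 1 then θ (j, ⟨n, h⟩) else 0

theorem coeff_jetArc_of_le (θ : Fin N × Fin (l + 1) → A) (j : Fin N) {n : ℕ} (hn : l + 1 ≤ n) :
    PowerSeries.coeff n (jetArc θ j) = 0 := by
  rw [jetArc, PowerSeries.coeff_mk, dif_neg (not_lt.2 hn)]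

theorem map_jetArc (φ : A →+* B) (θ : Fin N × Fin (l + 1) → A) :
    (fun j => PowerSeries.map φ (jetArc θ j)) = jetArc fun i => φ (θ i) := by
  funext j
  ext n
  rw [PowerSeries.coeff_map, jetArc, jetArc, PowerSeries.coeff_mk, PowerSeries.coeff_mk]
  split_ifs
  · rfl
  · exact map_zero φ

theorem arcTrunc_jetArc (θ : Jet k N l) : arcTrunc l (jetArc θ) = θ := by
  funext ⟨j, n⟩
  rw [arcTrunc, jetArc, PowerSeries.coeff_mk, dif_pos n.2]

theorem jetArc_eq_map_aeval (θ : Jet k N l) :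
    jetArc θ = fun j => PowerSeries.map ((aeval θ : MvPolynomial (Fin N × Fin (l + 1)) k →ₐ[k] k) :
        MvPolynomial (Fin N × Fin (l + 1)) k →+* k)
      (jetArc X j) := by
  rw [map_jetArc]
  congr 1
  funext i
  exact (aeval_X θ i).symm

end Jets

section Map

variable {A B : Type*} [CommRing A] [CommRing B] [Algebra k A] [Algebra k B] {N r d : ℕ}

theorem minorConditions_map_iff (φ : A →ₐ[k] B) (g : Fin r → MvPolynomial (Fin N) k)
    (σ : Fin r ⊕ Fin d ≃ Fin N) (l E : ℕ) (γ : Fin N → PowerSeries A) :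
    MinorConditions g σ l E (fun j => PowerSeries.map (φ : A →+* B) (γ j)) ↔
      (PowerSeries.X ^ E ∣ PowerSeries.map (φ : A →+* B) (jacL g σ γ).det ∧
        (∀ i j, PowerSeries.X ^ E ∣ PowerSeries.map (φ : A →+* B)
          (((jacL g σ γ).adjugate * jacR g σ γ) i j)) ∧
        (∀ i j, PowerSeries.X ^ E ∣ PowerSeries.map (φ : A →+* B)
          (PowerSeries.X ^ l * (jacL g σ γ).adjugate i j)) ∧
        (∀ i, PowerSeries.X ^ (E + (l + 1)) ∣ PowerSeries.map (φ : A →+* B)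
          ((jacL g σ γ).adjugate.mulVec (fun i => aeval γ (g i)) i))) ∧
      IsUnit (φ (PowerSeries.coeff E (jacL g σ γ).det)) := by
  have hdet : (jacL g σ fun j => PowerSeries.map (φ : A →+* B) (γ j)).det =
      PowerSeries.map (φ : A →+* B) (jacL g σ γ).det := by
    rw [jacL_map, RingHom.map_det]; rfl
  have hadj : (jacL g σ fun j => PowerSeries.map (φ : A →+* B) (γ j)).adjugate =
      (jacL g σ γ).adjugate.map (PowerSeries.map (φ : A →+* B)) := by
    rw [jacL_map]
    exact (RingHom.map_adjugate (PowerSeries.map (φ : A →+* B)) _).symm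
  have hcol : (jacL g σ fun j => PowerSeries.map (φ : A →+* B) (γ j)).adjugate *
      (jacR g σ fun j => PowerSeries.map (φ : A →+* B) (γ j)) =
      ((jacL g σ γ).adjugate * jacR g σ γ).map (PowerSeries.map (φ : A →+* B)) := by
    rw [hadj, jacR_map, Matrix.map_mul]
  have hval : ∀ i, (jacL g σ fun j => PowerSeries.map (φ : A →+* B) (γ j)).adjugate.mulVec
      (fun i => aeval (fun j => PowerSeries.map (φ : A →+* B) (γ j)) (g i)) i =
      PowerSeries.map (φ : A →+* B) ((jacL g σ γ).adjugate.mulVec (fun i => aeval γ (g i)) i) := by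
    intro i
    simp only [hadj, Matrix.mulVec, dotProduct, map_sum, map_mul, aeval_map_comp, Matrix.map_apply]
  have hunit : PowerSeries.coeff E (jacL g σ fun j => PowerSeries.map (φ : A →+* B) (γ j)).det =
      φ (PowerSeries.coeff E (jacL g σ γ).det) := by
    rw [hdet, PowerSeries.coeff_map]; rfl
  constructor
  · rintro ⟨h1, h2, h3, h4, h5⟩
    refine ⟨⟨hdet ▸ h1, fun i j => ?_, fun i j => ?_, fun i => hval i ▸ h5 i⟩, hunit ▸ h2⟩
    · have := h3 i j
      rwa [hcol] at this
    · have := h4 i j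
      rw [hadj, Matrix.map_apply] at this
      rw [map_mul, map_pow, PowerSeries.map_X]
      exact this
  · rintro ⟨⟨h1, h3, h4, h5⟩, h2⟩
    refine ⟨hdet ▸ h1, hunit ▸ h2, fun i j => ?_, fun i j => ?_, fun i => hval i ▸ h5 i⟩
    · rw [hcol]
      exact h3 i j
    · have := h4 i j
      rw [map_mul, map_pow, PowerSeries.map_X] at this
      rw [hadj, Matrix.map_apply]
      exact this

theorem toeplitz_map (φ : A →ₐ[k] B) {m : ℕ} (f : Fin m → MvPolynomial (Fin N) k)
    (γ : Fin N → PowerSeries A) (j : ℕ) :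
    toeplitz f (fun j => PowerSeries.map (φ : A →+* B) (γ j)) j = (toeplitz f γ j).map φ := by
  ext1 ia bc
  rw [Matrix.map_apply, toeplitz, toeplitz, Matrix.of_apply, Matrix.of_apply, aeval_map_comp]
  rw [show PowerSeries.X ^ (ia.2 : ℕ) * PowerSeries.map (φ : A →+* B) (aeval γ (pderiv bc.1 (f ia.1))) =
    PowerSeries.map (φ : A →+* B) (PowerSeries.X ^ (ia.2 : ℕ) * aeval γ (pderiv bc.1 (f ia.1))) by
      rw [map_mul, map_pow, PowerSeries.map_X], PowerSeries.coeff_map]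
  rfl

end Map

/-- The block Toeplitz matrices of order at most `l + 1` depend only on the `l`-jet. -/
theorem toeplitz_congr {N m l : ℕ} (f : Fin m → MvPolynomial (Fin N) k) {γ ρ : Arc k N}
    (h : arcTrunc l ρ = arcTrunc l γ) {j : ℕ} (hj : j ≤ l + 1) : toeplitz f ρ j = toeplitz f γ j := by
  ext1 ia bc
  rw [toeplitz, toeplitz, Matrix.of_apply, Matrix.of_apply, ← sub_eq_zero, ← map_sub, ← mul_sub]
  have h1 := dvd_aeval_sub_aeval _ ρ γ ((arcTrunc_eq_iff l γ ρ).1 h) (pderiv bc.1 (f ia.1))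
  exact PowerSeries.X_pow_dvd_iff.1 (h1.mul_left _) _ (bc.2.2.trans_le hj)

section Closed

variable {τ : Type*}

theorem isClosed_setOf_X_pow_dvd (p : PowerSeries (MvPolynomial τ k)) (n : ℕ) :
    IsClosed {x : AffSpace k τ |
      PowerSeries.X ^ n ∣ PowerSeries.map ((aeval x : MvPolynomial τ k →ₐ[k] k) :
        MvPolynomial τ k →+* k) p} := by
  have : {x : AffSpace k τ |
      PowerSeries.X ^ n ∣ PowerSeries.map ((aeval x : MvPolynomial τ k →ₐ[k] k) :
        MvPolynomial τ k →+* k) p} =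
      ⋂ i, ⋂ (_ : i < n), {x : AffSpace k τ | eval x (PowerSeries.coeff i p) = 0} := by
    ext x
    simp only [Set.mem_ofPred_eq, Set.mem_iInter, PowerSeries.X_pow_dvd_iff, PowerSeries.coeff_map]
    rfl
  rw [this]
  exact isClosed_iInter fun i => isClosed_iInter fun _ => isClosed_setOf_eval_eq_zero _

theorem isLocallyClosed_setOf_minorConditions {N r d : ℕ} (g : Fin r → MvPolynomial (Fin N) k)
    (σ : Fin r ⊕ Fin d ≃ Fin N) (l E : ℕ) :
    IsLocallyClosed {θ : Jet k N l | MinorConditions g σ l E (jetArc θ)} := by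
  simp only [jetArc_eq_map_aeval, minorConditions_map_iff, Set.ofPred_and, Set.ofPred_forall,
    isUnit_iff_ne_zero]
  refine IsLocallyClosed.inter (IsClosed.isLocallyClosed ?_) (IsOpen.isLocallyClosed ?_)
  · exact (isClosed_setOf_X_pow_dvd _ _).inter
      ((isClosed_iInter fun _ => isClosed_iInter fun _ => isClosed_setOf_X_pow_dvd _ _).inter
      ((isClosed_iInter fun _ => isClosed_iInter fun _ => isClosed_setOf_X_pow_dvd _ _).inter
      (isClosed_iInter fun _ => isClosed_setOf_X_pow_dvd _ _)))
  · exact (isClosed_setOf_eval_eq_zero _).isOpen_compl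

/-- The rank through minors of arbitrary size: those of size `s` and all larger ones. -/
theorem rank_eq_iff_minors {K ι κ : Type*} [Field K] [Fintype ι] [Fintype κ] (M : Matrix ι κ K)
    (s : ℕ) : M.rank = s ↔ (∃ (c : Fin s → ι) (c' : Fin s → κ), (M.submatrix c c').det ≠ 0) ∧
      ∀ p, s < p → ∀ (c : Fin p → ι) (c' : Fin p → κ), (M.submatrix c c').det = 0 := by
  have h1 : ∀ (p : ℕ) (c : Fin p → ι) (c' : Fin p → κ), (M.submatrix c c').det ≠ 0 → p ≤ M.rank := by
    intro p c c' h
    have h2 := Matrix.rank_of_isUnit _ ((Matrix.isUnit_iff_isUnit_det _).2 h.isUnit)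
    rw [Fintype.card_fin] at h2
    exact h2 ▸ Matrix.rank_submatrix_le M c c'
  have h2 := exists_det_submatrix_ne_zero M (M.rank_eq_finrank_span_row.symm)
  constructor
  · rintro rfl
    exact ⟨h2, fun p hp c c' => by_contra fun h => not_lt.2 (h1 p c c' h) hp⟩
  · rintro ⟨⟨c, c', h⟩, h'⟩
    refine le_antisymm (not_lt.1 fun hlt => ?_) (h1 _ c c' h)
    obtain ⟨c, c', h⟩ := h2
    exact h (h' _ hlt c c')

theorem isLocallyClosed_setOf_forall_rank_eq {ι κ : ℕ → Type*} [∀ j, Fintype (ι j)]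
    [∀ j, Fintype (κ j)] (M : ∀ j, Matrix (ι j) (κ j) (MvPolynomial τ k)) (s : ℕ → ℕ) (n : ℕ) :
    IsLocallyClosed {x : AffSpace k τ | ∀ j ≤ n, ((M j).map (aeval x : MvPolynomial τ k →ₐ[k] k)).rank = s j} := by
  have hdet : ∀ (j p : ℕ) (c : Fin p → ι j) (c' : Fin p → κ j) (x : AffSpace k τ),
      (((M j).map (aeval x : MvPolynomial τ k →ₐ[k] k)).submatrix c c').det =
        eval x ((M j).submatrix c c').det := by
    intro j p c c' x
    rw [RingHom.map_det]
    rfl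
  simp only [rank_eq_iff_minors, hdet, forall_and, Set.ofPred_and, Set.ofPred_forall]
  refine IsLocallyClosed.inter (IsOpen.isLocallyClosed ?_) (IsClosed.isLocallyClosed ?_)
  · refine (Set.finite_Iic n).isOpen_biInter fun j _ => ?_
    simp only [Set.ofPred_exists]
    exact isOpen_iUnion fun c => isOpen_iUnion fun c' =>
      (isClosed_setOf_eval_eq_zero _).isOpen_compl
  · exact isClosed_iInter fun j => isClosed_iInter fun _ => isClosed_iInter fun p =>
      isClosed_iInter fun _ => isClosed_iInter fun c => isClosed_iInter fun c' =>
        isClosed_setOf_eval_eq_zero _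

theorem isLocallyClosed_setOf_rank_toeplitz {N m : ℕ} (f : Fin m → MvPolynomial (Fin N) k)
    (l : ℕ) (s : ℕ → ℕ) :
    IsLocallyClosed {θ : Jet k N l | ∀ j ≤ l + 1, (toeplitz f (jetArc θ) j).rank = s j} := by
  simp only [jetArc_eq_map_aeval, toeplitz_map]
  exact isLocallyClosed_setOf_forall_rank_eq (fun j => toeplitz f (jetArc X) j) s (l + 1)

end Closed

section Family

variable {τ : Type*} {S : Set (AffSpace k τ)}

theorem X_pow_dvd_iff_forall_evalAt {p : PowerSeries (regularFunctions S)} {n : ℕ} :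
    PowerSeries.X ^ n ∣ p ↔ ∀ x : S, PowerSeries.X ^ n ∣
      PowerSeries.map (evalAt x : regularFunctions S →+* k) p := by
  simp only [PowerSeries.X_pow_dvd_iff, PowerSeries.coeff_map]
  constructor
  · intro h x i hi
    rw [h i hi, map_zero]
  · intro h i hi
    refine ext_evalAt fun x => ?_
    rw [map_zero]
    exact h x i hi

theorem minorConditions_of_forall_evalAt {N r d l E : ℕ} {g : Fin r → MvPolynomial (Fin N) k}
    {σ : Fin r ⊕ Fin d ≃ Fin N} {γ : Fin N → PowerSeries (regularFunctions S)}
    (h : ∀ x : S, MinorConditions g σ l E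
      fun j => PowerSeries.map (evalAt x : regularFunctions S →+* k) (γ j)) :
    MinorConditions g σ l E γ := by
  simp only [minorConditions_map_iff] at h
  exact ⟨X_pow_dvd_iff_forall_evalAt.2 fun x => (h x).1.1,
    isUnit_of_forall_ne_zero fun x => (h x).2.ne_zero,
    fun i j => X_pow_dvd_iff_forall_evalAt.2 fun x => (h x).1.2.1 i j,
    fun i j => X_pow_dvd_iff_forall_evalAt.2 fun x => (h x).1.2.2.1 i j,
    fun i => X_pow_dvd_iff_forall_evalAt.2 fun x => (h x).1.2.2.2 i⟩

/-- Solutions of `g = 0` with given `l`-jet and given `z`-coordinates depend regularly on these. -/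
theorem exists_family {N r d l E : ℕ} {g : Fin r → MvPolynomial (Fin N) k}
    {σ : Fin r ⊕ Fin d ≃ Fin N} (θ : Fin N × Fin (l + 1) → regularFunctions S)
    (z : Fin d → PowerSeries (regularFunctions S))
    (h : ∀ x : S, MinorConditions g σ l E (jetArc fun i => evalAt x (θ i))) :
    ∃ ρ : Fin N → PowerSeries (regularFunctions S), ∀ x : S,
      (∀ i, aeval (fun j => PowerSeries.map (evalAt x : regularFunctions S →+* k) (ρ j)) (g i) = 0) ∧
      ∃ w, (fun j => PowerSeries.map (evalAt x : regularFunctions S →+* k) (ρ j)) =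
        perturb σ l (jetArc fun i => evalAt x (θ i)) w
          (fun i => PowerSeries.map (evalAt x : regularFunctions S →+* k) (z i)) := by
  have h1 : MinorConditions g σ l E (jetArc θ) := by
    refine minorConditions_of_forall_evalAt fun x => ?_
    rw [map_jetArc]
    exact h x
  obtain ⟨L, H, v, hL⟩ := h1.exists_liftData
  obtain ⟨w, hw, -⟩ := hL.existsUnique z
  refine ⟨perturb σ l (jetArc θ) w z, fun x => ⟨fun i => ?_,
    fun i => PowerSeries.map (evalAt x : regularFunctions S →+* k) (w i), ?_⟩⟩
  · rw [aeval_map_comp, hw, map_zero]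
  · rw [← perturb_map, map_jetArc]
    rfl

end Family

end ArcTruncation

/-! ### Strata of jets and their trivializations -/

namespace ArcTruncation
open MvPolynomial Topology regularFunctions

variable {k : Type*} [Field k]

attribute [local instance] zariskiTopology

theorem coeff_perturb_jetArc {N r d l : ℕ} (σ : Fin r ⊕ Fin d ≃ Fin N) (θ : Jet k N l)
    (w : Fin r → PowerSeries k) (z : Fin d → PowerSeries k) (b : Fin d) (t : ℕ) :
    PowerSeries.coeff (l + 1 + t) (perturb σ l (jetArc θ) w z (σ (Sum.inr b))) =
      PowerSeries.coeff t (z b) := by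
  rw [perturb, map_add, coeff_jetArc_of_le _ _ (Nat.le_add_right _ _), zero_add, add_comm,
    PowerSeries.coeff_X_pow_mul, Equiv.symm_apply_apply, Sum.elim_inr]

section Strata

variable {N m d r l : ℕ} {f : Fin m → MvPolynomial (Fin N) k} {e : Fin r → ℕ}

/-- Among the arcs on the scheme, the exponents `e i ≤ l` of the invariant factors depend only on the
`l`-jet. -/
theorem mem_arcsWith_of_arcTrunc_eq [IsAlgClosed k]
    (hd : IsMinComponentDim (Ideal.span (Set.range f)) d)
    (hr : r = N - d) (hl : ∀ i, e i ≤ l) {γ ρ : Arc k N} (hγ : γ ∈ arcsWith f e)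
    (hρ : ρ ∈ arcs (Ideal.span (Set.range f))) (h : arcTrunc l ρ = arcTrunc l γ) :
    ρ ∈ arcsWith f e := by
  refine ⟨hρ, (hasInvariantFactors_iff_rank_toeplitz hd hr hρ hγ.2.2.1 hl).2 fun j hj => ?_⟩
  rw [toeplitz_congr f h hj]
  exact hγ.2.rank_toeplitz j

theorem exists_minorConditions_jetArc (hrd : r + d = N) (hl : ∀ i, e i ≤ l) {γ : Arc k N}
    (hγ : γ ∈ arcsWith f e) :
    ∃ (c : Fin r → Fin m) (σ : Fin r ⊕ Fin d ≃ Fin N), ∃ E ≤ l * r,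
      MinorConditions (fun i => f (c i)) σ l E (jetArc (arcTrunc l γ)) := by
  obtain ⟨c, σ, E, h⟩ := hγ.2.exists_minorConditions hrd hl hγ.1
  obtain ⟨L, H, v, h⟩ := h.exists_liftData
  obtain ⟨w, z, hwz⟩ := exists_perturb_eq σ (arcTrunc_jetArc (arcTrunc l γ))
  obtain ⟨L', H', v', h'⟩ := h.exists_perturb w z
  rw [← hwz] at h'
  obtain ⟨E', hE', h''⟩ := h'.exists_minorConditions
  exact ⟨c, σ, E', hE', h''⟩

/-- The truncations of arcs in a stratum for which given equations, coordinates and order of the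
Jacobian minor can be used. -/
def jetStratum (f : Fin m → MvPolynomial (Fin N) k) (e : Fin r → ℕ) (l : ℕ) (c : Fin r → Fin m)
    (σ : Fin r ⊕ Fin d ≃ Fin N) (E : ℕ) : Set (Jet k N l) :=
  {θ ∈ arcTrunc l '' arcsWith f e | MinorConditions (fun i => f (c i)) σ l E (jetArc θ)}

theorem mem_arcsWith_of_mem_jetStratum [IsAlgClosed k]
    (hd : IsMinComponentDim (Ideal.span (Set.range f)) d)
    (hr : r = N - d) (hl : ∀ i, e i ≤ l) {c : Fin r → Fin m} {σ : Fin r ⊕ Fin d ≃ Fin N} {E : ℕ}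
    {θ : Jet k N l} (hθ : θ ∈ jetStratum f e l c σ E) {ρ : Arc k N} (hρ : arcTrunc l ρ = θ)
    (h : ∀ i, aeval ρ (f (c i)) = 0) : ρ ∈ arcsWith f e := by
  obtain ⟨⟨γ, hγ, hγθ⟩, hmc⟩ := hθ
  obtain ⟨L, H, v, hL⟩ := hmc.exists_liftData
  refine mem_arcsWith_of_arcTrunc_eq hd hr hl hγ ?_ (hρ.trans hγθ.symm)
  exact hL.mem_arcs_of_arcTrunc_eq hd hr (fun i => Ideal.subset_span ⟨c i, rfl⟩)
    (hγθ.trans (arcTrunc_jetArc θ).symm) (hρ.trans (arcTrunc_jetArc θ).symm) hγ.1 h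

theorem isLocallyClosed_jetStratum [IsAlgClosed k]
    (hd : IsMinComponentDim (Ideal.span (Set.range f)) d)
    (hr : r = N - d) (he : Monotone e) (hl : ∀ i, e i ≤ l) (c : Fin r → Fin m)
    (σ : Fin r ⊕ Fin d ≃ Fin N) (E : ℕ) : IsLocallyClosed (jetStratum f e l c σ E) := by
  set S : Set (Jet k N l) :=
    {θ | ∀ j ≤ l + 1, (toeplitz f (jetArc θ) j).rank = ∑ i, (j - e i)} ∩
      {θ | MinorConditions (fun i => f (c i)) σ l E (jetArc θ)} with hS
  have hSc : IsLocallyClosed S := (isLocallyClosed_setOf_rank_toeplitz f l _).inter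
    (isLocallyClosed_setOf_minorConditions _ σ l E)
  -- the solution over `S` with vanishing `z`-coordinates lies on the scheme over a closed subset
  obtain ⟨ρ, hρ⟩ := exists_family (S := S) (fun i => ofPolynomial S (X i)) (0 : Fin d → _)
    (l := l) (g := fun i => f (c i)) (σ := σ) (E := E) (fun x => by
      simp only [evalAt_ofPolynomial, eval_X]
      exact x.2.2)
  simp only [evalAt_ofPolynomial, eval_X] at hρ
  have hC : IsClosed {x : S | ∀ i n, evalAt x (PowerSeries.coeff n (aeval ρ (f i))) = 0} := by
    simp only [Set.ofPred_forall]
    exact isClosed_iInter fun i => isClosed_iInter fun n => isClosed_setOf_evalAt_eq_zero _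
  have heq : jetStratum f e l c σ E =
      Subtype.val '' {x : S | ∀ i n, evalAt x (PowerSeries.coeff n (aeval ρ (f i))) = 0} := by
    have key : ∀ x : S, (∀ i n, evalAt x (PowerSeries.coeff n (aeval ρ (f i))) = 0) ↔
        (fun j => PowerSeries.map (evalAt x : regularFunctions S →+* k) (ρ j)) ∈
          arcs (Ideal.span (Set.range f)) := by
      intro x
      rw [mem_arcs_span_iff]
      refine forall_congr' fun i => ?_
      rw [aeval_map_comp, PowerSeries.ext_iff]
      rfl
    have htr : ∀ x : S, arcTrunc l
        (fun j => PowerSeries.map (evalAt x : regularFunctions S →+* k) (ρ j)) = x.1 := by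
      intro x
      obtain ⟨-, w, hw⟩ := hρ x
      rw [hw, arcTrunc_perturb, arcTrunc_jetArc]
    ext θ
    constructor
    · intro hθ
      have hθS : θ ∈ S := by
        refine ⟨fun j hj => ?_, hθ.2⟩
        obtain ⟨γ, hγ, rfl⟩ := hθ.1
        rw [toeplitz_congr f (arcTrunc_jetArc (arcTrunc l γ)) hj]
        exact hγ.2.rank_toeplitz j
      refine ⟨⟨θ, hθS⟩, (key _).2 ?_, rfl⟩
      exact (mem_arcsWith_of_mem_jetStratum hd hr hl hθ (htr ⟨θ, hθS⟩) (hρ ⟨θ, hθS⟩).1).1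
    · rintro ⟨x, hx, rfl⟩
      have hx' := (key x).1 hx
      refine ⟨⟨_, ⟨hx', ?_⟩, htr x⟩, x.2.2⟩
      refine (hasInvariantFactors_iff_rank_toeplitz hd hr hx' he hl).2 fun j hj => ?_
      rw [toeplitz_congr f ((htr x).trans (arcTrunc_jetArc x.1).symm) hj]
      exact x.2.1 j hj
  rw [heq]
  refine hC.isLocallyClosed.image IsInducing.subtypeVal ?_
  rwa [Subtype.range_coe]

theorem jetTrunc_arcTrunc {n : ℕ} (h : l ≤ n) (γ : Arc k N) :
    jetTrunc h (arcTrunc n γ) = arcTrunc l γ := rfl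

theorem continuous_jetTrunc {n : ℕ} (h : l ≤ n) : Continuous (jetTrunc (k := k) (N := N) h) := by
  have := continuous_eval (k := k) fun ij : Fin N × Fin (l + 1) =>
    (X (ij.1, Fin.castLE (Nat.succ_le_succ h) ij.2) : MvPolynomial (Fin N × Fin (n + 1)) k)
  simp only [eval_X] at this
  exact this

/-- Over a subset `S` of a stratum, the truncation map is trivial: an `n`-jet corresponds to its
`l`-jet together with its coefficients of order `l + 1, …, n` in the last `d` coordinates of the splitting. -/
theorem exists_isIsoOn [IsAlgClosed k]
    (hd : IsMinComponentDim (Ideal.span (Set.range f)) d)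
    (hr : r = N - d) (hl : ∀ i, e i ≤ l) {n : ℕ} (hln : l < n) {c : Fin r → Fin m}
    {σ : Fin r ⊕ Fin d ≃ Fin N} {E : ℕ} {S : Set (Jet k N l)} (hS : S ⊆ jetStratum f e l c σ E) :
    ∃ (Φ : Jet k N n → AffSpace k ((Fin N × Fin (l + 1)) ⊕ Fin ((n - l) * d)))
      (Ψ : AffSpace k ((Fin N × Fin (l + 1)) ⊕ Fin ((n - l) * d)) → Jet k N n),
      IsIsoOn (arcTrunc n '' arcsWith f e ∩ jetTrunc hln.le ⁻¹' S) (prodAffine S ((n - l) * d)) Φ Ψ ∧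
      (∀ x j, Φ x (Sum.inl j) = jetTrunc hln.le x j) ∧
      ∃ C, IsClosed C ∧ arcTrunc n '' arcsWith f e ∩ jetTrunc hln.le ⁻¹' S =
        jetTrunc hln.le ⁻¹' S ∩ C := by
  classical
  set P := prodAffine S ((n - l) * d) with hP
  set z : Fin d → PowerSeries (regularFunctions P) := fun b => PowerSeries.mk fun t =>
    if h : t < n - l then ofPolynomial P (X (Sum.inr (finProdFinEquiv (⟨t, h⟩, b)))) else 0 with hz
  have hmc : ∀ y ∈ P, MinorConditions (fun i => f (c i)) σ l E (jetArc fun i => y (Sum.inl i)) :=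
    fun y hy => (hS hy).2
  obtain ⟨ρ, hρ⟩ := exists_family (S := P) (fun i => ofPolynomial P (X (Sum.inl i))) z
    (l := l) (g := fun i => f (c i)) (σ := σ) (E := E) (fun y => by
      simp only [evalAt_ofPolynomial, eval_X]
      exact hmc y.1 y.2)
  simp only [evalAt_ofPolynomial, eval_X] at hρ
  let arc : P → Arc k N := fun y j =>
    PowerSeries.map (evalAt y : regularFunctions P →+* k) (ρ j)
  have hzc : ∀ (y : P) (b : Fin d) (t : Fin (n - l)), PowerSeries.coeff (t : ℕ)
      (PowerSeries.map (evalAt y : regularFunctions P →+* k) (z b)) =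
        y.1 (Sum.inr (finProdFinEquiv (t, b))) := by
    intro y b t
    rw [PowerSeries.coeff_map, hz, PowerSeries.coeff_mk, dif_pos t.2]
    exact (evalAt_ofPolynomial _ _).trans (eval_X _)
  have htr : ∀ y : P, arcTrunc l (arc y) = fun i => y.1 (Sum.inl i) := by
    intro y
    obtain ⟨-, w, hw⟩ := hρ y
    change arcTrunc l (fun j => PowerSeries.map (evalAt y : regularFunctions P →+* k) (ρ j)) = _
    rw [hw, arcTrunc_perturb, arcTrunc_jetArc]
  have hmem : ∀ y : P, arc y ∈ arcsWith f e := fun y =>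
    mem_arcsWith_of_mem_jetStratum hd hr hl (hS y.2) (htr y) (hρ y).1
  -- the coordinates of the trivialization are coordinates of the `n`-jet
  let G : (Fin N × Fin (l + 1)) ⊕ Fin ((n - l) * d) → MvPolynomial (Fin N × Fin (n + 1)) k :=
    Sum.elim (fun i => X (i.1, Fin.castLE (Nat.succ_le_succ hln.le) i.2))
      (fun u => X (σ (Sum.inr (finProdFinEquiv.symm u).2),
        ⟨l + 1 + (finProdFinEquiv.symm u).1, by have := (finProdFinEquiv.symm u).1.2; omega⟩))
  let Φ : Jet k N n → AffSpace k ((Fin N × Fin (l + 1)) ⊕ Fin ((n - l) * d)) :=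
    fun x j => eval x (G j)
  let Ψ : AffSpace k ((Fin N × Fin (l + 1)) ⊕ Fin ((n - l) * d)) → Jet k N n := fun y i =>
    if h : y ∈ P then evalAt ⟨y, h⟩ (PowerSeries.coeff (i.2 : ℕ) (ρ i.1)) else 0
  have hΨ : ∀ y : P, Ψ y.1 = arcTrunc n (arc y) := by
    intro y
    funext i
    change dite _ _ _ = _
    rw [dif_pos y.2]
    exact (PowerSeries.coeff_map _ _ _).symm
  have hΦl : ∀ x j, Φ x (Sum.inl j) = jetTrunc hln.le x j := fun x j => eval_X _
  have hΦr : ∀ x (t : Fin (n - l)) (b : Fin d), Φ x (Sum.inr (finProdFinEquiv (t, b))) =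
      x (σ (Sum.inr b), ⟨l + 1 + t, by omega⟩) := by
    intro x t b
    change eval x (X _) = _
    rw [eval_X]
    simp only [Equiv.symm_apply_apply]
  have hΦP : Set.MapsTo Φ (jetTrunc hln.le ⁻¹' S) P := by
    intro x hx
    change (fun j => Φ x (Sum.inl j)) ∈ S
    simp only [hΦl]
    exact hx
  have hΨA : ∀ y : P, Ψ y.1 ∈ arcTrunc n '' arcsWith f e ∩ jetTrunc hln.le ⁻¹' S := by
    intro y
    rw [hΨ]
    refine ⟨⟨_, hmem y, rfl⟩, ?_⟩
    rw [Set.mem_preimage, jetTrunc_arcTrunc, htr]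
    exact y.2
  have hΨreg : ∀ i, IsRegularOn P fun y => Ψ y i := fun i =>
    isRegularOn_of_forall_eq (PowerSeries.coeff (i.2 : ℕ) (ρ i.1)) fun y => dif_pos y.2
  have hleft : Set.LeftInvOn Ψ Φ (arcTrunc n '' arcsWith f e ∩ jetTrunc hln.le ⁻¹' S) := by
    rintro _ ⟨⟨γ, hγ, rfl⟩, hγS⟩
    set y : P := ⟨Φ (arcTrunc n γ), hΦP hγS⟩ with hy
    have hyl : (fun i => y.1 (Sum.inl i)) = arcTrunc l γ := funext fun i => hΦl _ _
    change Ψ y.1 = _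
    rw [hΨ, arcTrunc_eq_iff]
    obtain ⟨hg, w, hw⟩ := hρ y
    obtain ⟨L, H, v, hL⟩ := (hmc y.1 y.2).exists_liftData
    rw [hyl] at hw hL
    obtain ⟨w', z', hγ'⟩ := exists_perturb_eq σ (arcTrunc_jetArc (arcTrunc l γ)).symm
    have hg' : ∀ i, aeval γ (f (c i)) = 0 := fun i => hγ.1 _ (Ideal.subset_span ⟨c i, rfl⟩)
    have hzz : ∀ b, PowerSeries.X ^ (n - l) ∣
        PowerSeries.map (evalAt y : regularFunctions P →+* k) (z b) - z' b := by
      intro b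
      rw [PowerSeries.X_pow_dvd_iff]
      intro t ht
      rw [map_sub, hzc y b ⟨t, ht⟩, sub_eq_zero]
      refine (hΦr _ ⟨t, ht⟩ b).trans ?_
      rw [← coeff_perturb_jetArc σ (arcTrunc l γ) w' z' b t, ← hγ']
      rfl
    rw [hw] at hg
    rw [hγ'] at hg'
    have hww := hL.congr_of_congr hg hg' hzz
    intro j
    have h1 : arc y = perturb σ l (jetArc (arcTrunc l γ)) w
      (fun i => PowerSeries.map (evalAt y : regularFunctions P →+* k) (z i)) := hw
    rw [h1, congrFun hγ' j, perturb, perturb, add_sub_add_left_eq_sub, ← mul_sub,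
      show n + 1 = (l + 1) + (n - l) by omega, pow_add]
    refine mul_dvd_mul_left _ ?_
    rcases σ.symm j with a | b
    · exact hww a
    · exact hzz b
  refine ⟨Φ, Ψ, ⟨fun x hx => hΦP hx.2, fun y hy => hΨA ⟨y, hy⟩, hleft, ?_,
    fun j => isRegularOn_eval _ _, hΨreg⟩, hΦl, ?_⟩
  · intro y hy
    have h1 := hΨ ⟨y, hy⟩
    change Ψ y = _ at h1
    funext j
    rcases j with j | u
    · rw [hΦl, h1, jetTrunc_arcTrunc, htr]
    · obtain ⟨⟨t, b⟩, rfl⟩ := finProdFinEquiv.surjective u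
      rw [hΦr, h1]
      obtain ⟨-, w, hw⟩ := hρ ⟨y, hy⟩
      have h2 : arc ⟨y, hy⟩ = _ := hw
      rw [h2]
      change PowerSeries.coeff (l + 1 + (t : ℕ)) _ = _
      rw [coeff_perturb_jetArc, hzc]
  -- an `n`-jet over `S` comes from an arc of the stratum if and only if it is fixed by `Ψ ∘ Φ`
  · obtain ⟨C, hC, hC'⟩ := exists_isClosed_of_forall_isRegularOn
      (S := jetTrunc hln.le ⁻¹' S) (fun i x => Ψ (Φ x) i - x i) (fun i => by
        rw [isRegularOn_iff]
        refine Subalgebra.sub_mem _ ((isRegularOn_iff _).1 ((hΨreg i).comp_eval G hΦP)) ?_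
        have := (isRegularOn_iff _).1 (isRegularOn_eval (jetTrunc hln.le ⁻¹' S)
          (X i : MvPolynomial (Fin N × Fin (n + 1)) k))
        simpa only [eval_X] using this)
    refine ⟨C, hC, ?_⟩
    rw [← hC']
    ext x
    constructor
    · intro hx
      refine ⟨hx.2, fun i => ?_⟩
      rw [hleft hx, sub_self]
    · rintro ⟨hx, hx'⟩
      have : Ψ (Φ x) = x := funext fun i => sub_eq_zero.1 (hx' i)
      rw [← this]
      exact hΨA ⟨_, hΦP hx⟩

end Strata

end ArcTruncation

/-! ### Affine fibres and piecewise triviality -/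

namespace ArcTruncation
open MvPolynomial Topology regularFunctions

variable {k : Type*} [Field k]

attribute [local instance] zariskiTopology

section Main

variable {N m d r l : ℕ} {f : Fin m → MvPolynomial (Fin N) k} {e : Fin r → ℕ}

theorem iUnion_jetStratum_eq [IsAlgClosed k]
    (hd : IsMinComponentDim (Ideal.span (Set.range f)) d)
    (hr : r = N - d) (hl : ∀ i, e i ≤ l) :
    ⋃ i : (Fin r → Fin m) × (Fin r ⊕ Fin d ≃ Fin N) × Fin (l * r + 1),
      jetStratum f e l i.1 i.2.1 i.2.2 = arcTrunc l '' arcsWith f e := by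
  have hrd : r + d = N := by have := hd.le; omega
  apply Set.Subset.antisymm
  · exact Set.iUnion_subset fun i => fun θ hθ => hθ.1
  · rintro _ ⟨γ, hγ, rfl⟩
    obtain ⟨c, σ, E, hE, h⟩ := exists_minorConditions_jetArc hrd hl hγ
    exact Set.mem_iUnion.2 ⟨⟨c, σ, E, Nat.lt_succ_of_le hE⟩, ⟨γ, hγ, rfl⟩, h⟩

theorem zariskiConstructible_image_arcsWith [IsAlgClosed k]
    (hd : IsMinComponentDim (Ideal.span (Set.range f)) d)
    (hr : r = N - d) (hl : ∀ i, e i ≤ l) : ZariskiConstructible (arcTrunc l '' arcsWith f e) := by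
  by_cases he : Monotone e
  · rw [← iUnion_jetStratum_eq hd hr hl]
    exact IsConstructible.iUnion fun i =>
      isConstructible_of_isLocallyClosed (isLocallyClosed_jetStratum hd hr he hl _ _ _)
  -- invariant factors are increasing by definition, so there are no arcs
  · have : arcsWith f e = ∅ := Set.eq_empty_of_forall_notMem fun γ hγ => he hγ.2.2.1
    rw [this, Set.image_empty]
    exact IsConstructible.empty

theorem isPiecewiseTrivialFibration_jetTrunc [IsAlgClosed k]
    (hd : IsMinComponentDim (Ideal.span (Set.range f)) d) (hr : r = N - d) (hl : ∀ i, e i ≤ l)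
    {n : ℕ} (hln : l < n) :
    IsPiecewiseTrivialFibration (arcTrunc n '' arcsWith f e) (arcTrunc l '' arcsWith f e)
      (jetTrunc hln.le) ((n - l) * d) := by
  refine ⟨?_, ?_⟩
  · rintro _ ⟨γ, hγ, rfl⟩
    exact ⟨γ, hγ, rfl⟩
  by_cases he : Monotone e
  · obtain ⟨parts, hfin, hdisj, hunion, hparts⟩ := exists_partition_of_isLocallyClosed
      (fun i : (Fin r → Fin m) × (Fin r ⊕ Fin d ≃ Fin N) × Fin (l * r + 1) =>
        jetStratum f e l i.1 i.2.1 i.2.2)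
      (fun i => isLocallyClosed_jetStratum hd hr he hl _ _ _)
    refine ⟨parts, hfin, hdisj, hunion.trans (iUnion_jetStratum_eq hd hr hl),
      fun S hS => ?_⟩
    obtain ⟨hSl, i, hSi⟩ := hparts S hS
    obtain ⟨Φ, Ψ, hiso, hΦ, C, hC, hC'⟩ := exists_isIsoOn hd hr hl hln hSi
    refine ⟨hSl, ?_, Φ, Ψ, hiso, fun x _ j => hΦ x j⟩
    rw [ZariskiLocallyClosed, hC']
    exact (hSl.preimage (continuous_jetTrunc hln.le)).inter hC.isLocallyClosed
  · have : arcsWith f e = ∅ := Set.eq_empty_of_forall_notMem fun γ hγ => he hγ.2.2.1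
    refine ⟨∅, Set.finite_empty, Set.pairwiseDisjoint_empty, ?_, fun S hS => hS.elim⟩
    rw [this, Set.image_empty, Set.sUnion_empty]

/-- The jets of the arcs with a given `l`-jet form an affine space. -/
theorem isoAffine_image_sameJet [IsAlgClosed k]
    (hd : IsMinComponentDim (Ideal.span (Set.range f)) d)
    (hr : r = N - d) (hl : ∀ i, e i ≤ l) {n : ℕ} (hln : l < n) {γ : Arc k N}
    (hγ : γ ∈ arcsWith f e) :
    IsoAffine (arcTrunc n '' (arcs (Ideal.span (Set.range f)) ∩ sameJet l γ)) ((n - l) * d) := by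
  have hrd : r + d = N := by have := hd.le; omega
  obtain ⟨c, σ, E, hE, h⟩ := exists_minorConditions_jetArc hrd hl hγ
  have hS : {arcTrunc l γ} ⊆ jetStratum f e l c σ E := by
    rintro _ rfl
    exact ⟨⟨γ, hγ, rfl⟩, h⟩
  obtain ⟨Φ, Ψ, hiso, hΦ, C, hC, hC'⟩ := exists_isIsoOn hd hr hl hln hS
  have heq : arcTrunc n '' (arcs (Ideal.span (Set.range f)) ∩ sameJet l γ) =
      arcTrunc n '' arcsWith f e ∩ jetTrunc hln.le ⁻¹' {arcTrunc l γ} := by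
    ext x
    constructor
    · rintro ⟨ρ, ⟨hρ, hργ⟩, rfl⟩
      exact ⟨⟨ρ, mem_arcsWith_of_arcTrunc_eq hd hr hl hγ hρ hργ, rfl⟩, hργ⟩
    · rintro ⟨⟨ρ, hρ, rfl⟩, hργ⟩
      exact ⟨ρ, ⟨hρ.1, hργ⟩, rfl⟩
  have hpoint : IsClosed ({arcTrunc l γ} : Set (Jet k N l)) := by
    refine (zariskiClosed_iff _).2 ⟨Set.range fun j => X j - MvPolynomial.C (arcTrunc l γ j), ?_⟩
    ext x
    simp only [Set.mem_singleton_iff, Set.mem_ofPred_eq, Set.forall_mem_range, map_sub, eval_X,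
      eval_C, sub_eq_zero]
    exact _root_.funext_iff
  rw [heq]
  refine ⟨?_, fun x u => Φ x (Sum.inr u), fun u => Ψ (Sum.elim (arcTrunc l γ) u), ?_⟩
  · rw [ZariskiClosed, hC']
    exact (hpoint.preimage (continuous_jetTrunc hln.le)).inter hC
  · have hmaps : ∀ u, Sum.elim (arcTrunc l γ) u ∈ prodAffine {arcTrunc l γ} ((n - l) * d) :=
      fun u => rfl
    refine ⟨Set.mapsTo_univ _ _, fun u _ => hiso.mapsTo_symm (hmaps u), fun x hx => ?_,
      fun u _ => ?_, fun j => hiso.regular _, fun i => ?_⟩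
    · have h1 : Sum.elim (arcTrunc l γ) (fun u => Φ x (Sum.inr u)) = Φ x := by
        funext j
        rcases j with j | u
        · rw [hΦ, show jetTrunc hln.le x = arcTrunc l γ from hx.2]; rfl
        · rfl
      change Ψ (Sum.elim _ _) = x
      rw [h1]
      exact hiso.left_inv hx
    · funext j
      exact congrFun (hiso.right_inv (hmaps u)) (Sum.inr j)
    · have h1 := (hiso.regular_symm i).comp_eval (S := Set.univ)
        (Sum.elim (fun j => MvPolynomial.C (arcTrunc l γ j)) X)
      have h2 : ∀ u : AffSpace k (Fin ((n - l) * d)), (fun j => eval u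
          (Sum.elim (fun j => MvPolynomial.C (arcTrunc l γ j)) X j)) = Sum.elim (arcTrunc l γ) u := by
        intro u
        funext j
        rcases j with j | j <;> simp
      simp only [h2] at h1
      refine h1 fun u _ => ?_
      change (fun j => eval u _) ∈ _
      rw [h2]
      exact hmaps u

/-- The arcs on a complete intersection containing the scheme, with the same invariant factors at `γ`,
are near `γ` the arcs on the scheme. -/
theorem arcs_inter_sameJet_eq [IsAlgClosed k]
    (hd : IsMinComponentDim (Ideal.span (Set.range f)) d)
    (hr : r = N - d) (hl : ∀ i, e i ≤ l) {γ : Arc k N} (hγ : γ ∈ arcs (Ideal.span (Set.range f)))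
    {g : Fin r → MvPolynomial (Fin N) k} (hg : ∀ i, g i ∈ Ideal.span (Set.range f))
    (hγg : γ ∈ arcsWith g e) :
    arcs (Ideal.span (Set.range g)) ∩ sameJet l γ =
      arcs (Ideal.span (Set.range f)) ∩ sameJet l γ := by
  have hrd : r + d = N := by have := hd.le; omega
  obtain ⟨c, σ, E, h⟩ := hγg.2.exists_minorConditions hrd hl hγg.1
  obtain ⟨L, H, v, hL⟩ := h.exists_liftData
  have hle : Ideal.span (Set.range g) ≤ Ideal.span (Set.range f) := by
    rw [Ideal.span_le]
    rintro _ ⟨i, rfl⟩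
    exact hg i
  refine Set.Subset.antisymm (fun ρ hρ => ⟨?_, hρ.2⟩) fun ρ hρ => ⟨fun F hF => hρ.1 F (hle hF), hρ.2⟩
  exact hL.mem_arcs_of_arcTrunc_eq hd hr (fun i => hg (c i)) rfl hρ.2 hγ
    fun i => hρ.1 _ (Ideal.subset_span ⟨c i, rfl⟩)

end Main

end ArcTruncation

theorem proposition5 {k : Type*} [Field k] [IsAlgClosed k] (N m d r : ℕ)
    (f : Fin m → MvPolynomial (Fin N) k)
    (hd : IsMinComponentDim (Ideal.span (Set.range f)) d) (hr : r = N - d) :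
    (∀ γ ∈ arcs (Ideal.span (Set.range f)) \ arcs (jacIdeal (Ideal.span (Set.range f)) r),
      ∀ (p : ℕ) (e : Fin p → ℕ), HasInvariantFactors f γ e →
        p = r ∧
        (∀ g : Fin r → MvPolynomial (Fin N) k, (∀ i, g i ∈ Ideal.span (Set.range f)) →
          γ ∈ arcsWith g e →
          ∀ l : ℕ, (∀ i, e i ≤ l) →
            arcs (Ideal.span (Set.range g)) ∩ sameJet l γ =
              arcs (Ideal.span (Set.range f)) ∩ sameJet l γ) ∧
        (∀ l n : ℕ, (∀ i, e i ≤ l) → l < n →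
          IsoAffine (arcTrunc n '' (arcs (Ideal.span (Set.range f)) ∩ sameJet l γ))
            ((n - l) * d))) ∧
    (∀ e : Fin r → ℕ,
      (∀ l : ℕ, (∀ i, e i ≤ l) →
        ZariskiConstructible (arcTrunc l '' arcsWith f e)) ∧
      (∀ (l n : ℕ) (hln : l < n), (∀ i, e i ≤ l) →
        IsPiecewiseTrivialFibration (arcTrunc n '' arcsWith f e) (arcTrunc l '' arcsWith f e)
          (jetTrunc hln.le) ((n - l) * d))) := by
  refine ⟨?_, fun e => ⟨fun l hl => zariskiConstructible_image_arcsWith hd hr hl,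
    fun l n hln hl => isPiecewiseTrivialFibration_jetTrunc hd hr hl hln⟩⟩
  rintro γ ⟨hγ, hJ⟩ p e he
  obtain rfl : p = r := le_antisymm (hr ▸ he.le_codim hd hγ) (he.le_of_notMem_jacIdeal hγ hJ)
  exact ⟨rfl, fun g hg hγg l hl => arcs_inter_sameJet_eq hd hr hl hγ hg hγg,
    fun l n hl hln => isoAffine_image_sameJet hd hr hl hln ⟨hγ, he⟩⟩
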